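/- For $c\in\mathbb C$, $\theta\in\mathbb R$ and $0<\alpha\le\pi/2$ let $S_\alpha=\{c+\rho e^{i(\theta+\varphi)} : \rho>0,\ |\varphi|<\alpha\}$ be an open convex sector of angle $2\alpha$ in $\mathbb C$ (a half-plane if $\alpha=\pi/2$). For a convex domain $\Omega\subset\mathbb C$ with boundary parametrized by arclength $s$ and with unit outward normal $\nu$ (defined off the corners), put $\mu(\sigma,z)=\frac1{2\pi}\Big(\frac{\nu}{\sigma-z}+\frac{\bar\nu}{\bar\sigma-\bar z}\Big)=\frac1\pi\frac{d}{ds}\arg(\sigma-z)$, and let $$Pg(z)=\int_{\partial\Omega\setminus\{z\}}g(\sigma)\,\mu(\sigma,z)\,ds$$ for bounded continuous $g$ on $\partial\Omega$; the formula is used at the points $z\in\partial\Omega$ which are not corners, and $Pg$ is extended to the corners by continuity. When $I+P$ is invertible on the space of bounded continuous functions on $\partial\Omega$, set $$C_N(\Omega)=\sup\{2\,\|(I+P)^{-1}r\|_{L^\infty(\partial\Omega)} : r \text{ rational},\ |r|\le1\text{ in }\Omega\}.$$ Moreover let $$C_{cb}(\Omega)=\sup\{\|R(A)\| : \overline{W(A)}\subset\Omega,\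 \|R(z)\|\le1\ \ \forall z\in\Omega\},$$ the supremum being over all complex Hilbert spaces $H$, all bounded linear operators $A$ on $H$ (with numerical range $W(A)=\{\langle Ax,x\rangle : \|x\|=1\}$), all $m,n$, and all rational functions $R$ with values in the complex $m\times n$ matrices, with the Euclidean operator norm on the matrices. Theorem. For every sector $S_\alpha$ of angle $2\alpha$ with $0<\alpha\le\pi/2$, the operator $P$ maps the bounded continuous functions on $\partial S_\alpha$ to themselves, $I+P$ is invertible there, and $$C_N(S_\alpha)\le 2-\frac2\pi\log\tan\Big(\frac{\alpha\pi}{4(\pi-\alpha)}\Big),\qquad C_{cb}(S_\alpha)\le\frac{\pi-\alpha}{\pi}\,C_N(S_\alpha).$$ Furthermore $$C_N(S_\alpha)=\frac2\pi\log\frac1\alpha+O(1),$$ that is, there is an absolute constant $K$ with $\big|C_N(S_\alpha)-\frac2\pi\log\frac1\alpha\big|\le K$ for all sectors $S_\alpha$ with $0<\alpha\le\pi/2$. -/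

import Mathlib

open MeasureTheory
open scoped BoundedContinuousFunction ENNReal ComplexConjugate

universe u

/-- The open sector with vertex `c`, axis in the direction `exp (θ i)` and opening angle `2 α`. -/
def sector (c : ℂ) (θ α : ℝ) : Set ℂ :=
  {z | z ≠ c ∧ |Complex.arg ((z - c) * Complex.exp (-(θ * Complex.I)))| < α}

/-- `ν` is a unit outward normal of the convex set `Ω` at the point `σ`. -/
def IsOutwardNormal (Ω : Set ℂ) (σ ν : ℂ) : Prop :=
  ‖ν‖ = 1 ∧ ∀ w ∈ Ω, (conj ν * (w - σ)).re ≤ 0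

/-- The boundary of the convex set `Ω` has a tangent at `σ`, that is, `σ` is not a corner. -/
def HasTangentAt (Ω : Set ℂ) (σ : ℂ) : Prop :=
  ∃! ν : ℂ, IsOutwardNormal Ω σ ν

open Classical in
/-- The unit outward normal of the convex set `Ω` at the boundary point `σ`; it is set to `0` at
corners (there are countably many). -/
noncomputable def outwardNormal (Ω : Set ℂ) (σ : ℂ) : ℂ :=
  if h : HasTangentAt Ω σ then h.choose else 0

/-- The kernel of the double layer potential,
`μ(σ, z) = (1 / 2π) (ν / (σ - z) + conj ν / (conj σ - conj z)) = (1 / π) d/ds arg (σ - z)`. -/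
noncomputable def doubleLayerKernel (Ω : Set ℂ) (σ z : ℂ) : ℝ :=
  (outwardNormal Ω σ / (σ - z)).re / Real.pi

/-- Arclength on the boundary of `Ω`. -/
noncomputable def arclength (Ω : Set ℂ) : Measure (frontier Ω) :=
  Measure.hausdorffMeasure 1

/-- `f = P g`, where `P` is the operator of the double layer potential on the bounded continuous
functions on the boundary,
`P g (z) = ∫_{∂Ω \ {z}} g(σ) μ(σ, z) ds = (1 / π) ∫_{∂Ω \ {z}} g(σ) d arg (σ - z)`.
The formula is imposed at the boundary points with a tangent; at the corners the value of `P g` is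
the one given by continuity. -/
def IsDoubleLayer (Ω : Set ℂ) (g f : frontier Ω →ᵇ ℂ) : Prop :=
  ∀ z : frontier Ω, HasTangentAt Ω z →
    IntegrableOn (fun σ : frontier Ω => (doubleLayerKernel Ω σ z : ℂ) * g σ) {z}ᶜ (arclength Ω) ∧
    f z = ∫ σ in {z}ᶜ, (doubleLayerKernel Ω σ z : ℂ) * g σ ∂(arclength Ω)

/-- The operator `P` is defined on the bounded continuous functions on the boundary, with values in
the same space, and `I + P` is invertible there. -/
def IsNeumannInvertible (Ω : Set ℂ) : Prop :=
  (∀ g : frontier Ω →ᵇ ℂ, ∃ f : frontier Ω →ᵇ ℂ, IsDoubleLayer Ω g f) ∧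
  ∀ f : frontier Ω →ᵇ ℂ, ∃! h : frontier Ω →ᵇ ℂ, IsDoubleLayer Ω h (f - h)

/-- The constant `C_N(Ω)`: the supremum of `2 ‖(I + P)⁻¹ r‖` over the rational functions `r` with
`|r| ≤ 1` in `Ω`. Here `f` is the restriction of `r` to the boundary and `h = (I + P)⁻¹ f`. -/
noncomputable def constN (Ω : Set ℂ) : ℝ≥0∞ :=
  sSup {K | ∃ (r : RatFunc ℂ) (f h : frontier Ω →ᵇ ℂ),
    (∀ z ∈ Ω, ‖r.eval (RingHom.id ℂ) z‖ ≤ 1) ∧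
    (∀ z : frontier Ω, f z = r.eval (RingHom.id ℂ) z) ∧
    IsDoubleLayer Ω h (f - h) ∧
    K = ENNReal.ofReal (2 * ‖h‖)}

section Operators

variable {H : Type u} [NormedAddCommGroup H] [InnerProductSpace ℂ H]

/-- The numerical range of `A`; Mathlib's inner product is linear in its second argument. -/
def numRange (A : H →L[ℂ] H) : Set ℂ :=
  {w | ∃ x : H, ‖x‖ = 1 ∧ w = inner ℂ x (A x)}

/-- `r(A)` for a rational function `r` without poles in the spectrum of `A`. -/
noncomputable def ratEval (r : RatFunc ℂ) (A : H →L[ℂ] H) : H →L[ℂ] H :=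
  Polynomial.aeval A r.num * Ring.inverse (Polynomial.aeval A r.denom)

/-- The operator `H ^ n → H ^ m` given by a matrix of operators on `H`. -/
noncomputable def blockOperator {m n : ℕ} (T : Matrix (Fin m) (Fin n) (H →L[ℂ] H)) :
    PiLp 2 (fun _ : Fin n => H) →L[ℂ] PiLp 2 (fun _ : Fin m => H) :=
  ((PiLp.continuousLinearEquiv 2 ℂ (fun _ : Fin m => H)).symm :
      (Fin m → H) →L[ℂ] PiLp 2 (fun _ : Fin m => H)).comp
    (ContinuousLinearMap.pi fun i =>
      ∑ j, (T i j).comp (PiLp.proj 2 (fun _ : Fin n => H) j))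

end Operators

/-- The operator norm of a complex `m × n` matrix for the Euclidean norms. -/
noncomputable def matrixNorm {m n : ℕ} (M : Matrix (Fin m) (Fin n) ℂ) : ℝ :=
  ‖(Matrix.toEuclideanLin M).toContinuousLinearMap‖

/-- The constant `C_cb(Ω)`: the supremum of `‖R(A)‖` over all complex Hilbert spaces `H`, all
bounded operators `A` on `H` with the closure of the numerical range in `Ω`, and all rational
functions `R` with matrix values (of any size) such that `‖R(z)‖ ≤ 1` for `z ∈ Ω`. -/
noncomputable def constCB.{v} (Ω : Set ℂ) : ℝ≥0∞ :=
  sSup {K | ∃ (H : Type v) (_ : NormedAddCommGroup H) (_ : InnerProductSpace ℂ H)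
    (_ : CompleteSpace H) (A : H →L[ℂ] H) (m n : ℕ) (R : Matrix (Fin m) (Fin n) (RatFunc ℂ)),
    closure (numRange A) ⊆ Ω ∧
    (∀ z ∈ Ω, matrixNorm (R.map fun r => r.eval (RingHom.id ℂ) z) ≤ 1) ∧
    K = ENNReal.ofReal ‖blockOperator (R.map fun r => ratEval r A)‖}

/-! Logarithmic coordinates z = c + t exp(w + iθ) turn the sector into the strip |Im w| < α, its
sides into the lines Im w = ±α, and homotheties into translations. The double layer kernel becomes a
convolution kernel: a side seen from a point at angular distance γ contributes `stripKernel γ`,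
whose total mass is (π - γ)/π. From a boundary point its own side contributes nothing and the
opposite side has γ = 2α. So P is convolution with `stripKernel (2 * α)` combined with the exchange
of the two sides. Its norm is at most 1 - 2α/π < 1, and I + P is inverted by a Neumann series. That
alone gives only C_N ≤ π/α.

The logarithmic bound comes from the holomorphy of r. If f is the boundary value of r, then (I +
P)⁻¹ f = f - (1/2) K f, where K f on one side integrates `sectorKernel α` against f on the other
side (`solution_sidePoint`). For the verification all contours are shifted to the central line Im w
= 0, where the equation becomes a pointwise identity between kernels. That identity is the residue
computation `integral_stripKernel_mul_sectorKernel` of the convolution of the two kernels.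
Uniqueness follows from the contraction property. The L¹ norm of `sectorKernel α` has an elementary
primitive and equals -(2/π) log tan(απ/(4(π - α))), so that C_N is at most 2 plus this norm.

For the lower bound, 2‖h‖ ≥ |K f| - 2 is evaluated at the boundary point at distance 1 from the
vertex, for r a Cayley transform of the N-th power, N being the integer part of π/(2α). Up to sign
the imaginary part of the integrand is even, nonnegative, and close to 1/(πy) on 2α ≤ y ≤ 1. This
produces (2/π) log(1/α) up to a bounded error.

For C_cb, the double layer potential of the same h reproduces r inside the sector
(`interior_identity`, `integral_solution`). The double layer kernel is the real part of a Cauchy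
kernel, so the potential is a holomorphic function plus an antiholomorphic one. As the sum is
holomorphic, the antiholomorphic part is constant. After subtraction of the values at a base point,
the Cauchy integral of h is therefore r and that of the conjugate of h vanishes (`scalar_identity`).
Both relations are power series identities, and they extend to operators by analytic continuation
along s ↦ s(A - z) from s = 0 to s = 1. Hence r(A) is the integral of h against an operator density.
This density is positive because W(A) lies in every supporting half-plane, and its total mass 2(π -
α)/π is read off from the case r = 1.

For matrix valued R the forms v*Rw are scalar rational functions, so the solutions h satisfy the
bound C_N/2 as matrices. A Gram decomposition of the positive density transfers this bound to
vectors of H, and the product of C_N/2 and 2(π - α)/π is the constant in the theorem. -/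

/-! ### Contour integrals over horizontal lines. -/

open Filter Topology Complex in
theorem integrable_of_quadratic_decay {f : ℝ → ℂ} (hc : Continuous f) {C R : ℝ}
    (h : ∀ x, R ≤ |x| → ‖f x‖ ≤ C / (1 + x ^ 2)) : Integrable f := by
  obtain ⟨B, hB⟩ := (isCompact_Icc (a := -|R|) (b := |R|)).exists_bound_of_continuousOn
    hc.continuousOn
  have hB0 : 0 ≤ B := (norm_nonneg _).trans (hB 0 (by simp))
  refine Integrable.mono' (integrable_inv_one_add_sq.const_mul (|C| + B * (1 + R ^ 2)))
    hc.aestronglyMeasurable (Eventually.of_forall fun x => ?_)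
  have hx : 0 < 1 + x ^ 2 := by positivity
  rw [← div_eq_mul_inv]
  rcases le_or_gt R |x| with hR | hR
  · refine (h x hR).trans ?_
    gcongr
    have := le_abs_self C
    nlinarith [sq_nonneg R]
  · have hR' : |x| ≤ |R| := hR.le.trans (le_abs_self R)
    have h1 := hB x (abs_le.1 hR')
    have h2 : x ^ 2 ≤ R ^ 2 := sq_le_sq.2 hR'
    rw [le_div_iff₀ hx]
    calc ‖f x‖ * (1 + x ^ 2) ≤ B * (1 + R ^ 2) := by gcongr
      _ ≤ _ := by have := abs_nonneg C; linarith

/-- A function on a horizontal strip decays quadratically at both ends of the strip. -/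
def StripDecay (Φ : ℂ → ℂ) (a b : ℝ) : Prop :=
  ∃ C R : ℝ, ∀ z : ℂ, a ≤ z.im → z.im ≤ b → R ≤ |z.re| → ‖Φ z‖ ≤ C / (1 + z.re ^ 2)

theorem StripDecay.sub {Φ Ψ : ℂ → ℂ} {a b : ℝ} (h : StripDecay Φ a b) (h' : StripDecay Ψ a b) :
    StripDecay (fun z => Φ z - Ψ z) a b := by
  obtain ⟨C, R, h⟩ := h
  obtain ⟨C', R', h'⟩ := h'
  refine ⟨C + C', max R R', fun z h1 h2 h3 => (norm_sub_le _ _).trans ?_⟩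
  rw [add_div]
  exact add_le_add (h z h1 h2 ((le_max_left _ _).trans h3))
    (h' z h1 h2 ((le_max_right _ _).trans h3))

theorem StripDecay.const_mul {Φ : ℂ → ℂ} {a b : ℝ} (h : StripDecay Φ a b) (c : ℂ) :
    StripDecay (fun z => c * Φ z) a b := by
  obtain ⟨C, R, h⟩ := h
  refine ⟨‖c‖ * C, R, fun z h1 h2 h3 => ?_⟩
  rw [norm_mul, mul_div_assoc]
  exact mul_le_mul_of_nonneg_left (h z h1 h2 h3) (norm_nonneg _)

theorem StripDecay.mul_bounded {Φ G : ℂ → ℂ} {a b : ℝ} (h : StripDecay Φ a b) {M R' : ℝ}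
    (hG : ∀ z : ℂ, a ≤ z.im → z.im ≤ b → R' ≤ |z.re| → ‖G z‖ ≤ M) :
    StripDecay (fun z => Φ z * G z) a b := by
  obtain ⟨C, R, h⟩ := h
  refine ⟨C * M, max R R', fun z h1 h2 h3 => ?_⟩
  have e1 := h z h1 h2 ((le_max_left _ _).trans h3)
  have e2 := hG z h1 h2 ((le_max_right _ _).trans h3)
  rw [norm_mul, mul_div_right_comm]
  exact mul_le_mul e1 e2 (norm_nonneg _) ((norm_nonneg _).trans e1)

theorem StripDecay.integrable {Φ : ℂ → ℂ} {a b τ : ℝ} (h : StripDecay Φ a b) (ha : a ≤ τ)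
    (hb : τ ≤ b) (hc : Continuous fun x : ℝ => Φ (x + τ * Complex.I)) :
    Integrable fun x : ℝ => Φ (x + τ * Complex.I) := by
  obtain ⟨C, R, h⟩ := h
  refine integrable_of_quadratic_decay hc (C := C) (R := R) fun x hx => ?_
  simpa using h (x + τ * Complex.I) (by simpa) (by simpa) (by simpa)

theorem ContinuousOn.continuous_line {Φ : ℂ → ℂ} {a b τ : ℝ}
    (h : ContinuousOn Φ (Complex.im ⁻¹' Set.Icc a b)) (ha : a ≤ τ) (hb : τ ≤ b) :
    Continuous fun x : ℝ => Φ (x + τ * Complex.I) := by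
  refine h.comp_continuous (by fun_prop) fun x => ?_
  simp [ha, hb]

open Filter Topology in
/-- The integral of a holomorphic function over a horizontal line does not depend on the line. -/
theorem integral_line_eq_of_differentiableOn {Φ : ℂ → ℂ} {a b : ℝ} (hab : a < b)
    (hc : ContinuousOn Φ (Complex.im ⁻¹' Set.Icc a b))
    (hd : DifferentiableOn ℂ Φ (Complex.im ⁻¹' Set.Ioo a b)) (hD : StripDecay Φ a b) :
    ∫ x : ℝ, Φ (x + a * Complex.I) = ∫ x : ℝ, Φ (x + b * Complex.I) := by
  have ia := hD.integrable le_rfl hab.le (hc.continuous_line le_rfl hab.le)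
  have ib := hD.integrable hab.le le_rfl (hc.continuous_line hab.le le_rfl)
  obtain ⟨C, R, hD⟩ := hD
  have ta := intervalIntegral_tendsto_integral ia tendsto_neg_atTop_atBot tendsto_id
  have tb := intervalIntegral_tendsto_integral ib tendsto_neg_atTop_atBot tendsto_id
  -- The map `s` is X or -X, so that both vertical sides of the rectangle are treated at once.
  have vert : ∀ s : ℝ → ℝ, (∀ X, |s X| = |X|) →
      Tendsto (fun X : ℝ => ∫ y in a..b, Φ (s X + y * Complex.I)) atTop (𝓝 0) := by
    intro s hs
    have hlim : Tendsto (fun X : ℝ => C / (1 + X ^ 2) * |b - a|) atTop (𝓝 0) := by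
      have : Tendsto (fun X : ℝ => 1 + X ^ 2) atTop atTop :=
        tendsto_atTop_add_const_left _ _ (tendsto_pow_atTop two_ne_zero)
      simpa using (this.const_div_atTop C).mul_const |b - a|
    refine squeeze_zero_norm' ?_ hlim
    filter_upwards [eventually_ge_atTop R, eventually_ge_atTop 0] with X hX hX0
    refine intervalIntegral.norm_integral_le_of_norm_le_const fun y hy => ?_
    rw [Set.uIoc_of_le hab.le] at hy
    have := hD (s X + y * Complex.I) (by simpa using hy.1.le) (by simpa using hy.2)
      (by simpa [hs, abs_of_nonneg hX0] using hX)
    have e : s X ^ 2 = X ^ 2 := by rw [← sq_abs, hs, sq_abs]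
    simpa [e] using this
  have key : ∀ X : ℝ, 0 < X → (∫ x in -X..X, Φ (x + a * Complex.I)) -
      (∫ x in -X..X, Φ (x + b * Complex.I)) + Complex.I • (∫ y in a..b, Φ (X + y * Complex.I)) -
      Complex.I • (∫ y in a..b, Φ ((-X : ℝ) + y * Complex.I)) = 0 := by
    intro X hX
    have := Complex.integral_boundary_rect_eq_zero_of_continuousOn_of_differentiableOn Φ
      ⟨-X, a⟩ ⟨X, b⟩ (hc.mono ?_) (hd.mono ?_)
    · simpa using this
    · intro z hz
      rw [Complex.mem_reProdIm] at hz
      simpa [Set.uIcc_of_le hab.le] using hz.2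
    · intro z hz
      rw [Complex.mem_reProdIm] at hz
      simpa [hab.le] using hz.2
  have lim := (((ta.sub tb).add ((vert (fun X => X) fun X => rfl).const_smul Complex.I)).sub
    ((vert (fun X => -X) fun X => abs_neg X).const_smul Complex.I))
  have := tendsto_nhds_unique (lim.congr' ?_) (tendsto_const_nhds (x := (0 : ℂ)))
  · simpa [sub_eq_zero] using this
  · filter_upwards [eventually_gt_atTop 0] with X hX
    simpa using key X hX

open Filter Topology in
-- The second pole p + iM always lies above the line; it is there only to make the integrand decay
-- quadratically. A primitive is an explicit logarithm minus i times an arctangent. The logarithms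
-- cancel at infinity, and the jumps of the two arctangents cancel or add up according to the side
-- of the line on which p lies.
theorem integral_inv_sub_inv_line {p : ℂ} {τ M : ℝ} (h1 : τ ≠ p.im) (h2 : τ < p.im + M)
    (hi : Integrable fun x : ℝ => ((x : ℂ) + τ * Complex.I - p)⁻¹ -
      ((x : ℂ) + τ * Complex.I - (p + M * Complex.I))⁻¹) :
    ∫ x : ℝ, (((x : ℂ) + τ * Complex.I - p)⁻¹ - ((x : ℂ) + τ * Complex.I - (p + M * Complex.I))⁻¹) =
      if τ < p.im then 0 else -(2 * Real.pi * Complex.I) := by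
  set s := τ - p.im with hs
  set s' := τ - p.im - M with hs'
  have s0 : s ≠ 0 := sub_ne_zero.2 h1
  have s0' : s' < 0 := by rw [hs']; linarith
  -- A branch of log(x - Re p + iσ), up to a constant, that is smooth on the whole line for either
  -- sign of σ.
  let G : ℝ → ℝ → ℂ := fun σ x => ((Real.log ((x - p.re) ^ 2 + σ ^ 2) / 2 : ℝ) : ℂ) -
    Complex.I * ((Real.arctan ((x - p.re) / σ) : ℝ) : ℂ)
  have hG : ∀ σ : ℝ, σ ≠ 0 → ∀ x : ℝ,
      HasDerivAt (G σ) ((x - p.re : ℝ) + σ * Complex.I : ℂ)⁻¹ x := by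
    intro σ hσ x
    have pos : 0 < (x - p.re) ^ 2 + σ ^ 2 := by positivity
    have d1 : HasDerivAt (fun x : ℝ => Real.log ((x - p.re) ^ 2 + σ ^ 2) / 2)
        ((x - p.re) / ((x - p.re) ^ 2 + σ ^ 2)) x := by
      have := (((((hasDerivAt_id x).sub_const p.re).pow 2).add_const (σ ^ 2)).log pos.ne').div_const 2
      convert! this using 1
      simp
      field_simp
    have d2 : HasDerivAt (fun x : ℝ => Real.arctan ((x - p.re) / σ))
        (σ / ((x - p.re) ^ 2 + σ ^ 2)) x := by
      have := ((((hasDerivAt_id x).sub_const p.re).div_const σ)).arctan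
      convert! this using 1
      simp
      field_simp
      ring
    have := d1.ofReal_comp.sub ((d2.ofReal_comp).const_mul Complex.I)
    convert! this using 1
    have nz : ((x - p.re : ℝ) + σ * Complex.I : ℂ) ≠ 0 := by
      intro h
      have := congrArg Complex.im h
      simp at this
      exact hσ this
    have nz2 : (((x - p.re) ^ 2 + σ ^ 2 : ℝ) : ℂ) ≠ 0 := by exact_mod_cast pos.ne'
    rw [inv_eq_iff_eq_inv, ← one_div, eq_div_iff]
    · push_cast at nz2 ⊢
      field_simp
      linear_combination (-(σ : ℂ) ^ 2) * Complex.I_sq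
    · rw [Complex.ofReal_div, Complex.ofReal_div, ← mul_div_assoc, ← sub_div]
      refine div_ne_zero ?_ nz2
      intro h
      have := congrArg Complex.im h
      simp at this
      exact hσ this
  have arc : ∀ σ : ℝ, 0 < σ → Tendsto (fun x : ℝ => (Real.arctan ((x - p.re) / σ))) atTop
      (𝓝 (Real.pi / 2)) ∧ Tendsto (fun x : ℝ => (Real.arctan ((x - p.re) / σ))) atBot
      (𝓝 (-(Real.pi / 2))) := by
    intro σ hσ
    refine ⟨(Real.tendsto_arctan_atTop.mono_right nhdsWithin_le_nhds).comp ?_,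
      (Real.tendsto_arctan_atBot.mono_right nhdsWithin_le_nhds).comp ?_⟩
    · exact (tendsto_atTop_add_const_right _ (-p.re) tendsto_id).atTop_div_const hσ
    · exact (tendsto_atBot_add_const_right _ (-p.re) tendsto_id).atBot_div_const hσ
  have arcn : ∀ σ : ℝ, σ < 0 → Tendsto (fun x : ℝ => (Real.arctan ((x - p.re) / σ))) atTop
      (𝓝 (-(Real.pi / 2))) ∧ Tendsto (fun x : ℝ => (Real.arctan ((x - p.re) / σ))) atBot
      (𝓝 (Real.pi / 2)) := by
    intro σ hσ
    have := arc (-σ) (by linarith)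
    simp only [div_neg, Real.arctan_neg] at this
    refine ⟨by simpa using this.1.neg, by simpa using this.2.neg⟩
  have tsq : ∀ l : Filter ℝ, Tendsto (fun x : ℝ => (x - p.re) ^ 2) l atTop →
      Tendsto (fun x : ℝ => ((Real.log ((x - p.re) ^ 2 + s ^ 2) / 2 -
        Real.log ((x - p.re) ^ 2 + s' ^ 2) / 2 : ℝ))) l (𝓝 0) := by
    intro l hl
    have q : Tendsto (fun u : ℝ => (u + s ^ 2) / (u + s' ^ 2)) atTop (𝓝 1) := by
      have e : ∀ u : ℝ, 0 < u → 1 + (s ^ 2 - s' ^ 2) / (u + s' ^ 2) = (u + s ^ 2) / (u + s' ^ 2) := by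
        intro u hu
        have : u + s' ^ 2 ≠ 0 := by positivity
        field_simp
        ring
      have := (((tendsto_atTop_add_const_right atTop (s' ^ 2) tendsto_id).const_div_atTop
        (s ^ 2 - s' ^ 2)).const_add 1)
      rw [add_zero] at this
      refine this.congr' ?_
      filter_upwards [eventually_gt_atTop 0] with u hu using e u hu
    have q2 := ((Real.continuousAt_log one_ne_zero).tendsto.comp (q.comp hl)).div_const 2
    simp only [Real.log_one, zero_div] at q2
    refine q2.congr fun x => ?_
    have p1 : 0 < (x - p.re) ^ 2 + s ^ 2 := by positivity
    have p2 : 0 < (x - p.re) ^ 2 + s' ^ 2 := by have := s0'.ne; positivity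
    simp only [Function.comp]
    rw [Real.log_div p1.ne' p2.ne']
    ring
  have sqt : Tendsto (fun x : ℝ => (x - p.re) ^ 2) atTop atTop :=
    (tendsto_pow_atTop two_ne_zero).comp (tendsto_atTop_add_const_right _ (-p.re) tendsto_id)
  have sqb : Tendsto (fun x : ℝ => (x - p.re) ^ 2) atBot atTop := by
    have : Tendsto (fun x : ℝ => (-(x - p.re)) ^ 2) atBot atTop :=
      (tendsto_pow_atTop two_ne_zero).comp
        (tendsto_neg_atBot_atTop.comp (tendsto_atBot_add_const_right _ (-p.re) tendsto_id))
    refine this.congr fun x => ?_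
    ring
  have lim : ∀ (l : Filter ℝ) (A B : ℝ), Tendsto (fun x : ℝ => (x - p.re) ^ 2) l atTop →
      Tendsto (fun x : ℝ => (Real.arctan ((x - p.re) / s))) l (𝓝 A) →
      Tendsto (fun x : ℝ => (Real.arctan ((x - p.re) / s'))) l (𝓝 B) →
      Tendsto (fun x => G s x - G s' x) l (𝓝 (-(Complex.I * ((A - B : ℝ) : ℂ)))) := by
    intro l A B h h1 h2
    have := (((Complex.continuous_ofReal.tendsto _).comp (tsq l h))).sub
      (((Complex.continuous_ofReal.tendsto _).comp (h1.sub h2)).const_mul Complex.I)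
    simp only [Complex.ofReal_zero, zero_sub] at this
    refine this.congr fun x => ?_
    simp only [G, Function.comp]
    push_cast
    ring
  have hder : ∀ x : ℝ, HasDerivAt (fun x => G s x - G s' x)
      (((x : ℂ) + τ * Complex.I - p)⁻¹ - ((x : ℂ) + τ * Complex.I - (p + M * Complex.I))⁻¹) x := by
    intro x
    convert! (hG s s0 x).sub (hG s' s0'.ne x) using 3
    · apply Complex.ext <;> simp [hs]
    · apply Complex.ext <;> simp [hs']
      ring
  split_ifs with hτ
  · have hsn : s < 0 := by rw [hs]; linarith
    rw [integral_of_hasDerivAt_of_tendsto hder hi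
      (lim _ _ _ sqb (arcn s hsn).2 (arcn s' s0').2) (lim _ _ _ sqt (arcn s hsn).1 (arcn s' s0').1)]
    simp
  · have hsn : 0 < s := lt_of_le_of_ne (by rw [hs]; linarith [not_lt.1 hτ]) s0.symm
    rw [integral_of_hasDerivAt_of_tendsto hder hi
      (lim _ _ _ sqb (arc s hsn).2 (arcn s' s0').2) (lim _ _ _ sqt (arc s hsn).1 (arcn s' s0').1)]
    push_cast
    ring

theorem stripDecay_inv_sub_inv (p q : ℂ) (a b : ℝ) :
    StripDecay (fun z => (z - p)⁻¹ - (z - q)⁻¹) a b := by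
  refine ⟨8 * ‖p - q‖, 2 * ‖p‖ + 2 * ‖q‖ + 1, fun z _ _ hz => ?_⟩
  have key : ∀ w : ℂ, ‖w‖ ≤ ‖p‖ + ‖q‖ → |z.re| / 2 ≤ ‖z - w‖ := by
    intro w hw
    have h1 := Complex.abs_re_le_norm z
    have h2 := norm_sub_norm_le z w
    linarith
  have hp := key p (by linarith [norm_nonneg q])
  have hq := key q (by linarith [norm_nonneg p])
  have hz1 : 1 ≤ |z.re| := by linarith [norm_nonneg p, norm_nonneg q]
  have p0 : 0 < ‖z - p‖ := by linarith
  have q0 : 0 < ‖z - q‖ := by linarith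
  show ‖(z - p)⁻¹ - (z - q)⁻¹‖ ≤ _
  rw [inv_sub_inv (norm_pos_iff.1 p0) (norm_pos_iff.1 q0), norm_div, norm_mul,
    div_le_div_iff₀ (by positivity) (by positivity)]
  have e1 : z - q - (z - p) = p - q := by ring
  rw [e1]
  have : 1 + z.re ^ 2 ≤ 8 * (‖z - p‖ * ‖z - q‖) := by
    have h3 : |z.re| / 2 * (|z.re| / 2) ≤ ‖z - p‖ * ‖z - q‖ := by gcongr
    have h4 := sq_abs z.re
    nlinarith
  nlinarith [norm_nonneg (p - q)]

open Filter Topology in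
/-- Residue theorem for horizontal strips and simple poles. -/
theorem integral_line_sub_integral_line_eq_sum_residues {a b : ℝ} (hab : a < b) (P : Finset ℂ)
    (c : ℂ → ℂ) : ∀ {Φ : ℂ → ℂ}, (∀ p ∈ P, a < p.im ∧ p.im < b) →
    ContinuousOn Φ (Complex.im ⁻¹' Set.Icc a b \ P) →
    DifferentiableOn ℂ Φ (Complex.im ⁻¹' Set.Ioo a b \ P) → StripDecay Φ a b →
    (∀ p ∈ P, Tendsto (fun z => (z - p) * Φ z) (𝓝[≠] p) (𝓝 (c p))) →
    (∫ x : ℝ, Φ (x + a * Complex.I)) - ∫ x : ℝ, Φ (x + b * Complex.I) =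
      2 * Real.pi * Complex.I * ∑ p ∈ P, c p := by
  classical
  induction P using Finset.induction_on with
  | empty =>
    intro Φ _ hc hd hD _
    simp only [Finset.coe_empty, Set.sdiff_empty] at hc hd
    simp [integral_line_eq_of_differentiableOn hab hc hd hD]
  | insert p P hp ih =>
    intro Φ hP hc hd hD hres
    have hpim := hP p (Finset.mem_insert_self _ _)
    -- With this M the compensating pole q lies above the strip, since Im p > a.
    set M := b - a + 1 with hM
    set q := p + M * Complex.I with hq
    have hqim : b < q.im := by simp [hq, hM]; linarith
    set E : ℂ → ℂ := fun z => (z - p)⁻¹ - (z - q)⁻¹ with hE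
    set Ψ0 : ℂ → ℂ := fun z => Φ z - c p * E z with hΨ0
    -- Subtracting c p times `E` removes the pole at p and keeps the quadratic decay. The value at p
    -- is redefined by the removable singularity theorem, so that the induction hypothesis applies
    -- with one pole fewer.
    set Ψ : ℂ → ℂ := Function.update Ψ0 p (limUnder (𝓝[≠] p) Ψ0) with hΨ
    have Edec : StripDecay E a b := stripDecay_inv_sub_inv p q a b
    have Edif : ∀ z : ℂ, z.im ≤ b → z ≠ p → DifferentiableAt ℂ E z := by
      intro z hz hzp
      have : z - q ≠ 0 := by
        intro h
        rw [sub_eq_zero.1 h] at hz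
        linarith
      exact ((differentiableAt_id.sub_const p).inv (sub_ne_zero.2 hzp)).sub
        ((differentiableAt_id.sub_const q).inv this)
    have hΨeq : ∀ z, z ≠ p → Ψ z = Ψ0 z := fun z hz => Function.update_of_ne hz _ _
    set U : Set ℂ := Complex.im ⁻¹' Set.Ioo a b \ P with hU
    have hUo : IsOpen U := (isOpen_Ioo.preimage Complex.continuous_im).sdiff P.finite_toSet.isClosed
    have hpU : U ∈ 𝓝 p := hUo.mem_nhds ⟨hpim, by simpa using hp⟩
    have hΨd : DifferentiableOn ℂ Ψ U := by
      refine Complex.differentiableOn_update_limUnder_of_isLittleO hpU ?_ ?_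
      · intro z hz
        have hzp : z ≠ p := by simpa using hz.2
        refine ((hd z ?_).mono ?_).sub
          (((Edif z hz.1.1.2.le hzp).differentiableWithinAt).const_mul (c p))
        · exact ⟨hz.1.1, by simpa [hzp] using hz.1.2⟩
        · intro w hw
          exact ⟨hw.1.1, by
            have : w ≠ p := by simpa using hw.2
            simpa [this] using hw.1.2⟩
      · rw [Asymptotics.isLittleO_iff_tendsto']
        · have t1 := hres p (Finset.mem_insert_self _ _)
          have hqp : p - q ≠ 0 := by
            intro h
            have := congrArg Complex.im h
            simp [hq] at this
            linarith
          have t2 : Tendsto (fun z => (z - p) * (c p * E z)) (𝓝[≠] p) (𝓝 (c p)) := by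
            have : Tendsto (fun z => c p * (1 - (z - p) * (z - q)⁻¹)) (𝓝[≠] p)
                (𝓝 (c p * (1 - (p - p) * (p - q)⁻¹))) := by
              refine Tendsto.mono_left ?_ nhdsWithin_le_nhds
              refine ContinuousAt.tendsto ?_
              have : ContinuousAt (fun z : ℂ => (z - q)⁻¹) p :=
                (continuousAt_id.sub_const q).inv₀ hqp
              fun_prop
            simp only [sub_self, zero_mul, sub_zero, mul_one] at this
            refine this.congr' ?_
            filter_upwards [self_mem_nhdsWithin] with z hz
            have : z - p ≠ 0 := sub_ne_zero.2 hz
            simp only [hE]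
            field_simp
          have t3 : Tendsto (fun z => (z - p) * (Ψ0 z - Ψ0 p)) (𝓝[≠] p) (𝓝 0) := by
            have t4 : Tendsto (fun z => (z - p) * Ψ0 p) (𝓝[≠] p) (𝓝 0) := by
              have : Tendsto (fun z : ℂ => (z - p) * Ψ0 p) (𝓝 p) (𝓝 ((p - p) * Ψ0 p)) :=
                (Continuous.tendsto (by fun_prop) p)
              simpa using this.mono_left nhdsWithin_le_nhds
            have := (t1.sub t2).sub t4
            simp only [sub_self] at this
            refine this.congr fun z => ?_
            simp only [hΨ0]
            ring
          refine t3.congr' ?_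
          filter_upwards [self_mem_nhdsWithin] with z hz
          rw [div_inv_eq_mul, mul_comm]
        · filter_upwards [self_mem_nhdsWithin] with z hz h
          exact absurd (inv_eq_zero.1 h) (sub_ne_zero.2 hz)
    have hΨc : ContinuousOn Ψ (Complex.im ⁻¹' Set.Icc a b \ P) := by
      intro z hz
      by_cases hzp : z = p
      · subst hzp
        exact ((hΨd.differentiableAt hpU).continuousAt).continuousWithinAt
      · have h1 : ContinuousWithinAt Φ (Complex.im ⁻¹' Set.Icc a b \ P) z := by
          have := hc z ⟨hz.1, by simpa [hzp] using hz.2⟩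
          refine this.mono_of_mem_nhdsWithin ?_
          have : ({p}ᶜ : Set ℂ) ∈ 𝓝 z := isOpen_compl_singleton.mem_nhds hzp
          filter_upwards [mem_nhdsWithin_of_mem_nhds this, self_mem_nhdsWithin] with w hw hw2
          have : w ≠ p := hw
          exact ⟨hw2.1, by simpa [this] using hw2.2⟩
        have h2 : ContinuousWithinAt Ψ0 (Complex.im ⁻¹' Set.Icc a b \ P) z :=
          h1.sub ((Edif z hz.1.2 hzp).continuousAt.continuousWithinAt.const_mul _)
        refine h2.congr_of_eventuallyEq ?_ (hΨeq z hzp)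
        have : ({p}ᶜ : Set ℂ) ∈ 𝓝 z := isOpen_compl_singleton.mem_nhds hzp
        filter_upwards [mem_nhdsWithin_of_mem_nhds this] with w hw using hΨeq w hw
    have hΨD : StripDecay Ψ a b := by
      obtain ⟨C, R, h⟩ := hD.sub (Edec.const_mul (c p))
      refine ⟨C, max R (|p.re| + 1), fun z h1 h2 h3 => ?_⟩
      have : z ≠ p := by
        rintro rfl
        have := (le_max_right _ _).trans h3
        linarith
      rw [hΨeq z this]
      exact h z h1 h2 ((le_max_left _ _).trans h3)
    have hrec := ih (Φ := Ψ) (fun p' h => hP p' (Finset.mem_insert_of_mem h)) hΨc hΨd hΨD ?_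
    · have line : ∀ τ : ℝ, a ≤ τ → τ ≤ b → τ ≠ p.im → (∀ p' ∈ P, p'.im ≠ τ) →
          ∫ x : ℝ, Ψ (x + τ * Complex.I) = (∫ x : ℝ, Φ (x + τ * Complex.I)) -
            c p * if τ < p.im then 0 else -(2 * Real.pi * Complex.I) := by
        intro τ h1 h2 h3 h4
        have hne : ∀ x : ℝ, (x : ℂ) + τ * Complex.I ≠ p := by
          intro x h
          have := congrArg Complex.im h
          simp at this
          exact h3 this
        have iE : Integrable fun x : ℝ => E (x + τ * Complex.I) := by
          refine Edec.integrable h1 h2 ?_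
          rw [continuous_iff_continuousAt]
          intro x
          exact (Edif _ (by simpa using h2) (hne x)).continuousAt.comp
            (f := fun x : ℝ => (x : ℂ) + τ * Complex.I) (by fun_prop)
        have iΦ : Integrable fun x : ℝ => Φ (x + τ * Complex.I) := by
          refine hD.integrable h1 h2 ?_
          refine hc.comp_continuous (by fun_prop) fun x => ⟨by simp [h1, h2], ?_⟩
          simp only [Finset.coe_insert, Set.mem_insert_iff, not_or]
          refine ⟨hne x, fun h => h4 _ h ?_⟩
          simp
        rw [← integral_inv_sub_inv_line h3 (by rw [hM]; linarith) iE, ← integral_const_mul,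
          ← integral_sub iΦ (iE.const_mul _)]
        refine integral_congr_ae (Eventually.of_forall fun x => ?_)
        exact hΨeq _ (hne x)
      rw [line a le_rfl hab.le hpim.1.ne fun p' h => (hP p' (Finset.mem_insert_of_mem h)).1.ne',
        line b hab.le le_rfl hpim.2.ne' fun p' h => (hP p' (Finset.mem_insert_of_mem h)).2.ne,
        if_pos hpim.1, if_neg hpim.2.le.not_gt] at hrec
      rw [Finset.sum_insert hp, mul_add, ← hrec]
      ring
    · intro p' hp'
      have hne : p' ≠ p := fun h => hp (h ▸ hp')
      have hnep : ∀ᶠ z in 𝓝[≠] p', z ≠ p :=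
        mem_nhdsWithin_of_mem_nhds (isOpen_compl_singleton.mem_nhds hne)
      have h1 := hres p' (Finset.mem_insert_of_mem hp')
      have h2 : Tendsto (fun z => (z - p') * (c p * E z)) (𝓝[≠] p') (𝓝 0) := by
        have cE := (Edif p' (hP p' (Finset.mem_insert_of_mem hp')).2.le hne).continuousAt
        have : ContinuousAt (fun z => (z - p') * (c p * E z)) p' := by fun_prop
        simpa using this.tendsto.mono_left nhdsWithin_le_nhds
      have h3 := h1.sub h2
      rw [sub_zero] at h3
      refine h3.congr' ?_
      filter_upwards [hnep] with z hz
      rw [hΨeq z hz]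
      simp only [hΨ0]
      ring

/-! ### The two kernels and the hyperbolic functions behind them. -/

/-- The Poisson kernel of the strip of width `π`, at the height `γ`. -/
noncomputable def stripKernel (γ : ℝ) (z : ℂ) : ℂ :=
  Real.sin γ / (2 * Real.pi * (Complex.cosh z - Real.cos γ))

/-- The hyperbolic tangent with period `4 b I`. -/
noncomputable def scaledTanh (b : ℝ) (z : ℂ) : ℂ :=
  Complex.sinh ((Real.pi / (4 * b) : ℝ) * z) / Complex.cosh ((Real.pi / (4 * b) : ℝ) * z)

/-- The kernel expressing `(I + P)⁻¹ r` through the values of `r` on the opposite side of the sector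
of opening `2 α`. -/
noncomputable def sectorKernel (α : ℝ) (z : ℂ) : ℂ :=
  -Complex.I / (4 * (Real.pi - α)) * (scaledTanh (Real.pi - α) (z + (2 * (Real.pi - 2 * α) : ℝ) *
    Complex.I) - scaledTanh (Real.pi - α) z)

section Hyperbolic

open Complex in
theorem normSq_cosh_eq (z : ℂ) : ‖cosh z‖ ^ 2 = Real.sinh z.re ^ 2 + Real.cos z.im ^ 2 := by
  have h := Complex.cosh_add z.re (z.im * I)
  rw [re_add_im, cosh_mul_I, sinh_mul_I] at h
  have h2 : cosh z = ((Real.cosh z.re * Real.cos z.im : ℝ) : ℂ) +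
      ((Real.sinh z.re * Real.sin z.im : ℝ) : ℂ) * I := by
    rw [h]
    push_cast
    ring
  rw [h2, ← normSq_eq_norm_sq, normSq_add_mul_I]
  have := Real.cosh_sq z.re
  have := Real.sin_sq_add_cos_sq z.im
  nlinarith

open Complex in
theorem normSq_sinh_eq (z : ℂ) : ‖sinh z‖ ^ 2 = Real.sinh z.re ^ 2 + Real.sin z.im ^ 2 := by
  have h := Complex.sinh_add z.re (z.im * I)
  rw [re_add_im, cosh_mul_I, sinh_mul_I] at h
  have h2 : sinh z = ((Real.sinh z.re * Real.cos z.im : ℝ) : ℂ) +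
      ((Real.cosh z.re * Real.sin z.im : ℝ) : ℂ) * I := by
    rw [h]
    push_cast
    ring
  rw [h2, ← normSq_eq_norm_sq, normSq_add_mul_I]
  have := Real.cosh_sq z.re
  have := Real.sin_sq_add_cos_sq z.im
  nlinarith

theorem one_add_sq_div_two_le_cosh (x : ℝ) : 1 + x ^ 2 / 2 ≤ Real.cosh x := by
  have h1 : Real.cosh x = 1 + 2 * Real.sinh (x / 2) ^ 2 := by
    have := Real.cosh_two_mul (x / 2)
    rw [show 2 * (x / 2) = x by ring] at this
    have h2 := Real.cosh_sq (x / 2)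
    linarith
  have h2 : (x / 2) ^ 2 ≤ Real.sinh (x / 2) ^ 2 := by
    rw [sq_le_sq]
    rcases le_total 0 x with h | h
    · rw [abs_of_nonneg (by linarith), abs_of_nonneg (Real.sinh_nonneg_iff.2 (by linarith))]
      exact Real.self_le_sinh_iff.2 (by linarith)
    · rw [abs_of_nonpos (by linarith), abs_of_nonpos (Real.sinh_nonpos_iff.2 (by linarith))]
      have := Real.sinh_le_self_iff.2 (show x / 2 ≤ 0 by linarith)
      linarith
  rw [h1]
  linarith

theorem cosh_sub_one_le_norm_cosh (z : ℂ) : Real.cosh z.re - 1 ≤ ‖Complex.cosh z‖ := by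
  have h := normSq_cosh_eq z
  have h1 := Real.cosh_sq z.re
  have h2 := Real.one_le_cosh z.re
  refine abs_le_of_sq_le_sq' ?_ (norm_nonneg _) |>.2
  nlinarith [sq_nonneg (Real.cos z.im)]

theorem sq_div_two_le_norm_cosh (z : ℂ) : z.re ^ 2 / 2 ≤ ‖Complex.cosh z‖ := by
  have := cosh_sub_one_le_norm_cosh z
  have := one_add_sq_div_two_le_cosh z.re
  linarith

theorem norm_sinh_div_cosh_le {z : ℂ} (hz : 1 ≤ |z.re|) :
    ‖Complex.sinh z / Complex.cosh z‖ ≤ 2 := by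
  have h1 := normSq_cosh_eq z
  have h2 := normSq_sinh_eq z
  have h3 : 1 ≤ Real.sinh z.re ^ 2 := by
    have : |z.re| ≤ |Real.sinh z.re| := by
      rw [Real.abs_sinh]
      exact Real.self_le_sinh_iff.2 (abs_nonneg _)
    rw [← sq_abs]
    nlinarith
  have hpos : 0 < ‖Complex.cosh z‖ := by
    have := norm_nonneg (Complex.cosh z)
    rcases this.eq_or_lt with h | h
    · rw [← h] at h1
      nlinarith [sq_nonneg (Real.cos z.im)]
    · exact h
  rw [norm_div, div_le_iff₀ hpos]
  refine abs_le_of_sq_le_sq' ?_ (by positivity) |>.2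
  nlinarith [sq_nonneg (Real.cos z.im), Real.sin_sq_le_one z.im]

theorem complex_cosh_eq_zero_iff {z : ℂ} :
    Complex.cosh z = 0 ↔ ∃ k : ℤ, z = ((2 * k + 1) * Real.pi / 2 : ℝ) * Complex.I := by
  rw [← Complex.cos_mul_I, Complex.cos_eq_zero_iff]
  constructor
  · rintro ⟨k, h⟩
    refine ⟨-k - 1, ?_⟩
    have := congrArg (fun w => -w * Complex.I) h
    simp only [neg_mul, mul_assoc, Complex.I_mul_I] at this
    push_cast
    linear_combination this
  · rintro ⟨k, rfl⟩
    refine ⟨-k - 1, ?_⟩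
    push_cast
    rw [mul_assoc, Complex.I_mul_I]
    ring

theorem complex_cosh_eq_cos_iff {z : ℂ} {γ : ℝ} : Complex.cosh z = Real.cos γ ↔
    ∃ k : ℤ, z = (2 * k * Real.pi + γ : ℝ) * Complex.I ∨
      z = (2 * k * Real.pi - γ : ℝ) * Complex.I := by
  rw [← Complex.cos_mul_I, Complex.ofReal_cos, eq_comm, Complex.cos_eq_cos_iff]
  constructor
  · rintro ⟨k, h⟩
    refine ⟨-k, ?_⟩
    rcases h with h | h
    all_goals
      have := congrArg (fun w => -w * Complex.I) h
      simp only [neg_mul, mul_assoc, Complex.I_mul_I] at this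
    · right
      push_cast
      linear_combination this
    · left
      push_cast
      linear_combination this
  · rintro ⟨k, h | h⟩
    all_goals
      refine ⟨-k, ?_⟩
      rw [h]
      push_cast
      rw [mul_assoc, Complex.I_mul_I]
    · right; ring
    · left; ring

theorem complex_cosh_ne_zero_of_abs_im_lt {z : ℂ} (h : |z.im| < Real.pi / 2) :
    Complex.cosh z ≠ 0 := by
  intro h0
  have := normSq_cosh_eq z
  rw [h0] at this
  have hc : 0 < Real.cos z.im := Real.cos_pos_of_mem_Ioo (abs_lt.1 h)
  simp only [norm_zero] at this
  nlinarith [sq_nonneg (Real.sinh z.re)]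

theorem complex_cosh_ne_cos_of_abs_im_lt {z : ℂ} {γ : ℝ} (hγ : γ ≤ Real.pi) (h : |z.im| < γ) :
    Complex.cosh z - Real.cos γ ≠ 0 := by
  intro h0
  rw [abs_lt] at h
  obtain ⟨k, h1 | h1⟩ := complex_cosh_eq_cos_iff.1 (sub_eq_zero.1 h0)
  all_goals
    have h2 := congrArg Complex.im h1
    simp only [Complex.im_ofReal_mul, Complex.I_im, mul_one] at h2
    have hpi := Real.pi_pos
    rcases lt_trichotomy k 0 with hk | hk | hk
    · have : (k : ℝ) ≤ -1 := by exact_mod_cast Int.le_sub_one_of_lt hk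
      nlinarith
    · subst hk
      simp at h2
      linarith
    · have : (1 : ℝ) ≤ k := by exact_mod_cast hk
      nlinarith

theorem scaledTanh_neg (b : ℝ) (z : ℂ) : scaledTanh b (-z) = -scaledTanh b z := by
  simp [scaledTanh, neg_div]

theorem scaledTanh_periodic {b : ℝ} (hb : b ≠ 0) (z : ℂ) :
    scaledTanh b (z + (4 * b : ℝ) * Complex.I) = scaledTanh b z := by
  have : ((Real.pi / (4 * b) : ℝ) : ℂ) * (z + (4 * b : ℝ) * Complex.I) =
      ((Real.pi / (4 * b) : ℝ) : ℂ) * z + Real.pi * Complex.I := by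
    have : (b : ℂ) ≠ 0 := by exact_mod_cast hb
    push_cast
    field_simp
  rw [scaledTanh, scaledTanh, this, Complex.sinh_add, Complex.cosh_add, Complex.sinh_mul_I,
    Complex.cosh_mul_I]
  simp [neg_div, div_neg]

theorem stripKernel_neg (γ : ℝ) (z : ℂ) : stripKernel γ (-z) = stripKernel γ z := by
  simp [stripKernel]

theorem stripKernel_periodic (γ : ℝ) (z : ℂ) :
    stripKernel γ (z + 2 * Real.pi * Complex.I) = stripKernel γ z := by
  have : Complex.cosh (z + 2 * Real.pi * Complex.I) = Complex.cosh z := by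
    rw [← Complex.cos_mul_I, ← Complex.cos_mul_I z, ← Complex.cos_sub_two_pi (z * Complex.I)]
    congr 1
    linear_combination (2 * Real.pi : ℂ) * Complex.I_sq
  rw [stripKernel, stripKernel, this]

end Hyperbolic

/-- The map `L` stands for any translation or reflected translation of the variable. The decay comes
from |cosh w| ≥ (Re w)²/2. -/
theorem stripDecay_stripKernel (γ : ℝ) {L : ℂ → ℂ} (x : ℝ) (hL : ∀ z, |(L z).re| = |z.re - x|)
    (a b : ℝ) : StripDecay (fun z => stripKernel γ (L z)) a b := by
  refine ⟨4 * 8, 2 * |x| + 6, fun z _ _ hz => ?_⟩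
  have hx := abs_nonneg x
  have h1 : |z.re| / 2 ≤ |(L z).re| := by
    rw [hL]
    have := abs_sub_abs_le_abs_sub z.re x
    linarith
  have h2 : 3 ≤ |(L z).re| := by linarith
  have h3 := sq_abs (L z).re
  have h4 := sq_abs z.re
  have h5 : (1 + z.re ^ 2) / 16 ≤ (L z).re ^ 2 / 2 - 1 := by nlinarith
  have h6 : (L z).re ^ 2 / 2 - 1 ≤ ‖Complex.cosh (L z) - Real.cos γ‖ := by
    have e1 := norm_sub_norm_le (Complex.cosh (L z)) (Real.cos γ)
    have e2 : ‖((Real.cos γ : ℝ) : ℂ)‖ ≤ 1 := by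
      rw [Complex.norm_real]
      exact Real.abs_cos_le_one γ
    have e3 := sq_div_two_le_norm_cosh (L z)
    linarith
  have h7 : 0 < (1 + z.re ^ 2) / 16 := by positivity
  have h8 : ‖((Real.sin γ : ℝ) : ℂ)‖ ≤ 1 := by
    rw [Complex.norm_real]
    exact Real.abs_sin_le_one γ
  have hn : 0 < ‖Complex.cosh (L z) - Real.cos γ‖ := by linarith
  have h9 : ‖(2 * Real.pi : ℂ)‖ = 2 * Real.pi := by
    rw [norm_mul, Complex.norm_real]
    simp [abs_of_pos Real.pi_pos]
  show ‖stripKernel γ (L z)‖ ≤ _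
  rw [stripKernel, norm_div, norm_mul, h9, div_le_div_iff₀ (by positivity) (by positivity)]
  have hpi := Real.pi_gt_three
  calc ‖((Real.sin γ : ℝ) : ℂ)‖ * (1 + z.re ^ 2) ≤ 1 * (1 + z.re ^ 2) := by gcongr
    _ ≤ 4 * 8 * (2 * 3 * ‖Complex.cosh (L z) - Real.cos γ‖) := by nlinarith
    _ ≤ _ := by gcongr

theorem differentiableAt_stripKernel {γ : ℝ} {z : ℂ} (h : Complex.cosh z - Real.cos γ ≠ 0) :
    DifferentiableAt ℂ (stripKernel γ) z := by
  unfold stripKernel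
  refine (differentiableAt_const _).div ?_ ?_
  · exact (Complex.differentiable_cosh.differentiableAt.sub_const _).const_mul _
  · have : (Real.pi : ℂ) ≠ 0 := by exact_mod_cast Real.pi_ne_zero
    exact mul_ne_zero (mul_ne_zero two_ne_zero this) h

theorem differentiableAt_scaledTanh {b : ℝ} {z : ℂ}
    (h : Complex.cosh ((Real.pi / (4 * b) : ℝ) * z) ≠ 0) :
    DifferentiableAt ℂ (scaledTanh b) z := by
  unfold scaledTanh
  refine DifferentiableAt.div ?_ ?_ h
  · exact (Complex.differentiable_sinh.comp (differentiable_id.const_mul _)).differentiableAt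
  · exact (Complex.differentiable_cosh.comp (differentiable_id.const_mul _)).differentiableAt

open Filter Topology in
-- The residue of g/f at a simple zero of f.
theorem tendsto_sub_mul_div_of_hasDerivAt {f g : ℂ → ℂ} {f' p : ℂ} (hf : HasDerivAt f f' p)
    (h0 : f p = 0) (hf' : f' ≠ 0) (hg : ContinuousAt g p) :
    Tendsto (fun z => (z - p) * (g z / f z)) (𝓝[≠] p) (𝓝 (g p / f')) := by
  have h1 := (hasDerivAt_iff_tendsto_slope.1 hf).inv₀ hf'
  have h2 := (hg.tendsto.mono_left nhdsWithin_le_nhds).mul h1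
  rw [← div_eq_mul_inv] at h2
  refine h2.congr' ?_
  filter_upwards [self_mem_nhdsWithin] with z hz
  rw [slope_def_field, h0, sub_zero, inv_div]
  ring

/-! ### The convolution of the kernels, by residues. -/

/-- The convolution of the two kernels. -/
theorem integral_stripKernel_mul_sectorKernel {α γ x : ℝ} (hα : 0 < α) (hα2 : α ≤ Real.pi / 2)
    (hγ : 0 < γ) (hγ2 : γ < Real.pi) (hγα : γ ≠ α) :
    ∫ y : ℝ, stripKernel γ (x - y) * sectorKernel α (-y + α * Complex.I) =
      2 * stripKernel γ (x + α * Complex.I) - Complex.I / (4 * (Real.pi - α)) *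
        (scaledTanh (Real.pi - α) (x - α * Complex.I + γ * Complex.I) -
          scaledTanh (Real.pi - α) (x - α * Complex.I - γ * Complex.I + 2 * Real.pi * Complex.I)) := by
  classical
  have hpi := Real.pi_pos
  set b := Real.pi - α with hb
  have hb0 : 0 < b := by linarith
  have hbc : (Real.pi : ℂ) - α = b := by rw [hb]; push_cast; rfl
  have hbC : (b : ℂ) ≠ 0 := by exact_mod_cast hb0.ne'
  have hpiC : (Real.pi : ℂ) ≠ 0 := by exact_mod_cast hpi.ne'
  set lam : ℝ := Real.pi / (4 * b) with hlam
  have hlam0 : 0 < lam := by positivity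
  have hlamC : (lam : ℂ) ≠ 0 := by exact_mod_cast hlam0.ne'
  have hlb : lam * (4 * b) = Real.pi := by rw [hlam]; field_simp
  -- These are the poles of the integrand in the strip -α ≤ Im Y ≤ 2π - α: p1 and p2 come from the
  -- strip kernel, p3 from the hyperbolic tangent. The assumption γ ≠ α keeps p2 and p3 apart.
  set p1 : ℂ := x - α * Complex.I + γ * Complex.I with hp1
  set p2 : ℂ := x - α * Complex.I - γ * Complex.I + 2 * Real.pi * Complex.I with hp2
  set p3 : ℂ := (2 * b : ℝ) * Complex.I with hp3
  have im1 : p1.im = γ - α := by simp [hp1]; ring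
  have im2 : p2.im = 2 * Real.pi - α - γ := by simp [hp2]; ring
  have im3 : p3.im = 2 * Real.pi - 2 * α := by simp [hp3, hb]; ring
  have h12 : p1 ≠ p2 := fun h => by
    have := congrArg Complex.im h
    rw [im1, im2] at this
    linarith
  have h13 : p1 ≠ p3 := fun h => by
    have := congrArg Complex.im h
    rw [im1, im3] at this
    linarith
  have h23 : p2 ≠ p3 := fun h => by
    have := congrArg Complex.im h
    rw [im2, im3] at this
    exact hγα (by linarith)
  set L : ℂ → ℂ := fun Y => x - Y - α * Complex.I with hL
  set Φ : ℂ → ℂ := fun Y => stripKernel γ (L Y) * scaledTanh b Y with hΦ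
  have hsin : (Real.sin γ : ℂ) ≠ 0 := by
    exact_mod_cast (Real.sin_pos_of_pos_of_lt_pi hγ hγ2).ne'
  have zeros1 : ∀ Y : ℂ, -α ≤ Y.im → Y.im ≤ 2 * Real.pi - α → Y ≠ p1 → Y ≠ p2 →
      Complex.cosh (L Y) - Real.cos γ ≠ 0 := by
    intro Y h1 h2 n1 n2 h0
    obtain ⟨k, h | h⟩ := complex_cosh_eq_cos_iff.1 (sub_eq_zero.1 h0)
    · have him := congrArg Complex.im h
      simp [hL] at him
      have hk : k = -1 := by
        have l1 : (-2 : ℝ) < k := by nlinarith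
        have l2 : (k : ℝ) < 0 := by nlinarith
        have l1' : -2 < k := by exact_mod_cast l1
        have l2' : k < 0 := by exact_mod_cast l2
        omega
      subst hk
      apply n2
      simp only [hL] at h
      push_cast at h
      rw [hp2]
      linear_combination -h
    · have him := congrArg Complex.im h
      simp [hL] at him
      have hk : k = 0 := by
        have l1 : (-1 : ℝ) < k := by nlinarith
        have l2 : (k : ℝ) < 1 := by nlinarith
        have l1' : -1 < k := by exact_mod_cast l1
        have l2' : k < 1 := by exact_mod_cast l2
        omega
      subst hk
      apply n1
      simp only [hL] at h
      push_cast at h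
      rw [hp1]
      linear_combination -h
  have zeros2 : ∀ Y : ℂ, -α ≤ Y.im → Y.im ≤ 2 * Real.pi - α → Y ≠ p3 →
      Complex.cosh ((lam : ℂ) * Y) ≠ 0 := by
    intro Y h1 h2 n3 h0
    obtain ⟨k, h⟩ := complex_cosh_eq_zero_iff.1 h0
    have hY : Y = ((2 * k + 1) * (2 * b) : ℝ) * Complex.I := by
      have : (lam : ℂ) * Y = lam * (((2 * k + 1) * (2 * b) : ℝ) * Complex.I) := by
        rw [h, ← mul_assoc, ← Complex.ofReal_mul, ← hlb]
        push_cast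
        ring
      exact mul_left_cancel₀ hlamC this
    have him := congrArg Complex.im hY
    simp at him
    have hk : k = 0 := by
      have l1 : (-1 : ℝ) < k := by
        by_contra hcon
        have : (k : ℝ) ≤ -1 := not_lt.1 hcon
        nlinarith
      have l2 : (k : ℝ) < 1 := by
        by_contra hcon
        have : (1 : ℝ) ≤ k := not_lt.1 hcon
        nlinarith
      have l1' : -1 < k := by exact_mod_cast l1
      have l2' : k < 1 := by exact_mod_cast l2
      omega
    subst hk
    apply n3
    rw [hY, hp3]
    simp
  have dL : ∀ Y, HasDerivAt L (-1) Y := by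
    intro Y
    simpa [hL] using ((hasDerivAt_id Y).const_sub (x : ℂ)).sub_const (α * Complex.I)
  have dif : ∀ Y : ℂ, -α ≤ Y.im → Y.im ≤ 2 * Real.pi - α → Y ≠ p1 → Y ≠ p2 → Y ≠ p3 →
      DifferentiableAt ℂ Φ Y := by
    intro Y h1 h2 n1 n2 n3
    refine DifferentiableAt.mul ?_ (differentiableAt_scaledTanh (zeros2 Y h1 h2 n3))
    exact (differentiableAt_stripKernel (zeros1 Y h1 h2 n1 n2)).comp Y (dL Y).differentiableAt
  have hD : StripDecay Φ (-α) (2 * Real.pi - α) := by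
    refine (stripDecay_stripKernel γ x (L := L) ?_ _ _).mul_bounded (M := 2) (R' := 1 / lam) ?_
    · intro z
      simp [hL, abs_sub_comm]
    · intro z _ _ hz
      refine norm_sinh_div_cosh_le ?_
      rw [Complex.re_ofReal_mul, abs_mul, abs_of_pos hlam0]
      rwa [div_le_iff₀ hlam0, mul_comm] at hz
  set res : ℂ → ℂ := fun p => if p = p1 then scaledTanh b p1 / (2 * Real.pi * Complex.I) else
    if p = p2 then -(scaledTanh b p2 / (2 * Real.pi * Complex.I)) else
      stripKernel γ (x + α * Complex.I) / lam with hres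
  have dcosh : ∀ Y, HasDerivAt (fun Y => 2 * Real.pi * (Complex.cosh (L Y) - Real.cos γ))
      (2 * Real.pi * -Complex.sinh (L Y)) Y := by
    intro Y
    have := (((Complex.hasDerivAt_cosh (L Y)).comp Y (dL Y)).sub_const
      ((Real.cos γ : ℝ) : ℂ)).const_mul (2 * Real.pi : ℂ)
    simpa using this
  have key := integral_line_sub_integral_line_eq_sum_residues (a := -α) (b := 2 * Real.pi - α)
    (by linarith) {p1, p2, p3} res (Φ := Φ) ?_ ?_ ?_ hD ?_
  · rw [Finset.sum_insert (by simp [h12, h13]), Finset.sum_insert (by simp [h23]),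
      Finset.sum_singleton] at key
    have r1 : res p1 = scaledTanh b p1 / (2 * Real.pi * Complex.I) := by simp [hres]
    have r2 : res p2 = -(scaledTanh b p2 / (2 * Real.pi * Complex.I)) := by
      simp [hres, h12.symm]
    have r3 : res p3 = stripKernel γ (x + α * Complex.I) / lam := by
      simp [hres, h13.symm, h23.symm]
    rw [r1, r2, r3] at key
    have cl : ∀ τ : ℝ, -α ≤ τ → τ ≤ 2 * Real.pi - α → τ ≠ γ - α → τ ≠ 2 * Real.pi - α - γ →
        τ ≠ 2 * Real.pi - 2 * α → Integrable fun y : ℝ => Φ (y + τ * Complex.I) := by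
      intro τ h1 h2 n1 n2 n3
      refine hD.integrable h1 h2 ?_
      rw [continuous_iff_continuousAt]
      intro y
      have him : ((y : ℂ) + τ * Complex.I).im = τ := by simp
      refine ContinuousAt.comp (f := fun x : ℝ => (x : ℂ) + τ * Complex.I) (g := Φ)
        (dif _ (by rwa [him]) (by rwa [him]) ?_ ?_ ?_).continuousAt (by fun_prop)
      all_goals
        intro h
        have := congrArg Complex.im h
        rw [him] at this
      · exact n1 (this.trans im1)
      · exact n2 (this.trans im2)
      · exact n3 (this.trans im3)
    have i1 := cl (-α) le_rfl (by linarith) (by linarith) (by linarith) (by linarith)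
    have i2 := cl (2 * Real.pi - α) (by linarith) le_rfl (by linarith) (by linarith) (by linarith)
    rw [← integral_sub i1 i2] at key
    -- The strip has height 2π, a period of the strip kernel. Hence the difference of Φ on its two
    -- edges is the strip kernel times a difference of two hyperbolic tangents. By oddness and the
    -- period 4(π - α)i this difference is `sectorKernel`, which explains the shift 2(π - 2α) in its
    -- definition.
    have e : ∀ y : ℝ, stripKernel γ (x - y) * sectorKernel α (-y + α * Complex.I) =
        -Complex.I / (4 * b) * (Φ (y + (-α : ℝ) * Complex.I) -
          Φ (y + (2 * Real.pi - α : ℝ) * Complex.I)) := by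
      intro y
      have eL1 : L (y + (-α : ℝ) * Complex.I) = x - y := by
        simp only [hL]; push_cast; ring
      have eL2 : L (y + (2 * Real.pi - α : ℝ) * Complex.I) + 2 * Real.pi * Complex.I = x - y := by
        simp only [hL]; push_cast; ring
      have t1 : scaledTanh b (-y + α * Complex.I) =
          -scaledTanh b (y + (-α : ℝ) * Complex.I) := by
        rw [← scaledTanh_neg]
        congr 1
        push_cast
        ring
      have t2 : scaledTanh b (-y + α * Complex.I + (2 * (Real.pi - 2 * α) : ℝ) * Complex.I) =
          -scaledTanh b (y + (2 * Real.pi - α : ℝ) * Complex.I) := by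
        rw [← scaledTanh_neg, ← scaledTanh_periodic hb0.ne' (-_)]
        congr 1
        rw [hb]
        push_cast
        ring
      simp only [hΦ]
      rw [sectorKernel, ← hb, hbc, t1, t2, eL1,
        ← stripKernel_periodic γ (L (y + (2 * Real.pi - α : ℝ) * Complex.I)), eL2]
      ring
    simp only [e]
    rw [integral_const_mul, key]
    have hl : (lam : ℂ) = Real.pi / (4 * b) := by rw [hlam]; push_cast; ring
    rw [hl, hbc]
    generalize stripKernel γ (x + α * Complex.I) = S
    field_simp
    linear_combination (-8 * b * S) * Complex.I_sq
  · intro p hp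
    simp only [Finset.mem_insert, Finset.mem_singleton] at hp
    rcases hp with rfl | rfl | rfl
    · rw [im1]; constructor <;> linarith
    · rw [im2]; constructor <;> linarith
    · rw [im3]; constructor <;> linarith
  · intro Y hY
    simp only [Finset.coe_insert, Finset.coe_singleton, Set.mem_sdiff, Set.mem_insert_iff,
      Set.mem_singleton_iff, not_or, Set.mem_preimage, Set.mem_Icc] at hY
    exact (dif Y hY.1.1 hY.1.2 hY.2.1 hY.2.2.1 hY.2.2.2).continuousAt.continuousWithinAt
  · intro Y hY
    simp only [Finset.coe_insert, Finset.coe_singleton, Set.mem_sdiff, Set.mem_insert_iff,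
      Set.mem_singleton_iff, not_or, Set.mem_preimage, Set.mem_Ioo] at hY
    exact (dif Y hY.1.1.le hY.1.2.le hY.2.1 hY.2.2.1 hY.2.2.2).differentiableWithinAt
  · intro p hp
    simp only [Finset.mem_insert, Finset.mem_singleton] at hp
    have shg : Complex.sinh (γ * Complex.I) = Real.sin γ * Complex.I := by
      rw [Complex.sinh_mul_I, Complex.ofReal_sin]
    rcases hp with rfl | rfl | rfl
    · have hL1 : L p1 = -(γ * Complex.I) := by simp only [hL, hp1]; ring
      have ct : ContinuousAt (scaledTanh b) p1 := (differentiableAt_scaledTanh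
        (zeros2 p1 (by rw [im1]; linarith) (by rw [im1]; linarith) h13)).continuousAt
      have := tendsto_sub_mul_div_of_hasDerivAt (dcosh p1) ?_ ?_
        (ct.const_mul ((Real.sin γ : ℝ) : ℂ))
      · have er : res p1 = (Real.sin γ : ℂ) * scaledTanh b p1 /
            (2 * Real.pi * -Complex.sinh (L p1)) := by
          rw [hL1, Complex.sinh_neg, shg]
          simp only [hres, if_true]
          field_simp
        rw [er]
        refine this.congr fun z => ?_
        simp only [hΦ, stripKernel]
        ring
      · rw [hL1, Complex.cosh_neg, Complex.cosh_mul_I, Complex.ofReal_cos]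
        simp
      · rw [hL1, Complex.sinh_neg, shg]
        simpa [hpiC] using hsin
    · have hL1 : L p2 + 2 * Real.pi * Complex.I = (γ * Complex.I) := by
        simp only [hL, hp2]; ring
      have hL2 : L p2 = ((γ - 2 * Real.pi : ℝ) : ℂ) * Complex.I := by
        push_cast
        linear_combination hL1
      have sh2 : Complex.sinh (L p2) = Real.sin γ * Complex.I := by
        rw [hL2, Complex.sinh_mul_I, ← Complex.ofReal_sin, Real.sin_sub_two_pi]
      have ch2 : Complex.cosh (L p2) = Real.cos γ := by
        rw [hL2, Complex.cosh_mul_I, ← Complex.ofReal_cos, Real.cos_sub_two_pi]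
      have ct : ContinuousAt (scaledTanh b) p2 := (differentiableAt_scaledTanh
        (zeros2 p2 (by rw [im2]; linarith) (by rw [im2]; linarith) h23)).continuousAt
      have := tendsto_sub_mul_div_of_hasDerivAt (dcosh p2) ?_ ?_
        (ct.const_mul ((Real.sin γ : ℝ) : ℂ))
      · have er : res p2 = (Real.sin γ : ℂ) * scaledTanh b p2 /
            (2 * Real.pi * -Complex.sinh (L p2)) := by
          rw [sh2]
          simp only [hres, if_neg h12.symm, if_true]
          field_simp
        rw [er]
        refine this.congr fun z => ?_
        simp only [hΦ, stripKernel]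
        ring
      · rw [ch2]
        simp
      · rw [sh2]
        simpa [hpiC] using hsin
    · have hlp : (lam : ℂ) * p3 = (Real.pi / 2 : ℝ) * Complex.I := by
        rw [hp3, ← mul_assoc, ← Complex.ofReal_mul, ← hlb]
        push_cast
        ring
      have ct : ContinuousAt (fun Y => stripKernel γ (L Y)) p3 :=
        ((differentiableAt_stripKernel (zeros1 p3 (by rw [im3]; linarith) (by rw [im3]; linarith)
          h13.symm h23.symm)).comp p3 (dL p3).differentiableAt).continuousAt
      have ds : HasDerivAt (fun Y => Complex.cosh ((lam : ℂ) * Y))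
          (Complex.sinh ((lam : ℂ) * p3) * (lam * 1)) p3 :=
        (Complex.hasDerivAt_cosh _).comp p3 ((hasDerivAt_id p3).const_mul (lam : ℂ))
      have cs : Continuous (fun Y => Complex.sinh ((lam : ℂ) * Y)) :=
        Complex.continuous_sinh.comp (by fun_prop)
      have shp : Complex.sinh ((lam : ℂ) * p3) = Complex.I := by
        rw [hlp, Complex.sinh_mul_I, ← Complex.ofReal_sin, Real.sin_pi_div_two]
        simp
      have := tendsto_sub_mul_div_of_hasDerivAt ds ?_ ?_ (ct.mul cs.continuousAt)
      · have er : res p3 = stripKernel γ (L p3) * Complex.sinh ((lam : ℂ) * p3) /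
            (Complex.sinh ((lam : ℂ) * p3) * (lam * 1)) := by
          have : L p3 + 2 * Real.pi * Complex.I = x + α * Complex.I := by
            simp only [hL, hp3, hb]
            push_cast
            ring
          rw [← stripKernel_periodic γ (L p3), this, shp]
          simp only [hres, if_neg h13.symm, if_neg h23.symm]
          field_simp
        rw [er]
        refine this.congr fun z => ?_
        simp only [hΦ, scaledTanh, Pi.mul_apply]
        rw [← hlam]
        ring
      · rw [hlp, Complex.cosh_mul_I, ← Complex.ofReal_cos, Real.cos_pi_div_two]
        simp
      · rw [shp]
        simpa using hlamC

/-! ### The mass of the strip kernel on the real line. -/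

theorem stripKernel_ofReal (γ x : ℝ) : stripKernel γ x =
    ((Real.sin γ / (2 * Real.pi * (Real.cosh x - Real.cos γ)) : ℝ) : ℂ) := by
  rw [stripKernel]
  push_cast
  rfl

theorem cosh_sub_cos_pos {γ : ℝ} (h0 : 0 < γ) (hπ : γ ≤ Real.pi) (x : ℝ) :
    0 < Real.cosh x - Real.cos γ := by
  have h1 := Real.one_le_cosh x
  have h2 : Real.cos γ < Real.cos 0 := Real.cos_lt_cos_of_nonneg_of_le_pi le_rfl hπ h0
  rw [Real.cos_zero] at h2
  linarith

theorem continuous_stripKernel {γ : ℝ} (h0 : 0 < γ) (hπ : γ ≤ Real.pi) :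
    Continuous fun x : ℝ => stripKernel γ x := by
  simp only [stripKernel_ofReal]
  refine Complex.continuous_ofReal.comp (Continuous.div continuous_const ?_ fun x => ?_)
  · exact continuous_const.mul (Real.continuous_cosh.sub continuous_const)
  · have := cosh_sub_cos_pos h0 hπ x
    have := Real.pi_pos
    positivity

theorem integrable_stripKernel {γ : ℝ} (h0 : 0 < γ) (hπ : γ ≤ Real.pi) :
    Integrable fun x : ℝ => stripKernel γ x := by
  have := (stripDecay_stripKernel γ 0 (L := id) (by simp) 0 0).integrable (τ := 0) le_rfl le_rfl
    (by simpa using continuous_stripKernel h0 hπ)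
  simpa using this

theorem norm_stripKernel {γ : ℝ} (h0 : 0 < γ) (hπ : γ ≤ Real.pi) (x : ℝ) :
    ‖stripKernel γ x‖ = Real.sin γ / (2 * Real.pi * (Real.cosh x - Real.cos γ)) := by
  rw [stripKernel_ofReal, Complex.norm_real, Real.norm_of_nonneg]
  have := cosh_sub_cos_pos h0 hπ x
  have := Real.pi_pos
  have := Real.sin_nonneg_of_nonneg_of_le_pi h0.le hπ
  positivity

open Filter Topology in
-- The primitive arctan((exp x - cos γ)/sin γ)/π increases by (π - γ)/π. Geometrically, π - γ is the
-- angle under which a ray is seen from a point at angular distance γ.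
theorem integral_stripKernel_real {γ : ℝ} (h0 : 0 < γ) (hπ : γ ≤ Real.pi) :
    ∫ x : ℝ, Real.sin γ / (2 * Real.pi * (Real.cosh x - Real.cos γ)) = (Real.pi - γ) / Real.pi := by
  have hpi := Real.pi_pos
  -- For γ = π the primitive is not available, since sin γ = 0, but the integrand vanishes.
  rcases hπ.eq_or_lt with rfl | hlt
  · simp
  have hs := Real.sin_pos_of_pos_of_lt_pi h0 hlt
  have hint := (integrable_stripKernel h0 hπ).norm
  simp only [norm_stripKernel h0 hπ] at hint
  have hder : ∀ x : ℝ, HasDerivAt (fun x : ℝ => Real.arctan ((Real.exp x - Real.cos γ) /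
      Real.sin γ) / Real.pi) (Real.sin γ / (2 * Real.pi * (Real.cosh x - Real.cos γ))) x := by
    intro x
    have := ((((Real.hasDerivAt_exp x).sub_const (Real.cos γ)).div_const
      (Real.sin γ)).arctan).div_const Real.pi
    convert! this using 1
    have hp := cosh_sub_cos_pos h0 hπ x
    have he := Real.exp_pos x
    have hc : Real.exp x * Real.cosh x * 2 = Real.exp x ^ 2 + 1 := by
      rw [Real.cosh_eq, Real.exp_neg]
      field_simp
    have hsc := Real.sin_sq_add_cos_sq γ
    have hq : 0 < Real.sin γ ^ 2 + (Real.exp x - Real.cos γ) ^ 2 := by positivity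
    have e1 : 1 + ((Real.exp x - Real.cos γ) / Real.sin γ) ^ 2 =
        (Real.sin γ ^ 2 + (Real.exp x - Real.cos γ) ^ 2) / Real.sin γ ^ 2 := by
      field_simp
    have e2 : Real.sin γ ^ 2 + (Real.exp x - Real.cos γ) ^ 2 =
        2 * Real.exp x * (Real.cosh x - Real.cos γ) := by nlinarith
    rw [e1, e2]
    field_simp
  have hcot : Real.arctan (-(Real.cos γ / Real.sin γ)) = γ - Real.pi / 2 := by
    rw [show -(Real.cos γ / Real.sin γ) = Real.tan (γ - Real.pi / 2) by
      rw [Real.tan_eq_sin_div_cos, Real.sin_sub_pi_div_two, Real.cos_sub_pi_div_two]; ring]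
    exact Real.arctan_tan (by linarith) (by linarith)
  rw [integral_of_hasDerivAt_of_tendsto hder hint (m := (γ - Real.pi / 2) / Real.pi)
    (n := (Real.pi / 2) / Real.pi)]
  · field_simp
    ring
  · refine Tendsto.div_const ?_ _
    rw [← hcot]
    refine (Real.continuous_arctan.tendsto _).comp ?_
    have := (Real.tendsto_exp_atBot.sub_const (Real.cos γ)).div_const (Real.sin γ)
    simpa [neg_div] using this
  · refine Tendsto.div_const ?_ _
    refine (Real.tendsto_arctan_atTop.mono_right nhdsWithin_le_nhds).comp ?_
    exact (tendsto_atTop_add_const_right _ _ Real.tendsto_exp_atTop).atTop_div_const hs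

theorem integral_stripKernel {γ : ℝ} (h0 : 0 < γ) (hπ : γ ≤ Real.pi) :
    ∫ x : ℝ, stripKernel γ x = (((Real.pi - γ) / Real.pi : ℝ) : ℂ) := by
  simp only [stripKernel_ofReal]
  rw [integral_complex_ofReal, integral_stripKernel_real h0 hπ]

theorem integral_norm_stripKernel {γ : ℝ} (h0 : 0 < γ) (hπ : γ ≤ Real.pi) :
    ∫ x : ℝ, ‖stripKernel γ x‖ = (Real.pi - γ) / Real.pi := by
  simp only [norm_stripKernel h0 hπ]
  exact integral_stripKernel_real h0 hπ

/-! ### The sector kernel and its L¹ norm. -/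

section SectorKernel

variable {α : ℝ}

/-- A difference of hyperbolic tangents is sinh of the difference over a product of two cosh. The
sinh is a constant here, and the decay becomes visible. -/
theorem sectorKernel_eq_div (α : ℝ) {z : ℂ}
    (h1 : Complex.cosh ((Real.pi / (4 * (Real.pi - α)) : ℝ) * z) ≠ 0)
    (h2 : Complex.cosh ((Real.pi / (4 * (Real.pi - α)) : ℝ) *
      (z + (2 * (Real.pi - 2 * α) : ℝ) * Complex.I)) ≠ 0) :
    sectorKernel α z = 1 / (4 * (Real.pi - α)) *
      Real.sin (Real.pi / (4 * (Real.pi - α)) * (2 * (Real.pi - 2 * α))) /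
      (Complex.cosh ((Real.pi / (4 * (Real.pi - α)) : ℝ) *
        (z + (2 * (Real.pi - 2 * α) : ℝ) * Complex.I)) *
      Complex.cosh ((Real.pi / (4 * (Real.pi - α)) : ℝ) * z)) := by
  rw [sectorKernel, scaledTanh, scaledTanh]
  set l : ℝ := Real.pi / (4 * (Real.pi - α))
  set d : ℝ := 2 * (Real.pi - 2 * α)
  have hs : Complex.sinh ((l : ℂ) * (z + d * Complex.I)) * Complex.cosh (l * z) -
      Complex.cosh ((l : ℂ) * (z + d * Complex.I)) * Complex.sinh (l * z) =
      Real.sin (l * d) * Complex.I := by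
    rw [← Complex.sinh_sub, Complex.ofReal_sin, ← Complex.sinh_mul_I]
    congr 1
    push_cast
    ring
  rw [div_sub_div _ _ h2 h1, hs]
  have : -Complex.I * Complex.I = 1 := by simp
  rw [mul_div_assoc, mul_div_assoc]
  linear_combination (1 / (4 * ((Real.pi : ℂ) - α)) * (Real.sin (l * d) /
    (Complex.cosh ((l : ℂ) * (z + d * Complex.I)) * Complex.cosh (l * z)))) * this

/-- The poles nearest to the real axis have imaginary part ±2(π - α), and the shifted height is at
most 2(π - 2α) + α. Hence the sector kernel is holomorphic for 0 ≤ Im z ≤ α. -/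
theorem scaled_im_bounds (hα : 0 < α) (hα2 : α ≤ Real.pi / 2) {z : ℂ} (h1 : 0 ≤ z.im)
    (h2 : z.im ≤ α) :
    |((Real.pi / (4 * (Real.pi - α)) : ℝ) * z : ℂ).im| < Real.pi / 2 ∧
    |((Real.pi / (4 * (Real.pi - α)) : ℝ) * (z + (2 * (Real.pi - 2 * α) : ℝ) * Complex.I) : ℂ).im| <
      Real.pi / 2 := by
  have hpi := Real.pi_pos
  have hb : 0 < Real.pi - α := by linarith
  simp only [Complex.im_ofReal_mul, Complex.add_im, Complex.I_im, mul_one]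
  have key : ∀ t : ℝ, 0 ≤ t → t < 2 * (Real.pi - α) →
      |Real.pi / (4 * (Real.pi - α)) * t| < Real.pi / 2 := by
    intro t ht0 ht
    rw [abs_of_nonneg (by positivity), div_mul_eq_mul_div, div_lt_div_iff₀ (by positivity) two_pos]
    nlinarith
  exact ⟨key _ h1 (by linarith), key _ (by linarith) (by linarith)⟩

theorem differentiableAt_sectorKernel (hα : 0 < α) (hα2 : α ≤ Real.pi / 2) {z : ℂ}
    (h1 : 0 ≤ z.im) (h2 : z.im ≤ α) : DifferentiableAt ℂ (sectorKernel α) z := by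
  obtain ⟨b1, b2⟩ := scaled_im_bounds hα hα2 h1 h2
  unfold sectorKernel
  refine DifferentiableAt.const_mul (DifferentiableAt.sub ?_ ?_) _
  · exact (differentiableAt_scaledTanh (complex_cosh_ne_zero_of_abs_im_lt b2)).comp z
      (differentiableAt_id.add_const _)
  · exact differentiableAt_scaledTanh (complex_cosh_ne_zero_of_abs_im_lt b1)

theorem stripDecay_sectorKernel (hα : 0 < α) (hα2 : α ≤ Real.pi / 2) :
    StripDecay (sectorKernel α) 0 α := by
  have hpi := Real.pi_pos
  have hb : 0 < Real.pi - α := by linarith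
  set l : ℝ := Real.pi / (4 * (Real.pi - α)) with hl
  have hl0 : 0 < l := by positivity
  refine ⟨8 / (4 * (Real.pi - α) * l ^ 4), 1, fun z h1 h2 h3 => ?_⟩
  obtain ⟨b1, b2⟩ := scaled_im_bounds hα hα2 h1 h2
  have c1 := complex_cosh_ne_zero_of_abs_im_lt b1
  have c2 := complex_cosh_ne_zero_of_abs_im_lt b2
  rw [sectorKernel_eq_div α c1 c2]
  simp only [← hl]
  have n1 := sq_div_two_le_norm_cosh (l * z)
  have n2 := sq_div_two_le_norm_cosh (l * (z + (2 * (Real.pi - 2 * α) : ℝ) * Complex.I))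
  have r1 : ((l : ℂ) * z).re = l * z.re := by simp
  have r2 : ((l : ℂ) * (z + (2 * (Real.pi - 2 * α) : ℝ) * Complex.I)).re = l * z.re := by
    rw [Complex.re_ofReal_mul]; simp
  rw [r1] at n1
  rw [r2] at n2
  have hz : 1 ≤ z.re ^ 2 := by
    rw [← sq_abs]; nlinarith
  have hx : 0 < z.re ^ 2 := by linarith
  have hprod : (l * z.re) ^ 2 / 2 * ((l * z.re) ^ 2 / 2) ≤
      ‖Complex.cosh (l * (z + (2 * (Real.pi - 2 * α) : ℝ) * Complex.I))‖ *
      ‖Complex.cosh (l * z)‖ := by gcongr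
  have hlow : l ^ 4 / 8 * (1 + z.re ^ 2) ≤ (l * z.re) ^ 2 / 2 * ((l * z.re) ^ 2 / 2) := by
    have : l ^ 4 / 8 * (1 + z.re ^ 2) ≤ l ^ 4 / 8 * (2 * (z.re ^ 2) ^ 2) := by
      gcongr
      nlinarith
    nlinarith
  have hs : ‖((Real.sin (l * (2 * (Real.pi - 2 * α))) : ℝ) : ℂ)‖ ≤ 1 := by
    rw [Complex.norm_real]
    exact Real.abs_sin_le_one _
  have hb' : ‖(4 * ((Real.pi : ℂ) - α))‖ = 4 * (Real.pi - α) := by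
    rw [norm_mul, ← Complex.ofReal_sub, Complex.norm_real, Real.norm_of_nonneg hb.le]
    simp
  rw [norm_div, norm_mul, norm_mul, norm_div, norm_one, hb']
  have hden : 0 < ‖Complex.cosh (l * (z + (2 * (Real.pi - 2 * α) : ℝ) * Complex.I))‖ *
      ‖Complex.cosh (l * z)‖ := mul_pos (norm_pos_iff.2 c2) (norm_pos_iff.2 c1)
  have hle := hlow.trans hprod
  generalize ‖Complex.cosh (l * (z + (2 * (Real.pi - 2 * α) : ℝ) * Complex.I))‖ *
    ‖Complex.cosh (l * z)‖ = D at hle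
  calc _ ≤ 1 / (4 * (Real.pi - α)) * 1 / (l ^ 4 / 8 * (1 + z.re ^ 2)) := by gcongr
    _ = _ := by field_simp

theorem continuous_sectorKernel_line (hα : 0 < α) (hα2 : α ≤ Real.pi / 2) {τ : ℝ} (h1 : 0 ≤ τ)
    (h2 : τ ≤ α) : Continuous fun x : ℝ => sectorKernel α (x + τ * Complex.I) := by
  rw [continuous_iff_continuousAt]
  intro x
  exact (differentiableAt_sectorKernel hα hα2 (by simpa using h1) (by simpa using h2)).continuousAt.comp
    (f := fun x : ℝ => (x : ℂ) + τ * Complex.I) (by fun_prop)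

theorem integrable_sectorKernel_line (hα : 0 < α) (hα2 : α ≤ Real.pi / 2) {τ : ℝ} (h1 : 0 ≤ τ)
    (h2 : τ ≤ α) : Integrable fun x : ℝ => sectorKernel α (x + τ * Complex.I) :=
  (stripDecay_sectorKernel hα hα2).integrable h1 h2 (continuous_sectorKernel_line hα hα2 h1 h2)

theorem integrable_sectorKernel (hα : 0 < α) (hα2 : α ≤ Real.pi / 2) :
    Integrable fun x : ℝ => sectorKernel α x := by
  simpa using integrable_sectorKernel_line hα hα2 le_rfl hα.le

theorem conj_scaledTanh (b : ℝ) (z : ℂ) : conj (scaledTanh b z) = scaledTanh b (conj z) := by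
  simp [scaledTanh, ← Complex.sinh_conj, ← Complex.cosh_conj, map_ofNat]

/-- The two sides of the sector involve the kernel at y and at -y; this symmetry gives both the same
L¹ norm. -/
theorem sectorKernel_neg_ofReal (α x : ℝ) : sectorKernel α (-x) = conj (sectorKernel α x) := by
  have e : conj ((x : ℂ) + (2 * (Real.pi - 2 * α) : ℝ) * Complex.I) =
      -(-x + (2 * (Real.pi - 2 * α) : ℝ) * Complex.I) := by
    simp only [map_add, map_mul, Complex.conj_ofReal, Complex.conj_I]
    ring
  rw [sectorKernel, sectorKernel, map_mul, map_sub, conj_scaledTanh, conj_scaledTanh, e,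
    scaledTanh_neg, scaledTanh_neg, Complex.conj_ofReal]
  simp [Complex.conj_ofReal, map_ofNat]
  ring

theorem norm_sectorKernel_neg (α x : ℝ) : ‖sectorKernel α (-x)‖ = ‖sectorKernel α x‖ := by
  rw [sectorKernel_neg_ofReal, RCLike.norm_conj]

/-- The angle occurring in the real form of the kernel. -/
theorem phase_bounds (hα : 0 < α) (hα2 : α ≤ Real.pi / 2) :
    0 ≤ Real.pi / (4 * (Real.pi - α)) * (2 * (Real.pi - 2 * α)) ∧
    Real.pi / (4 * (Real.pi - α)) * (2 * (Real.pi - 2 * α)) < Real.pi / 2 := by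
  have hpi := Real.pi_pos
  have hb : 0 < Real.pi - α := by linarith
  constructor
  · have : 0 ≤ Real.pi - 2 * α := by linarith
    positivity
  · rw [div_mul_eq_mul_div, div_lt_div_iff₀ (by positivity) two_pos]
    nlinarith

theorem norm_sectorKernel (hα : 0 < α) (hα2 : α ≤ Real.pi / 2) (x : ℝ) :
    ‖sectorKernel α x‖ = 1 / (4 * (Real.pi - α)) *
      Real.sin (Real.pi / (4 * (Real.pi - α)) * (2 * (Real.pi - 2 * α))) /
      (√(Real.sinh (Real.pi / (4 * (Real.pi - α)) * x) ^ 2 +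
        Real.cos (Real.pi / (4 * (Real.pi - α)) * (2 * (Real.pi - 2 * α))) ^ 2) *
      Real.cosh (Real.pi / (4 * (Real.pi - α)) * x)) := by
  have hpi := Real.pi_pos
  have hb : 0 < Real.pi - α := by linarith
  obtain ⟨b1, b2⟩ := scaled_im_bounds hα hα2 (z := x) (by simp) (by simpa using hα.le)
  have c1 := complex_cosh_ne_zero_of_abs_im_lt b1
  have c2 := complex_cosh_ne_zero_of_abs_im_lt b2
  rw [sectorKernel_eq_div α c1 c2]
  obtain ⟨p1, p2⟩ := phase_bounds hα hα2
  set l : ℝ := Real.pi / (4 * (Real.pi - α)) with hl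
  set d := 2 * (Real.pi - 2 * α)
  have hs : 0 ≤ Real.sin (l * d) := Real.sin_nonneg_of_nonneg_of_le_pi p1 (by linarith)
  have hb' : ‖(4 * ((Real.pi : ℂ) - α))‖ = 4 * (Real.pi - α) := by
    rw [norm_mul, ← Complex.ofReal_sub, Complex.norm_real, Real.norm_of_nonneg hb.le]
    simp
  have n1 : ‖Complex.cosh ((l : ℂ) * x)‖ = Real.cosh (l * x) := by
    rw [← Complex.ofReal_mul, ← Complex.ofReal_cosh, Complex.norm_real,
      Real.norm_of_nonneg (Real.cosh_pos _).le]
  have n2 : ‖Complex.cosh ((l : ℂ) * (x + d * Complex.I))‖ =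
      √(Real.sinh (l * x) ^ 2 + Real.cos (l * d) ^ 2) := by
    rw [eq_comm, Real.sqrt_eq_iff_mul_self_eq (by positivity) (norm_nonneg _), ← sq, eq_comm,
      normSq_cosh_eq]
    congr 3 <;> simp
  rw [norm_div, norm_mul, norm_mul, norm_div, norm_one, hb', n1, n2, Complex.norm_real,
    Real.norm_of_nonneg hs]

open Filter Topology in
-- With l = π/(4(π - α)) and φ = 2l(π - 2α), a primitive of the modulus is arsinh(tan φ tanh(lx))/π,
-- so the integral is (2/π) arsinh(tan φ). The angle in the statement is (π/2 - φ)/2, whose tangent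
-- cos φ/(1 + sin φ) is exp(-arsinh(tan φ)).
theorem integral_norm_sectorKernel (hα : 0 < α) (hα2 : α ≤ Real.pi / 2) :
    ∫ x : ℝ, ‖sectorKernel α x‖ =
      -(2 / Real.pi * Real.log (Real.tan (α * Real.pi / (4 * (Real.pi - α))))) := by
  have hpi := Real.pi_pos
  have hb : 0 < Real.pi - α := by linarith
  have hint := (integrable_sectorKernel hα hα2).norm
  have hnorm := norm_sectorKernel hα hα2
  obtain ⟨p1, p2⟩ := phase_bounds hα hα2
  set l : ℝ := Real.pi / (4 * (Real.pi - α)) with hl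
  have hl0 : 0 < l := by positivity
  set φ := l * (2 * (Real.pi - 2 * α)) with hφ
  have hcos : 0 < Real.cos φ := Real.cos_pos_of_mem_Ioo ⟨by linarith, p2⟩
  have hsin : 0 ≤ Real.sin φ := Real.sin_nonneg_of_nonneg_of_le_pi p1 (by linarith)
  have hder : ∀ x : ℝ, HasDerivAt (fun x : ℝ => Real.arsinh (Real.tan φ *
      (Real.sinh (l * x) / Real.cosh (l * x))) / Real.pi) ‖sectorKernel α x‖ x := by
    intro x
    rw [hnorm]
    have hC := Real.cosh_pos (l * x)
    have hx : HasDerivAt (fun x : ℝ => l * x) l x := by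
      simpa using (hasDerivAt_id x).const_mul l
    have d1 := (((Real.hasDerivAt_sinh (l * x)).comp x hx).div
      ((Real.hasDerivAt_cosh (l * x)).comp x hx) hC.ne').const_mul (Real.tan φ)
    have := (d1.arsinh).div_const Real.pi
    convert! this using 1
    simp only [Function.comp, smul_eq_mul, Pi.div_apply]
    have hCS := Real.cosh_sq (l * x)
    have hsc := Real.sin_sq_add_cos_sq φ
    have hq : 0 < Real.sinh (l * x) ^ 2 + Real.cos φ ^ 2 := by positivity
    have e1 : 1 + (Real.tan φ * (Real.sinh (l * x) / Real.cosh (l * x))) ^ 2 =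
        (Real.sinh (l * x) ^ 2 + Real.cos φ ^ 2) / (Real.cos φ * Real.cosh (l * x)) ^ 2 := by
      rw [Real.tan_eq_sin_div_cos, eq_div_iff (by positivity)]
      field_simp
      rw [hCS]
      linear_combination (Real.sinh (l * x) ^ 2) * hsc
    have e2 : √(1 + (Real.tan φ * (Real.sinh (l * x) / Real.cosh (l * x))) ^ 2) =
        √(Real.sinh (l * x) ^ 2 + Real.cos φ ^ 2) / (Real.cos φ * Real.cosh (l * x)) := by
      rw [e1, Real.sqrt_div hq.le, Real.sqrt_sq (by positivity)]
    have hQ : 0 < √(Real.sinh (l * x) ^ 2 + Real.cos φ ^ 2) := Real.sqrt_pos.2 hq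
    have e3 : 1 / (4 * (Real.pi - α)) = l / Real.pi := by rw [hl]; field_simp
    rw [e2, e3, Real.tan_eq_sin_div_cos]
    generalize √(Real.sinh (l * x) ^ 2 + Real.cos φ ^ 2) = Q at *
    field_simp
    rw [hCS]
    ring
  have tl : Tendsto (fun x : ℝ => l * x) atTop atTop := tendsto_id.const_mul_atTop hl0
  have tanh_top : Tendsto (fun x : ℝ => Real.sinh x / Real.cosh x) atTop (𝓝 1) := by
    have h1 : Tendsto (fun x : ℝ => (1 - Real.exp (-(2 * x))) / (1 + Real.exp (-(2 * x)))) atTop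
        (𝓝 ((1 - 0) / (1 + 0))) := by
      have : Tendsto (fun x : ℝ => Real.exp (-(2 * x))) atTop (𝓝 0) :=
        Real.tendsto_exp_neg_atTop_nhds_zero.comp (tendsto_id.const_mul_atTop two_pos)
      exact (this.const_sub 1).div (this.const_add 1) (by norm_num)
    simp only [sub_zero, add_zero, div_one] at h1
    refine h1.congr fun x => ?_
    rw [Real.sinh_eq, Real.cosh_eq, div_div_div_cancel_right₀ two_ne_zero]
    have e : Real.exp (-(2 * x)) = Real.exp (-x) * Real.exp (-x) := by
      rw [← Real.exp_add]; congr 1; ring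
    have e2 : Real.exp x * Real.exp (-x) = 1 := by rw [← Real.exp_add]; simp
    rw [e, div_eq_div_iff (by positivity) (by positivity)]
    linear_combination (-2 * Real.exp (-x)) * e2
  have tanh_bot : Tendsto (fun x : ℝ => Real.sinh x / Real.cosh x) atBot (𝓝 (-1)) := by
    have := (tanh_top.comp tendsto_neg_atBot_atTop).neg
    refine this.congr fun x => ?_
    simp [neg_div]
  have lim : ∀ (f : Filter ℝ) (s : ℝ), Tendsto (fun x : ℝ => Real.sinh (l * x) / Real.cosh (l * x)) f
      (𝓝 s) → Tendsto (fun x : ℝ => Real.arsinh (Real.tan φ *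
      (Real.sinh (l * x) / Real.cosh (l * x))) / Real.pi) f
      (𝓝 (Real.arsinh (Real.tan φ * s) / Real.pi)) := fun f s h =>
    ((Real.continuous_arsinh.tendsto _).comp (h.const_mul _)).div_const _
  rw [integral_of_hasDerivAt_of_tendsto hder hint
    (lim _ _ (tanh_bot.comp (tendsto_id.const_mul_atBot hl0))) (lim _ _ (tanh_top.comp tl))]
  have hhalf : α * Real.pi / (4 * (Real.pi - α)) = (Real.pi / 2 - φ) / 2 := by
    rw [hφ, hl]
    field_simp
    ring
  have htan : Real.tan ((Real.pi / 2 - φ) / 2) = Real.cos φ / (1 + Real.sin φ) := by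
    have hc2 : 0 < Real.cos ((Real.pi / 2 - φ) / 2) :=
      Real.cos_pos_of_mem_Ioo ⟨by linarith, by linarith⟩
    have a1 := Real.sin_two_mul ((Real.pi / 2 - φ) / 2)
    have a2 := Real.cos_two_mul ((Real.pi / 2 - φ) / 2)
    rw [mul_div_cancel₀ _ two_ne_zero] at a1 a2
    rw [Real.sin_pi_div_two_sub] at a1
    rw [Real.cos_pi_div_two_sub] at a2
    rw [Real.tan_eq_sin_div_cos, div_eq_div_iff hc2.ne' (by positivity), a1, a2]
    ring
  have hars : Real.arsinh (Real.tan φ) = -Real.log (Real.cos φ / (1 + Real.sin φ)) := by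
    rw [Real.arsinh, ← Real.log_inv, inv_div]
    congr 1
    have : 1 + Real.tan φ ^ 2 = (1 / Real.cos φ) ^ 2 := by
      rw [Real.tan_eq_sin_div_cos]
      field_simp
      linarith [Real.sin_sq_add_cos_sq φ]
    rw [this, Real.sqrt_sq (by positivity), Real.tan_eq_sin_div_cos]
    field_simp
    ring
  rw [mul_neg, Real.arsinh_neg, mul_one, hhalf, htan, hars]
  ring

end SectorKernel

/-! ### Integral identities for bounded holomorphic functions on the strip. -/

/-- A function bounded by `M` and continuous on the closed strip `|im z| ≤ α`, and holomorphic
inside. -/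
structure IsStripFunction (α M : ℝ) (F : ℂ → ℂ) : Prop where
  continuousOn : ContinuousOn F (Complex.im ⁻¹' Set.Icc (-α) α)
  differentiableOn : DifferentiableOn ℂ F (Complex.im ⁻¹' Set.Ioo (-α) α)
  norm_le : ∀ z : ℂ, -α ≤ z.im → z.im ≤ α → ‖F z‖ ≤ M

namespace IsStripFunction

variable {α M : ℝ} {F : ℂ → ℂ}

theorem comp_neg (h : IsStripFunction α M F) : IsStripFunction α M fun z => F (-z) where
  continuousOn := h.continuousOn.comp continuous_neg.continuousOn fun z hz => by
    simp only [Set.mem_preimage, Set.mem_Icc, Complex.neg_im] at hz ⊢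
    constructor <;> linarith
  differentiableOn := h.differentiableOn.comp differentiable_neg.differentiableOn fun z hz => by
    simp only [Set.mem_preimage, Set.mem_Ioo, Complex.neg_im] at hz ⊢
    constructor <;> linarith
  norm_le z h1 h2 := h.norm_le _ (by simpa using h2) (by simpa using neg_le.1 h1)

theorem comp_add_ofReal (h : IsStripFunction α M F) (t : ℝ) :
    IsStripFunction α M fun z => F (t + z) where
  continuousOn := h.continuousOn.comp (continuous_const.add continuous_id).continuousOn
    fun z hz => by simpa using hz
  differentiableOn := h.differentiableOn.comp
    ((differentiable_const _).add differentiable_id).differentiableOn fun z hz => by simpa using hz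
  norm_le z h1 h2 := h.norm_le _ (by simpa using h1) (by simpa using h2)

theorem continuous_line (h : IsStripFunction α M F) {τ : ℝ} (h1 : -α ≤ τ) (h2 : τ ≤ α) :
    Continuous fun x : ℝ => F (x + τ * Complex.I) :=
  h.continuousOn.continuous_line h1 h2

theorem norm_line_le (h : IsStripFunction α M F) {τ : ℝ} (h1 : -α ≤ τ) (h2 : τ ≤ α) (x : ℝ) :
    ‖F (x + τ * Complex.I)‖ ≤ M :=
  h.norm_le _ (by simpa using h1) (by simpa using h2)

theorem continuous_real (h : IsStripFunction α M F) (hα : 0 < α) :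
    Continuous fun x : ℝ => F x := by
  simpa using h.continuous_line (τ := 0) (by linarith) hα.le

theorem norm_real_le (h : IsStripFunction α M F) (hα : 0 < α) (x : ℝ) : ‖F x‖ ≤ M := by
  simpa using h.norm_line_le (τ := 0) (by linarith) hα.le x

/-- Moving the line of integration for a kernel that is holomorphic in `0 ≤ im z ≤ α`. -/
theorem integral_kernel_mul_line (h : IsStripFunction α M F) (hα : 0 < α) {κ : ℂ → ℂ}
    (hκ : ∀ z : ℂ, 0 ≤ z.im → z.im ≤ α → DifferentiableAt ℂ κ z) (hD : StripDecay κ 0 α) :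
    ∫ y : ℝ, κ y * F (y - α * Complex.I) = ∫ y : ℝ, κ (y + α * Complex.I) * F y := by
  have hd : ∀ z : ℂ, -α ≤ z.im → z.im ≤ 0 →
      DifferentiableAt ℂ (fun z => κ (z + α * Complex.I)) z := by
    intro z h1 h2
    exact (hκ (z + α * Complex.I) (by simp; linarith) (by simp; linarith)).comp z
      (differentiableAt_id.add_const _)
  have hD' : StripDecay (fun z => κ (z + α * Complex.I)) (-α) 0 := by
    obtain ⟨C, R, hC⟩ := hD
    refine ⟨C, R, fun z h1 h2 h3 => ?_⟩
    simpa using hC (z + α * Complex.I) (by simp; linarith) (by simp; linarith) (by simpa using h3)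
  have key := integral_line_eq_of_differentiableOn (a := -α) (b := 0) (by linarith)
    (Φ := fun z => κ (z + α * Complex.I) * F z) ?_ ?_
    (hD'.mul_bounded (M := M) (R' := 0) fun z h1 h2 _ => h.norm_le z h1 (by linarith))
  · simp only [Complex.ofReal_neg, neg_mul, ← sub_eq_add_neg,
      sub_add_cancel, Complex.ofReal_zero, zero_mul, add_zero] at key
    exact key
  · intro z hz
    refine ContinuousWithinAt.mul (hd z hz.1 hz.2).continuousAt.continuousWithinAt ?_
    exact (h.continuousOn z ⟨hz.1, hz.2.trans hα.le⟩).mono fun w hw => ⟨hw.1, hw.2.trans hα.le⟩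
  · intro z hz
    refine DifferentiableWithinAt.mul (hd z hz.1.le hz.2.le).differentiableWithinAt ?_
    exact (h.differentiableOn z ⟨hz.1, hz.2.trans hα⟩).mono fun w hw => ⟨hw.1, hw.2.trans hα⟩

theorem integral_stripKernel_mul_lower (h : IsStripFunction α M F) (hα : 0 < α) {γ : ℝ}
    (hγ : α < γ) (hγπ : γ ≤ Real.pi) :
    ∫ y : ℝ, stripKernel γ y * F (y - α * Complex.I) =
      ∫ y : ℝ, stripKernel γ (y + α * Complex.I) * F y :=
  h.integral_kernel_mul_line hα (fun z h1 h2 => differentiableAt_stripKernel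
    (complex_cosh_ne_cos_of_abs_im_lt hγπ (by rw [abs_of_nonneg h1]; linarith)))
    (stripDecay_stripKernel γ 0 (L := id) (by simp) _ _)

theorem integral_sectorKernel_mul_lower (h : IsStripFunction α M F) (hα : 0 < α)
    (hα2 : α ≤ Real.pi / 2) :
    ∫ y : ℝ, sectorKernel α y * F (y - α * Complex.I) =
      ∫ y : ℝ, sectorKernel α (y + α * Complex.I) * F y :=
  h.integral_kernel_mul_line hα (fun _ h1 h2 => differentiableAt_sectorKernel hα hα2 h1 h2)
    (stripDecay_sectorKernel hα hα2)

theorem integral_sectorKernel_neg_mul_upper (h : IsStripFunction α M F) (hα : 0 < α)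
    (hα2 : α ≤ Real.pi / 2) :
    ∫ y : ℝ, sectorKernel α (-y) * F (y + α * Complex.I) =
      ∫ y : ℝ, sectorKernel α (-y + α * Complex.I) * F y := by
  have := h.comp_neg.integral_sectorKernel_mul_lower hα hα2
  rw [← integral_neg_eq_self, ← integral_neg_eq_self (fun y : ℝ => sectorKernel α
    (y + α * Complex.I) * F (-y))] at this
  simpa [add_comm] using this

open Filter Topology in
-- For γ < α the shift of the contour from Im z = α down to the central line crosses the pole i(α -
-- γ) of the kernel. Its residue is the value of F there, and this is how the interior value enters
-- `interior_identity`.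
theorem integral_stripKernel_mul_upper (h : IsStripFunction α M F) (hα2 : α ≤ Real.pi / 2)
    {γ : ℝ} (hγ : 0 < γ) (hγα : γ < α) :
    ∫ y : ℝ, stripKernel γ y * F (y + α * Complex.I) = F ((α - γ : ℝ) * Complex.I) +
      ∫ y : ℝ, stripKernel γ (y - α * Complex.I) * F y := by
  have hpi := Real.pi_pos
  have hα : 0 < α := by linarith
  set p : ℂ := (α - γ : ℝ) * Complex.I with hp
  have hpim : p.im = α - γ := by simp [hp]
  have hsin : (Real.sin γ : ℂ) ≠ 0 := by
    exact_mod_cast (Real.sin_pos_of_pos_of_lt_pi hγ (by linarith)).ne'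
  have hpiC : (Real.pi : ℂ) ≠ 0 := by exact_mod_cast hpi.ne'
  have zeros : ∀ z : ℂ, 0 ≤ z.im → z.im ≤ α → z ≠ p →
      Complex.cosh (z - α * Complex.I) - Real.cos γ ≠ 0 := by
    intro z h1 h2 hz h0
    obtain ⟨k, hk | hk⟩ := complex_cosh_eq_cos_iff.1 (sub_eq_zero.1 h0)
    all_goals
      have him := congrArg Complex.im hk
      simp at him
    · have l1 : (-1 : ℝ) < k := by nlinarith
      have l2 : (k : ℝ) < 0 := by nlinarith
      have l1' : -1 < k := by exact_mod_cast l1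
      have l2' : k < 0 := by exact_mod_cast l2
      omega
    · have hk0 : k = 0 := by
        have l1 : (-1 : ℝ) < k := by nlinarith
        have l2 : (k : ℝ) < 1 := by nlinarith
        have l1' : -1 < k := by exact_mod_cast l1
        have l2' : k < 1 := by exact_mod_cast l2
        omega
      subst hk0
      apply hz
      push_cast at hk
      rw [hp]
      push_cast
      linear_combination hk
  have dk : ∀ z : ℂ, 0 ≤ z.im → z.im ≤ α → z ≠ p →
      DifferentiableAt ℂ (fun z => stripKernel γ (z - α * Complex.I)) z := by
    intro z h1 h2 hz
    exact DifferentiableAt.comp (f := fun z => z - α * Complex.I) (g := stripKernel γ) z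
      (differentiableAt_stripKernel (zeros z h1 h2 hz)) (differentiableAt_id.sub_const _)
  have hFp : ContinuousAt F p := by
    refine ((h.differentiableOn p ?_).differentiableAt
      ((isOpen_Ioo.preimage Complex.continuous_im).mem_nhds ?_)).continuousAt
    all_goals
      simp only [Set.mem_preimage, hpim, Set.mem_Ioo]
      constructor <;> linarith
  have dcosh : HasDerivAt (fun z => 2 * Real.pi * (Complex.cosh (z - α * Complex.I) - Real.cos γ))
      (2 * Real.pi * Complex.sinh (p - α * Complex.I)) p := by
    have := (((Complex.hasDerivAt_cosh (p - α * Complex.I)).comp p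
      ((hasDerivAt_id p).sub_const (α * Complex.I))).sub_const
      ((Real.cos γ : ℝ) : ℂ)).const_mul (2 * Real.pi : ℂ)
    simpa using this
  have hps : p - α * Complex.I = -(γ * Complex.I) := by
    rw [hp]; push_cast; ring
  have hsh : Complex.sinh (p - α * Complex.I) = -(Real.sin γ * Complex.I) := by
    rw [hps, Complex.sinh_neg, Complex.sinh_mul_I, Complex.ofReal_sin]
  have key := integral_line_sub_integral_line_eq_sum_residues hα {p}
    (fun _ => -(F p / (2 * Real.pi * Complex.I)))
    (Φ := fun z => stripKernel γ (z - α * Complex.I) * F z) ?_ ?_ ?_ ?_ ?_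
  · simp only [Finset.sum_singleton, Complex.ofReal_zero, zero_mul, add_zero,
      add_sub_cancel_right] at key
    have : 2 * Real.pi * Complex.I * -(F p / (2 * Real.pi * Complex.I)) = -F p := by
      field_simp
    rw [this] at key
    linear_combination -key
  · intro q hq
    rw [Finset.mem_singleton.1 hq, hpim]
    constructor <;> linarith
  · intro z hz
    have hz1 : 0 ≤ z.im ∧ z.im ≤ α := hz.1
    have hz2 : z ≠ p := by simpa using hz.2
    refine ContinuousWithinAt.mul (dk z hz1.1 hz1.2 hz2).continuousAt.continuousWithinAt ?_
    exact (h.continuousOn z ⟨by linarith, hz1.2⟩).mono fun w hw =>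
      ⟨by have : 0 ≤ w.im := hw.1.1; linarith, hw.1.2⟩
  · intro z hz
    have hz1 : 0 < z.im ∧ z.im < α := hz.1
    have hz2 : z ≠ p := by simpa using hz.2
    refine DifferentiableWithinAt.mul (dk z hz1.1.le hz1.2.le hz2).differentiableWithinAt ?_
    exact (h.differentiableOn z ⟨by linarith, hz1.2⟩).mono fun w hw =>
      ⟨by have : 0 < w.im := hw.1.1; linarith, hw.1.2⟩
  · exact (stripDecay_stripKernel γ 0 (L := fun z => z - α * Complex.I) (by simp) _ _).mul_bounded
      (R' := 0) fun z h1 h2 _ => h.norm_le z (by linarith) h2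
  · intro q hq
    rw [Finset.mem_singleton.1 hq]
    have := tendsto_sub_mul_div_of_hasDerivAt dcosh ?_ ?_ (hFp.const_mul ((Real.sin γ : ℝ) : ℂ))
    · have er : -(F p / (2 * Real.pi * Complex.I)) = (Real.sin γ : ℂ) * F p /
          (2 * Real.pi * Complex.sinh (p - α * Complex.I)) := by
        rw [hsh]
        field_simp
      rw [er]
      refine this.congr fun z => ?_
      simp only [stripKernel]
      ring
    · rw [hps, Complex.cosh_neg, Complex.cosh_mul_I, Complex.ofReal_cos]
      simp
    · rw [hsh]
      simpa [hpiC] using hsin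

end IsStripFunction

/-- The convolution of `stripKernel γ` and the kernel of the sector moved to the central line. -/
noncomputable def convKernel (α γ x : ℝ) : ℂ :=
  ∫ y : ℝ, stripKernel γ (x - y) * sectorKernel α (-y + α * Complex.I)

theorem convKernel_eq_integral_sub (α γ x : ℝ) :
    convKernel α γ x = ∫ y : ℝ, stripKernel γ y * sectorKernel α (-(x - y) + α * Complex.I) := by
  rw [convKernel, ← integral_sub_left_eq_self _ _ x]
  simp

theorem integrable_convKernel_integrand {α γ : ℝ} (hα : 0 < α) (hα2 : α ≤ Real.pi / 2) (hγ : 0 < γ)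
    (hγπ : γ ≤ Real.pi) : Integrable (fun p : ℝ × ℝ =>
      stripKernel γ p.2 * sectorKernel α (-(p.1 - p.2 : ℝ) + α * Complex.I)) := by
  have h1 := integrable_stripKernel hγ hγπ
  have h2 : Integrable fun y : ℝ => sectorKernel α (-y + α * Complex.I) := by
    have := (integrable_sectorKernel_line hα hα2 hα.le le_rfl).comp_neg
    simpa using this
  exact h1.convolution_integrand (ContinuousLinearMap.mul ℝ ℂ) h2

theorem integrable_convKernel {α γ : ℝ} (hα : 0 < α) (hα2 : α ≤ Real.pi / 2) (hγ : 0 < γ)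
    (hγπ : γ ≤ Real.pi) : Integrable (convKernel α γ) := by
  have := (integrable_convKernel_integrand hα hα2 hγ hγπ).integral_prod_left
  refine this.congr (Filter.Eventually.of_forall fun x => ?_)
  simp only
  rw [convKernel_eq_integral_sub]
  push_cast
  rfl

namespace IsStripFunction

variable {α M : ℝ} {F : ℂ → ℂ}

/-- The inner contour is moved to the central line and the order of integration is exchanged by
Fubini. What is left is F on the real line against the convolution of the kernels. -/
theorem integral_stripKernel_mul_integral_sectorKernel_upper (h : IsStripFunction α M F)
    (hα : 0 < α) (hα2 : α ≤ Real.pi / 2) {γ : ℝ} (hγ : 0 < γ) (hγπ : γ ≤ Real.pi) :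
    ∫ y : ℝ, stripKernel γ y * ∫ y' : ℝ, sectorKernel α (-y') * F (y + y' + α * Complex.I) =
      ∫ x : ℝ, convKernel α γ x * F x := by
  have step : ∀ y : ℝ, ∫ y' : ℝ, sectorKernel α (-y') * F (y + y' + α * Complex.I) =
      ∫ x : ℝ, sectorKernel α (-(x - y : ℝ) + α * Complex.I) * F x := by
    intro y
    have := (h.comp_add_ofReal y).integral_sectorKernel_neg_mul_upper hα hα2
    simp only [← add_assoc] at this
    rw [this, ← integral_sub_right_eq_self _ y]
    push_cast
    simp
  have hI := (integrable_convKernel_integrand hα hα2 hγ hγπ).mul_bdd (c := M)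
    (g := fun p : ℝ × ℝ => F p.1)
    ((h.continuous_real hα).comp continuous_fst).aestronglyMeasurable
    (Filter.Eventually.of_forall fun p => h.norm_real_le hα _)
  simp only [step, ← integral_const_mul, ← mul_assoc]
  rw [← integral_integral_swap hI]
  refine integral_congr_ae (Filter.Eventually.of_forall fun x => ?_)
  simp only
  rw [integral_mul_const, convKernel_eq_integral_sub]
  push_cast
  rfl

theorem integral_stripKernel_mul_integral_sectorKernel_lower (h : IsStripFunction α M F)
    (hα : 0 < α) (hα2 : α ≤ Real.pi / 2) {γ : ℝ} (hγ : 0 < γ) (hγπ : γ ≤ Real.pi) :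
    ∫ y : ℝ, stripKernel γ y * ∫ y' : ℝ, sectorKernel α y' * F (y + y' - α * Complex.I) =
      ∫ x : ℝ, convKernel α γ (-x) * F x := by
  have := h.comp_neg.integral_stripKernel_mul_integral_sectorKernel_upper hα hα2 hγ hγπ
  rw [← integral_neg_eq_self, ← integral_neg_eq_self (fun x : ℝ => convKernel α γ x * F (-x))]
    at this
  have e : ∀ y : ℝ, ∫ y' : ℝ, sectorKernel α (-y') * F (-(-y + y' + α * Complex.I)) =
      ∫ y' : ℝ, sectorKernel α y' * F (y + y' - α * Complex.I) := by
    intro y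
    rw [← integral_neg_eq_self]
    refine integral_congr_ae (Filter.Eventually.of_forall fun x => ?_)
    simp only [Complex.ofReal_neg, neg_neg]
    congr 2
    ring
  simp only [Complex.ofReal_neg, stripKernel_neg, neg_neg, e] at this
  exact this

theorem integrable_mul (h : IsStripFunction α M F) (hα : 0 < α) {κ : ℝ → ℂ} (hκ : Integrable κ) :
    Integrable fun x : ℝ => κ x * F x :=
  hκ.mul_bdd (h.continuous_real hα).aestronglyMeasurable
    (Filter.Eventually.of_forall fun _ => h.norm_real_le hα _)

/-- The boundary integral equation on the upper side. -/
theorem boundary_identity_upper (h : IsStripFunction α M F) (hα : 0 < α) (hα2 : α ≤ Real.pi / 2) :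
    ∫ y : ℝ, stripKernel (2 * α) y * F (y - α * Complex.I) =
      1 / 2 * (∫ y : ℝ, sectorKernel α y * F (y - α * Complex.I)) +
      1 / 2 * ∫ y : ℝ, stripKernel (2 * α) y *
        ∫ y' : ℝ, sectorKernel α (-y') * F (y + y' + α * Complex.I) := by
  have hpi := Real.pi_pos
  -- For a half-plane both kernels vanish identically, as sin 2α = 0 and π - 2α = 0. The convolution
  -- formula would not apply, because it needs γ = 2α < π.
  rcases hα2.eq_or_lt with heq | hlt
  · have e1 : ∀ z, stripKernel (2 * α) z = 0 := by
      intro z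
      rw [stripKernel, heq, mul_div_cancel₀ _ two_ne_zero]
      simp
    have e2 : ∀ z, sectorKernel α z = 0 := by
      intro z
      rw [sectorKernel, show Real.pi - 2 * α = 0 by rw [heq]; ring]
      simp
    simp [e1, e2]
  rw [h.integral_stripKernel_mul_lower hα (by linarith) (by linarith),
    h.integral_sectorKernel_mul_lower hα hα2,
    h.integral_stripKernel_mul_integral_sectorKernel_upper hα hα2 (by linarith) (by linarith),
    ← integral_const_mul, ← integral_const_mul, ← integral_add]
  -- At γ = 2α the hyperbolic tangents in the convolution amount to minus the sector kernel at x +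
  -- iα. The convolution is therefore twice the strip kernel minus the sector kernel, whence the
  -- factors 1/2 in the statement.
  · refine integral_congr_ae (Filter.Eventually.of_forall fun x => ?_)
    simp only
    rw [convKernel, integral_stripKernel_mul_sectorKernel hα hα2 (by linarith) (by linarith)
      (by linarith), sectorKernel]
    have a1 : (x : ℂ) + α * Complex.I + (2 * (Real.pi - 2 * α) : ℝ) * Complex.I =
        x - α * Complex.I - (2 * α : ℝ) * Complex.I + 2 * Real.pi * Complex.I := by
      push_cast; ring
    have a2 : (x : ℂ) - α * Complex.I + (2 * α : ℝ) * Complex.I = x + α * Complex.I := by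
      push_cast; ring
    rw [a1, a2]
    ring
  · exact (h.integrable_mul hα (integrable_sectorKernel_line hα hα2 hα.le le_rfl)).const_mul _
  · exact (h.integrable_mul hα
      (integrable_convKernel hα hα2 (by linarith) (by linarith))).const_mul _

/-- The boundary integral equation on the lower side. -/
theorem boundary_identity_lower (h : IsStripFunction α M F) (hα : 0 < α) (hα2 : α ≤ Real.pi / 2) :
    ∫ y : ℝ, stripKernel (2 * α) y * F (y + α * Complex.I) =
      1 / 2 * (∫ y : ℝ, sectorKernel α (-y) * F (y + α * Complex.I)) +
      1 / 2 * ∫ y : ℝ, stripKernel (2 * α) y *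
        ∫ y' : ℝ, sectorKernel α y' * F (y + y' - α * Complex.I) := by
  have key := h.comp_neg.boundary_identity_upper hα hα2
  rw [← integral_neg_eq_self, ← integral_neg_eq_self (fun y : ℝ => sectorKernel α y *
    F (-(y - α * Complex.I))), ← integral_neg_eq_self (fun y : ℝ => stripKernel (2 * α) y *
      ∫ y' : ℝ, sectorKernel α (-y') * F (-(y + y' + α * Complex.I)))] at key
  have e : ∀ y : ℝ, ∫ y' : ℝ, sectorKernel α (-y') * F (-(-y + y' + α * Complex.I)) =
      ∫ y' : ℝ, sectorKernel α y' * F (y + y' - α * Complex.I) := by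
    intro y
    rw [← integral_neg_eq_self]
    refine integral_congr_ae (Filter.Eventually.of_forall fun x => ?_)
    simp only [Complex.ofReal_neg, neg_neg]
    congr 2
    ring
  have e2 : ∀ y : ℝ, -(-(y : ℂ) - α * Complex.I) = y + α * Complex.I := fun y => by ring
  simp only [Complex.ofReal_neg, stripKernel_neg, e, e2] at key
  exact key

theorem integrable_stripKernel_line {γ δ : ℝ} (hγπ : γ ≤ Real.pi) (hδ : |δ| < γ) :
    Integrable fun x : ℝ => stripKernel γ (x + δ * Complex.I) := by
  refine (stripDecay_stripKernel γ 0 (L := id) (by simp) δ δ).integrable le_rfl le_rfl ?_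
  rw [continuous_iff_continuousAt]
  intro x
  refine ContinuousAt.comp (f := fun x : ℝ => (x : ℂ) + δ * Complex.I) (g := stripKernel γ)
    (differentiableAt_stripKernel (complex_cosh_ne_cos_of_abs_im_lt hγπ ?_)).continuousAt
    (by fun_prop)
  simpa using hδ

/-- The value of a bounded holomorphic function at a point of the upper half of the strip, as a
double layer potential. -/
theorem interior_identity (h : IsStripFunction α M F) (hα2 : α ≤ Real.pi / 2) {ϑ : ℝ}
    (h0 : 0 < ϑ) (h1 : ϑ < α) :
    (∫ y : ℝ, stripKernel (α - ϑ) y * F (y + α * Complex.I)) +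
      (∫ y : ℝ, stripKernel (α + ϑ) y * F (y - α * Complex.I)) =
    F (ϑ * Complex.I) + 1 / 2 * (∫ y : ℝ, stripKernel (α - ϑ) y *
        ∫ y' : ℝ, sectorKernel α y' * F (y + y' - α * Complex.I)) +
      1 / 2 * ∫ y : ℝ, stripKernel (α + ϑ) y *
        ∫ y' : ℝ, sectorKernel α (-y') * F (y + y' + α * Complex.I) := by
  have hpi := Real.pi_pos
  have hα : 0 < α := by linarith
  have hb : Real.pi - α ≠ 0 := by linarith
  rw [h.integral_stripKernel_mul_upper hα2 (by linarith) (by linarith),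
    h.integral_stripKernel_mul_lower hα (by linarith) (by linarith),
    h.integral_stripKernel_mul_integral_sectorKernel_upper hα hα2 (by linarith) (by linarith),
    h.integral_stripKernel_mul_integral_sectorKernel_lower hα hα2 (by linarith) (by linarith),
    sub_sub_cancel, add_assoc, add_assoc, ← integral_const_mul, ← integral_const_mul]
  congr 1
  have hi1 : Integrable fun x : ℝ => stripKernel (α - ϑ) (x - α * Complex.I) := by
    refine ((stripDecay_stripKernel (α - ϑ) 0 (L := id) (by simp) (-α) (-α)).integrable le_rfl le_rfl
      ?_).congr (Filter.Eventually.of_forall fun x => ?_)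
    · rw [continuous_iff_continuousAt]
      intro x
      refine ContinuousAt.comp (f := fun x : ℝ => (x : ℂ) + (-α : ℝ) * Complex.I)
        (g := stripKernel (α - ϑ)) (differentiableAt_stripKernel fun h0 => ?_).continuousAt
        (by fun_prop)
      obtain ⟨k, hk | hk⟩ := complex_cosh_eq_cos_iff.1 (sub_eq_zero.1 h0)
      all_goals
        have him := congrArg Complex.im hk
        simp at him
      · have l1 : (-1 : ℝ) < k := by nlinarith
        have l2 : (k : ℝ) < 0 := by nlinarith
        have l1' : -1 < k := by exact_mod_cast l1
        have l2' : k < 0 := by exact_mod_cast l2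
        omega
      · have l1 : (-1 : ℝ) < k := by nlinarith
        have l2 : (k : ℝ) < 0 := by nlinarith
        have l1' : -1 < k := by exact_mod_cast l1
        have l2' : k < 0 := by exact_mod_cast l2
        omega
    · simp [← sub_eq_add_neg]
  have hi2 : Integrable fun x : ℝ => stripKernel (α + ϑ) (x + α * Complex.I) :=
    integrable_stripKernel_line (by linarith) (by rw [abs_of_pos hα]; linarith)
  rw [← integral_add (h.integrable_mul hα hi1) (h.integrable_mul hα hi2), ← integral_add]
  -- The hyperbolic tangents for γ = α - ϑ at -x and for γ = α + ϑ at x cancel, by oddness and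
  -- periodicity. Only the strip kernels remain. Here 0 < ϑ ensures γ ≠ α in the convolution
  -- formula.
  · refine integral_congr_ae (Filter.Eventually.of_forall fun x => ?_)
    simp only
    rw [convKernel, convKernel, integral_stripKernel_mul_sectorKernel hα hα2 (by linarith)
      (by linarith) (by linarith), integral_stripKernel_mul_sectorKernel hα hα2 (by linarith)
      (by linarith) (by linarith)]
    have s1 : stripKernel (α - ϑ) ((-x : ℝ) + α * Complex.I) =
        stripKernel (α - ϑ) (x - α * Complex.I) := by
      rw [← stripKernel_neg]
      congr 1
      push_cast
      ring
    have t1 : scaledTanh (Real.pi - α) ((-x : ℝ) - α * Complex.I + (α - ϑ : ℝ) * Complex.I) =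
        -scaledTanh (Real.pi - α) (x - α * Complex.I + (α + ϑ : ℝ) * Complex.I) := by
      rw [← scaledTanh_neg]
      congr 1
      push_cast
      ring
    have t2 : scaledTanh (Real.pi - α)
        ((-x : ℝ) - α * Complex.I - (α - ϑ : ℝ) * Complex.I + 2 * Real.pi * Complex.I) =
        -scaledTanh (Real.pi - α)
          (x - α * Complex.I - (α + ϑ : ℝ) * Complex.I + 2 * Real.pi * Complex.I) := by
      rw [← scaledTanh_neg, ← scaledTanh_periodic hb (-_)]
      congr 1
      push_cast
      ring
    rw [s1, t1, t2]
    ring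
  · exact (h.integrable_mul hα
      (integrable_convKernel hα hα2 (by linarith) (by linarith)).comp_neg).const_mul _
  · exact (h.integrable_mul hα
      (integrable_convKernel hα hα2 (by linarith) (by linarith))).const_mul _

end IsStripFunction

/-! ### Geometry of the sector: sides, boundary, normals, and the kernel on rays. -/

section Geometry

/-- The point at distance `t` from `c` in the direction `exp (ψ i)`. -/
noncomputable def rayPoint (c : ℂ) (ψ t : ℝ) : ℂ := c + t * Complex.exp (ψ * Complex.I)

/-- The linear function that is negative on the side of the sector bounded by the ray in the
direction `θ + ε α`. -/
noncomputable def sideFun (c : ℂ) (θ α ε : ℝ) (z : ℂ) : ℝ :=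
  ε * ((z - c) * Complex.exp (-((θ + ε * α : ℝ) * Complex.I))).im

variable {c : ℂ} {θ α : ℝ}

theorem continuous_sideFun (c : ℂ) (θ α ε : ℝ) : Continuous (sideFun c θ α ε) := by
  unfold sideFun
  exact continuous_const.mul (Complex.continuous_im.comp (by fun_prop))

theorem sideFun_eq {ε : ℝ} (hε : ε = 1 ∨ ε = -1) (c : ℂ) (θ α : ℝ) (z : ℂ) : sideFun c θ α ε z =
    ε * ((z - c) * Complex.exp (-(θ * Complex.I))).im * Real.cos α -
      ((z - c) * Complex.exp (-(θ * Complex.I))).re * Real.sin α := by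
  have e : Complex.exp (-((θ + ε * α : ℝ) * Complex.I)) =
      Complex.exp (-(θ * Complex.I)) * Complex.exp ((-(ε * α) : ℝ) * Complex.I) := by
    rw [← Complex.exp_add]
    congr 1
    push_cast
    ring
  rw [sideFun, e, ← mul_assoc, Complex.exp_mul_I, ← Complex.ofReal_cos, ← Complex.ofReal_sin]
  rcases hε with rfl | rfl <;>
    simp [Complex.add_im, Complex.mul_im, Complex.cos_ofReal_re, Complex.sin_ofReal_re] <;> ring

/-- A convex sector is the intersection of two half-planes. With ζ the coordinate relative to the
axis, both inequalities together say |Im ζ| cos α < Re ζ sin α, that is sin(|arg ζ| - α) < 0. -/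
theorem mem_sector_iff (hα : 0 < α) (hα2 : α ≤ Real.pi / 2) {z : ℂ} :
    z ∈ sector c θ α ↔ ∀ ε : ℝ, ε = 1 ∨ ε = -1 → sideFun c θ α ε z < 0 := by
  have hpi := Real.pi_pos
  set ζ := (z - c) * Complex.exp (-(θ * Complex.I)) with hζ
  have h2 : (∀ ε : ℝ, ε = 1 ∨ ε = -1 → sideFun c θ α ε z < 0) ↔
      |ζ.im| * Real.cos α < ζ.re * Real.sin α := by
    have hc : 0 ≤ Real.cos α := Real.cos_nonneg_of_mem_Icc ⟨by linarith, hα2⟩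
    have : |ζ.im| * Real.cos α = |ζ.im * Real.cos α| := by rw [abs_mul, abs_of_nonneg hc]
    rw [this, abs_lt]
    constructor
    · intro h
      have h1 := h 1 (Or.inl rfl)
      have h2 := h (-1) (Or.inr rfl)
      rw [sideFun_eq (Or.inl rfl)] at h1
      rw [sideFun_eq (Or.inr rfl)] at h2
      constructor <;> linarith
    · rintro ⟨h1, h2⟩ ε hε
      rw [sideFun_eq hε]
      rcases hε with rfl | rfl <;> linarith
  rw [h2]
  show z ≠ c ∧ |Complex.arg ζ| < α ↔ _
  by_cases hz : z = c
  · subst hz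
    simp [hζ]
  have hζ0 : ζ ≠ 0 := mul_ne_zero (sub_ne_zero.2 hz) (Complex.exp_ne_zero _)
  have hn : 0 < ‖ζ‖ := norm_pos_iff.2 hζ0
  have hre : ζ.re = ‖ζ‖ * Real.cos |Complex.arg ζ| := by
    rw [Real.cos_abs, Complex.cos_arg hζ0]
    field_simp
  have him : |ζ.im| = ‖ζ‖ * Real.sin |Complex.arg ζ| := by
    have h1 : Real.sin |Complex.arg ζ| = |Real.sin (Complex.arg ζ)| := by
      rcases le_total 0 (Complex.arg ζ) with h | h
      · rw [abs_of_nonneg h, abs_of_nonneg (Real.sin_nonneg_of_nonneg_of_le_pi h (Complex.arg_le_pi _))]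
      · rw [abs_of_nonpos h, Real.sin_neg, abs_of_nonpos]
        exact Real.sin_nonpos_of_nonpos_of_neg_pi_le h (Complex.neg_pi_lt_arg _).le
    rw [h1, Complex.sin_arg, abs_div, abs_of_pos hn]
    field_simp
  have habs : |Complex.arg ζ| ≤ Real.pi := Complex.abs_arg_le_pi ζ
  have h0 := abs_nonneg (Complex.arg ζ)
  have hsub : ‖ζ‖ * Real.sin |Complex.arg ζ| * Real.cos α < ‖ζ‖ * Real.cos |Complex.arg ζ| * Real.sin α
      ↔ ‖ζ‖ * Real.sin (|Complex.arg ζ| - α) < 0 := by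
    rw [← sub_neg, Real.sin_sub]
    ring_nf
  rw [hre, him, hsub]
  simp only [ne_eq, hz, not_false_eq_true, true_and]
  constructor
  · intro h
    exact mul_neg_of_pos_of_neg hn (Real.sin_neg_of_neg_of_neg_pi_lt (by linarith) (by linarith))
  · intro h
    by_contra hcon
    have := Real.sin_nonneg_of_nonneg_of_le_pi (x := |Complex.arg ζ| - α)
      (by linarith [not_lt.1 hcon]) (by linarith)
    nlinarith

theorem isOpen_sector (hα : 0 < α) (hα2 : α ≤ Real.pi / 2) : IsOpen (sector c θ α) := by
  have : sector c θ α = {z | sideFun c θ α 1 z < 0} ∩ {z | sideFun c θ α (-1) z < 0} := by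
    ext z
    rw [mem_sector_iff hα hα2]
    simp
  rw [this]
  exact (isOpen_lt (continuous_sideFun _ _ _ _) continuous_const).inter
    (isOpen_lt (continuous_sideFun _ _ _ _) continuous_const)

/-- A translation by t along the axis lowers both side functions by t sin α, so it pushes points
satisfying the weak inequalities into the open sector. -/
theorem mem_closure_sector_iff (hα : 0 < α) (hα2 : α ≤ Real.pi / 2) {z : ℂ} :
    z ∈ closure (sector c θ α) ↔ ∀ ε : ℝ, ε = 1 ∨ ε = -1 → sideFun c θ α ε z ≤ 0 := by
  have hpi := Real.pi_pos
  have hs : 0 < Real.sin α := Real.sin_pos_of_pos_of_lt_pi hα (by linarith)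
  constructor
  · intro h ε hε
    refine closure_minimal (s := sector c θ α) (t := {z | sideFun c θ α ε z ≤ 0}) ?_
      (isClosed_le (continuous_sideFun _ _ _ _) continuous_const) h
    intro w hw
    exact ((mem_sector_iff hα hα2).1 hw ε hε).le
  · intro h
    have lim : Filter.Tendsto (fun t : ℝ => z + t * Complex.exp (θ * Complex.I))
        (nhdsWithin 0 (Set.Ioi 0)) (nhds z) := by
      have : Filter.Tendsto (fun t : ℝ => z + t * Complex.exp (θ * Complex.I)) (nhds 0)
          (nhds (z + (0 : ℝ) * Complex.exp (θ * Complex.I))) := Continuous.tendsto (by fun_prop) 0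
      simpa using this.mono_left nhdsWithin_le_nhds
    refine mem_closure_of_tendsto lim ?_
    filter_upwards [self_mem_nhdsWithin] with t ht
    rw [mem_sector_iff hα hα2]
    intro ε hε
    have h1 := h ε hε
    rw [sideFun_eq hε] at h1 ⊢
    have e : (z + t * Complex.exp (θ * Complex.I) - c) * Complex.exp (-(θ * Complex.I)) =
        (z - c) * Complex.exp (-(θ * Complex.I)) + t := by
      have : Complex.exp (θ * Complex.I) * Complex.exp (-(θ * Complex.I)) = 1 := by
        rw [← Complex.exp_add]; simp
      linear_combination (t : ℂ) * this
    rw [e]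
    have ht' : 0 < t := ht
    simp only [Complex.add_im, Complex.ofReal_im, add_zero, Complex.add_re, Complex.ofReal_re]
    nlinarith [mul_pos ht' hs]

theorem mem_frontier_sector_iff (hα : 0 < α) (hα2 : α ≤ Real.pi / 2) {z : ℂ} :
    z ∈ frontier (sector c θ α) ↔ ∃ ε : ℝ, (ε = 1 ∨ ε = -1) ∧ ∃ t : ℝ, 0 ≤ t ∧
      z = rayPoint c (θ + ε * α) t := by
  have hpi := Real.pi_pos
  have hs : 0 < Real.sin α := Real.sin_pos_of_pos_of_lt_pi hα (by linarith)
  have hc : 0 ≤ Real.cos α := Real.cos_nonneg_of_mem_Icc ⟨by linarith, hα2⟩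
  rw [(isOpen_sector hα hα2).frontier_eq, Set.mem_sdiff, mem_closure_sector_iff hα hα2,
    mem_sector_iff hα hα2]
  set ζ := (z - c) * Complex.exp (-(θ * Complex.I)) with hζ
  have hzζ : z = c + ζ * Complex.exp (θ * Complex.I) := by
    have : Complex.exp (-(θ * Complex.I)) * Complex.exp (θ * Complex.I) = 1 := by
      rw [← Complex.exp_add]; simp
    rw [hζ, mul_assoc, this]
    ring
  have hray : ∀ ε : ℝ, (ε = 1 ∨ ε = -1) → ∀ t : ℝ,
      (z = rayPoint c (θ + ε * α) t ↔ ζ.re = t * Real.cos α ∧ ζ.im = t * (ε * Real.sin α)) := by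
    intro ε hε t
    have e : rayPoint c (θ + ε * α) t =
        c + (t * Complex.exp ((ε * α : ℝ) * Complex.I)) * Complex.exp (θ * Complex.I) := by
      rw [rayPoint, mul_assoc, ← Complex.exp_add]
      congr 3
      push_cast
      ring
    have e2 : Complex.exp ((ε * α : ℝ) * Complex.I) =
        ((Real.cos α : ℝ) : ℂ) + ((ε * Real.sin α : ℝ) : ℂ) * Complex.I := by
      rw [Complex.exp_mul_I, ← Complex.ofReal_cos, ← Complex.ofReal_sin]
      rcases hε with rfl | rfl <;> simp
    rw [e, hzζ, add_right_inj, mul_left_inj' (Complex.exp_ne_zero _), e2, Complex.ext_iff]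
    simp [Complex.cos_ofReal_re, Complex.sin_ofReal_re]
  constructor
  · rintro ⟨h1, h2⟩
    push Not at h2
    obtain ⟨ε, hε, h3⟩ := h2
    have h4 : sideFun c θ α ε z = 0 := le_antisymm (h1 ε hε) h3
    have h5 := h1 1 (Or.inl rfl)
    have h6 := h1 (-1) (Or.inr rfl)
    rw [sideFun_eq hε] at h4
    rw [sideFun_eq (Or.inl rfl)] at h5
    rw [sideFun_eq (Or.inr rfl)] at h6
    rw [← hζ] at h4 h5 h6
    -- In the half-plane case the two rays form one line, and the sign of Im ζ decides on which ray
    -- the point lies. Otherwise the parameter is found by dividing by cos α.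
    rcases hc.eq_or_lt with hc0 | hc0
    · rw [← hc0] at h4
      have hre : ζ.re = 0 := by
        have : ζ.re * Real.sin α = 0 := by linarith
        exact (mul_eq_zero.1 this).resolve_right hs.ne'
      have hs1 : Real.sin α = 1 := by
        have := Real.sin_sq_add_cos_sq α
        rw [← hc0] at this
        nlinarith
      rcases le_total 0 ζ.im with hi | hi
      · exact ⟨1, Or.inl rfl, ζ.im, hi, (hray 1 (Or.inl rfl) _).2
          ⟨by rw [hre, ← hc0]; simp, by rw [hs1]; ring⟩⟩
      · exact ⟨-1, Or.inr rfl, -ζ.im, by linarith, (hray (-1) (Or.inr rfl) _).2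
          ⟨by rw [hre, ← hc0]; simp, by rw [hs1]; ring⟩⟩
    · have hre : 0 ≤ ζ.re := by nlinarith
      refine ⟨ε, hε, ζ.re / Real.cos α, by positivity, (hray ε hε _).2 ⟨by field_simp, ?_⟩⟩
      have : ε * ε = 1 := by rcases hε with rfl | rfl <;> norm_num
      field_simp
      linear_combination ε * h4 - ζ.im * Real.cos α * this
  · rintro ⟨ε, hε, t, ht, hz⟩
    obtain ⟨e1, e2⟩ := (hray ε hε t).1 hz
    constructor
    · intro ε' hε'
      rw [sideFun_eq hε', ← hζ, e1, e2]
      have hcs : 0 ≤ t * Real.cos α * Real.sin α := by positivity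
      rcases hε with rfl | rfl <;> rcases hε' with rfl | rfl <;> nlinarith
    · intro h
      have := h ε hε
      rw [sideFun_eq hε, ← hζ, e1, e2] at this
      have hε2 : ε * ε = 1 := by rcases hε with rfl | rfl <;> norm_num
      have : t * Real.sin α * Real.cos α * (ε * ε - 1) < 0 := by nlinarith
      rw [hε2] at this
      linarith

theorem rayPoint_mem_frontier (hα : 0 < α) (hα2 : α ≤ Real.pi / 2) {ε : ℝ} (hε : ε = 1 ∨ ε = -1)
    {t : ℝ} (ht : 0 ≤ t) : rayPoint c (θ + ε * α) t ∈ frontier (sector c θ α) :=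
  (mem_frontier_sector_iff hα hα2).2 ⟨ε, hε, t, ht, rfl⟩

/-- The normal to the side of the sector in the direction `θ + ε α`. -/
noncomputable def sideNormal (θ α ε : ℝ) : ℂ :=
  ε * Complex.I * Complex.exp ((θ + ε * α : ℝ) * Complex.I)

theorem norm_sideNormal {ε : ℝ} (hε : ε = 1 ∨ ε = -1) : ‖sideNormal θ α ε‖ = 1 := by
  rw [sideNormal, norm_mul, Complex.norm_exp_ofReal_mul_I]
  rcases hε with rfl | rfl <;> simp

theorem conj_exp_ofReal_mul_I (x : ℝ) :
    conj (Complex.exp (x * Complex.I)) = Complex.exp (-(x * Complex.I)) := by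
  rw [← Complex.exp_conj]
  simp

theorem re_conj_sideNormal_mul (c z : ℂ) (θ α ε t : ℝ) :
    (conj (sideNormal θ α ε) * (z - rayPoint c (θ + ε * α) t)).re = sideFun c θ α ε z := by
  have h1 : conj (sideNormal θ α ε) =
      -(ε * Complex.I) * Complex.exp (-((θ + ε * α : ℝ) * Complex.I)) := by
    rw [sideNormal, map_mul, map_mul, conj_exp_ofReal_mul_I, Complex.conj_I, Complex.conj_ofReal]
    ring
  have h2 : Complex.exp ((θ + ε * α : ℝ) * Complex.I) *
      Complex.exp (-((θ + ε * α : ℝ) * Complex.I)) = 1 := by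
    rw [← Complex.exp_add]; simp
  have h3 : conj (sideNormal θ α ε) * (z - rayPoint c (θ + ε * α) t) =
      -((ε : ℂ) * Complex.I) * ((z - c) * Complex.exp (-((θ + ε * α : ℝ) * Complex.I)) - t) := by
    rw [h1, rayPoint]
    linear_combination ((ε : ℂ) * Complex.I * t) * h2
  rw [h3, sideFun]
  simp

theorem isOutwardNormal_sideNormal (hα : 0 < α) (hα2 : α ≤ Real.pi / 2) {ε : ℝ}
    (hε : ε = 1 ∨ ε = -1) (t : ℝ) :
    IsOutwardNormal (sector c θ α) (rayPoint c (θ + ε * α) t) (sideNormal θ α ε) := by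
  refine ⟨norm_sideNormal hε, fun w hw => ?_⟩
  rw [re_conj_sideNormal_mul]
  exact ((mem_sector_iff hα hα2).1 hw ε hε).le

theorem IsOutwardNormal.re_le_of_mem_closure {Ω : Set ℂ} {σ ν : ℂ} (h : IsOutwardNormal Ω σ ν)
    {w : ℂ} (hw : w ∈ closure Ω) : (conj ν * (w - σ)).re ≤ 0 := by
  refine closure_minimal (t := {w | (conj ν * (w - σ)).re ≤ 0}) h.2 ?_ hw
  exact isClosed_le (Complex.continuous_re.comp (by fun_prop)) continuous_const

/-- The vertex and the point at distance 2t lie in the closure, on both sides of the given point of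
the ray, so a normal is orthogonal to the ray. Its sign is fixed by testing with a translation along
the axis, which stays in the closed sector. -/
theorem IsOutwardNormal.eq_sideNormal (hα : 0 < α) (hα2 : α ≤ Real.pi / 2) {ε : ℝ}
    (hε : ε = 1 ∨ ε = -1) {t : ℝ} (ht : 0 < t) {ν : ℂ}
    (h : IsOutwardNormal (sector c θ α) (rayPoint c (θ + ε * α) t) ν) : ν = sideNormal θ α ε := by
  have hpi := Real.pi_pos
  have hs : 0 < Real.sin α := Real.sin_pos_of_pos_of_lt_pi hα (by linarith)
  set e := Complex.exp ((θ + ε * α : ℝ) * Complex.I) with he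
  have he1 : ‖e‖ = 1 := Complex.norm_exp_ofReal_mul_I _
  have hcl : ∀ s : ℝ, 0 ≤ s → rayPoint c (θ + ε * α) s ∈ closure (sector c θ α) := fun s hs =>
    frontier_subset_closure (rayPoint_mem_frontier hα hα2 hε hs)
  have h1 := h.re_le_of_mem_closure (hcl 0 le_rfl)
  have h2 := h.re_le_of_mem_closure (hcl (2 * t) (by linarith))
  have r1 : rayPoint c (θ + ε * α) 0 - rayPoint c (θ + ε * α) t = (-t : ℝ) * e := by
    simp only [rayPoint, ← he]; push_cast; ring
  have r2 : rayPoint c (θ + ε * α) (2 * t) - rayPoint c (θ + ε * α) t = (t : ℝ) * e := by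
    simp only [rayPoint, ← he]; push_cast; ring
  rw [r1, mul_left_comm, Complex.re_ofReal_mul] at h1
  rw [r2, mul_left_comm, Complex.re_ofReal_mul] at h2
  have hre : (conj ν * e).re = 0 := by nlinarith
  have hnorm : ‖conj ν * e‖ = 1 := by rw [norm_mul, he1, RCLike.norm_conj, h.1, one_mul]
  have him : (conj ν * e).im ^ 2 = 1 := by
    have : ‖conj ν * e‖ ^ 2 = 1 := by rw [hnorm]; norm_num
    rw [← Complex.normSq_eq_norm_sq, Complex.normSq_apply, hre] at this
    linarith
  have h3 : rayPoint c (θ + ε * α) t + Complex.exp (θ * Complex.I) ∈ closure (sector c θ α) := by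
    rw [mem_closure_sector_iff hα hα2]
    intro ε' hε'
    have h4 := (mem_closure_sector_iff hα hα2).1 (hcl t ht.le) ε' hε'
    rw [sideFun_eq hε'] at h4 ⊢
    have e3 : (rayPoint c (θ + ε * α) t + Complex.exp (θ * Complex.I) - c) *
        Complex.exp (-(θ * Complex.I)) =
        (rayPoint c (θ + ε * α) t - c) * Complex.exp (-(θ * Complex.I)) + 1 := by
      have : Complex.exp (θ * Complex.I) * Complex.exp (-(θ * Complex.I)) = 1 := by
        rw [← Complex.exp_add]; simp
      linear_combination this
    rw [e3]
    simp only [Complex.add_im, Complex.one_im, add_zero, Complex.add_re, Complex.one_re]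
    linarith
  have h4 := h.re_le_of_mem_closure h3
  rw [add_sub_cancel_left] at h4
  have hexp : Complex.exp (θ * Complex.I) =
      e * (((Real.cos α : ℝ) : ℂ) - ((ε * Real.sin α : ℝ) : ℂ) * Complex.I) := by
    have : ((Real.cos α : ℝ) : ℂ) - ((ε * Real.sin α : ℝ) : ℂ) * Complex.I =
        Complex.exp ((-(ε * α) : ℝ) * Complex.I) := by
      rw [Complex.exp_mul_I, ← Complex.ofReal_cos, ← Complex.ofReal_sin]
      rcases hε with rfl | rfl <;> simp [sub_eq_add_neg]
    rw [this, he, ← Complex.exp_add]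
    congr 1
    push_cast
    ring
  rw [hexp, ← mul_assoc] at h4
  have h5 : (conj ν * e).im * (ε * Real.sin α) ≤ 0 := by
    simpa [Complex.mul_re, hre, -Complex.ofReal_mul, -map_mul] using h4
  have h6 : (conj ν * e).im = -ε := by
    have h7 : (conj ν * e).im * ε ≤ 0 := by nlinarith
    rcases hε with rfl | rfl <;> nlinarith
  have h7 : conj ν * e = -(ε * Complex.I) := by
    apply Complex.ext
    · rw [hre]; simp
    · rw [h6]; simp
  have h8 : conj e * e = 1 := by
    rw [mul_comm, Complex.mul_conj, Complex.normSq_eq_norm_sq, he1]; norm_num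
  have h9 : conj ν = -(ε * Complex.I) * conj e := by
    rw [← h7, mul_assoc, mul_comm e, h8, mul_one]
  have := congrArg conj h9
  rw [Complex.conj_conj] at this
  rw [this, sideNormal, ← he]
  simp

theorem hasTangentAt_rayPoint (hα : 0 < α) (hα2 : α ≤ Real.pi / 2) {ε : ℝ}
    (hε : ε = 1 ∨ ε = -1) {t : ℝ} (ht : 0 < t) :
    HasTangentAt (sector c θ α) (rayPoint c (θ + ε * α) t) :=
  ⟨_, isOutwardNormal_sideNormal hα hα2 hε t, fun _ h => h.eq_sideNormal hα hα2 hε ht⟩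

theorem outwardNormal_rayPoint (hα : 0 < α) (hα2 : α ≤ Real.pi / 2) {ε : ℝ}
    (hε : ε = 1 ∨ ε = -1) {t : ℝ} (ht : 0 < t) :
    outwardNormal (sector c θ α) (rayPoint c (θ + ε * α) t) = sideNormal θ α ε := by
  have h := hasTangentAt_rayPoint (c := c) (θ := θ) hα hα2 hε ht
  rw [outwardNormal, dif_pos h]
  exact h.choose_spec.1.eq_sideNormal hα hα2 hε ht

/-- The normals of both sides are normals at the vertex, and they differ when cos α > 0. For a
half-plane the vertex is an ordinary boundary point. -/
theorem not_hasTangentAt_vertex (hα : 0 < α) (hα2 : α < Real.pi / 2) :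
    ¬HasTangentAt (sector c θ α) c := by
  intro h
  have h1 := isOutwardNormal_sideNormal (c := c) (θ := θ) hα hα2.le (Or.inl rfl) 0
  have h2 := isOutwardNormal_sideNormal (c := c) (θ := θ) hα hα2.le (Or.inr rfl) 0
  simp only [rayPoint, Complex.ofReal_zero, zero_mul, add_zero] at h1 h2
  have h3 := h.unique h1 h2
  have e : ∀ ε : ℝ, Complex.exp ((θ + ε * α : ℝ) * Complex.I) =
      Complex.exp (θ * Complex.I) * Complex.exp ((ε * α : ℝ) * Complex.I) := by
    intro ε
    rw [← Complex.exp_add]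
    congr 1
    push_cast
    ring
  rw [sideNormal, sideNormal, e, e] at h3
  have h4 : Complex.exp ((1 * α : ℝ) * Complex.I) = -Complex.exp ((-1 * α : ℝ) * Complex.I) := by
    have hne : Complex.I * Complex.exp (θ * Complex.I) ≠ 0 :=
      mul_ne_zero Complex.I_ne_zero (Complex.exp_ne_zero _)
    refine mul_left_cancel₀ hne ?_
    push_cast at h3 ⊢
    linear_combination h3
  have h5 := congrArg Complex.re h4
  rw [Complex.neg_re, Complex.exp_ofReal_mul_I_re, Complex.exp_ofReal_mul_I_re] at h5
  simp only [one_mul, neg_mul, Real.cos_neg] at h5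
  have : 0 < Real.cos α := Real.cos_pos_of_mem_Ioo ⟨by linarith, hα2⟩
  linarith

/-- The Poisson kernel of a half-plane on rays. -/
theorem doubleLayerKernel_rayPoint (hα : 0 < α) (hα2 : α ≤ Real.pi / 2) {ε : ℝ}
    (hε : ε = 1 ∨ ε = -1) {s : ℝ} (hs : 0 < s) (t ϑ : ℝ) :
    doubleLayerKernel (sector c θ α) (rayPoint c (θ + ε * α) s) (rayPoint c (θ + ϑ) t) =
      t * Real.sin (α - ε * ϑ) /
        (Real.pi * (s ^ 2 - 2 * s * t * Real.cos (α - ε * ϑ) + t ^ 2)) := by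
  rw [doubleLayerKernel, outwardNormal_rayPoint hα hα2 hε hs]
  set γ := α - ε * ϑ with hγ
  set e := Complex.exp ((θ + ε * α : ℝ) * Complex.I) with he
  have he0 : e ≠ 0 := Complex.exp_ne_zero _
  have h1 : rayPoint c (θ + ε * α) s - rayPoint c (θ + ϑ) t =
      e * (s - t * Complex.exp ((-(ε * γ) : ℝ) * Complex.I)) := by
    have : Complex.exp ((θ + ϑ : ℝ) * Complex.I) =
        e * Complex.exp ((-(ε * γ) : ℝ) * Complex.I) := by
      rw [he, ← Complex.exp_add]
      congr 1
      have : ε * ε = 1 := by rcases hε with rfl | rfl <;> norm_num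
      have : (ε : ℂ) * ε = 1 := by exact_mod_cast this
      rw [hγ]
      push_cast
      linear_combination (-(ϑ : ℂ) * Complex.I) * this
    simp only [rayPoint]
    rw [this, ← he]
    ring
  have h2 : ((s : ℂ) - t * Complex.exp ((-(ε * γ) : ℝ) * Complex.I)) =
      ((s - t * Real.cos γ : ℝ) : ℂ) + ((ε * t * Real.sin γ : ℝ) : ℂ) * Complex.I := by
    rw [Complex.exp_mul_I, ← Complex.ofReal_cos, ← Complex.ofReal_sin]
    rcases hε with rfl | rfl <;> simp <;> ring
  have h3 : sideNormal θ α ε / (rayPoint c (θ + ε * α) s - rayPoint c (θ + ϑ) t) =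
      (ε * Complex.I) / (((s - t * Real.cos γ : ℝ) : ℂ) +
        ((ε * t * Real.sin γ : ℝ) : ℂ) * Complex.I) := by
    rw [h1, h2, sideNormal, ← he, mul_comm e, mul_div_mul_right _ _ he0]
  rw [h3, Complex.div_re, Complex.normSq_add_mul_I]
  have hq : (s - t * Real.cos γ) ^ 2 + (ε * t * Real.sin γ) ^ 2 =
      s ^ 2 - 2 * s * t * Real.cos γ + t ^ 2 := by
    have := Real.sin_sq_add_cos_sq γ
    rcases hε with rfl | rfl <;> nlinarith
  rw [hq]
  have hr : ((ε : ℂ) * Complex.I).re = 0 := by simp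
  have hi : ((ε : ℂ) * Complex.I).im = ε := by simp
  have him : (((s - t * Real.cos γ : ℝ) : ℂ) + ((ε * t * Real.sin γ : ℝ) : ℂ) * Complex.I).im =
      ε * t * Real.sin γ := by simp [Complex.sin_ofReal_re]
  have hε2 : ε * ε = 1 := by rcases hε with rfl | rfl <;> norm_num
  rw [hr, hi, him, zero_mul, zero_div, zero_add, ← mul_assoc, ← mul_assoc, hε2, one_mul, div_div,
    mul_comm Real.pi]

theorem isometry_rayPoint (c : ℂ) (ψ : ℝ) : Isometry (rayPoint c ψ) := by
  refine Isometry.of_dist_eq fun x y => ?_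
  rw [dist_eq_norm, dist_eq_norm, rayPoint, rayPoint, add_sub_add_left_eq_sub, ← sub_mul, norm_mul,
    Complex.norm_exp_ofReal_mul_I, mul_one, ← Complex.ofReal_sub, Complex.norm_real]

theorem rayPoint_sub_vertex (c : ℂ) (ψ t : ℝ) : ‖rayPoint c ψ t - c‖ = |t| := by
  rw [rayPoint, add_sub_cancel_left, norm_mul, Complex.norm_exp_ofReal_mul_I, mul_one,
    Complex.norm_real, Real.norm_eq_abs]

theorem rayPoint_one_eq_rayPoint_neg_one (hα : 0 < α) (hα2 : α ≤ Real.pi / 2) {s t : ℝ} (hs : 0 ≤ s)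
    (ht : 0 ≤ t) (h : rayPoint c (θ + 1 * α) s = rayPoint c (θ + -1 * α) t) : s = 0 ∧ t = 0 := by
  have hpi := Real.pi_pos
  have hst : s = t := by
    have := congrArg (fun z => ‖z - c‖) h
    simpa [rayPoint_sub_vertex, abs_of_nonneg hs, abs_of_nonneg ht] using this
  subst hst
  by_contra hcon
  have hs0 : s ≠ 0 := fun h => hcon ⟨h, h⟩
  have hsp : 0 < s := lt_of_le_of_ne hs hs0.symm
  have n1 := outwardNormal_rayPoint (c := c) (θ := θ) hα hα2 (Or.inl rfl) hsp
  have e : Complex.exp ((θ + 1 * α : ℝ) * Complex.I) = Complex.exp ((θ + -1 * α : ℝ) * Complex.I) := by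
    have hC : (s : ℂ) ≠ 0 := by exact_mod_cast hs0
    simpa [rayPoint, hC] using h
  have e1 : ∀ ε : ℝ, Complex.exp ((θ + ε * α : ℝ) * Complex.I) =
      Complex.exp (θ * Complex.I) * Complex.exp ((ε * α : ℝ) * Complex.I) := by
    intro ε
    rw [← Complex.exp_add]
    congr 1
    push_cast
    ring
  rw [e1, e1] at e
  have h5 := congrArg Complex.im (mul_left_cancel₀ (Complex.exp_ne_zero _) e)
  rw [Complex.exp_ofReal_mul_I_im, Complex.exp_ofReal_mul_I_im] at h5
  simp only [one_mul, neg_mul, Real.sin_neg] at h5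
  have : 0 < Real.sin α := Real.sin_pos_of_pos_of_lt_pi hα (by linarith)
  linarith

end Geometry

/-! ### Arclength in logarithmic coordinates, the operator P, and the inverse of I + P. -/

section Boundary

variable {c : ℂ} {θ α : ℝ}

/-- The boundary point at distance `t` from the vertex, on the side in the direction `θ + ε α`. -/
noncomputable def sidePoint (c : ℂ) (θ : ℝ) (hα : 0 < α) (hα2 : α ≤ Real.pi / 2) {ε : ℝ}
    (hε : ε = 1 ∨ ε = -1) (t : ℝ) : frontier (sector c θ α) :=
  ⟨rayPoint c (θ + ε * α) (max t 0), rayPoint_mem_frontier hα hα2 hε (le_max_right _ _)⟩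

theorem coe_sidePoint (hα : 0 < α) (hα2 : α ≤ Real.pi / 2) {ε : ℝ}
    (hε : ε = 1 ∨ ε = -1) {t : ℝ} (ht : 0 ≤ t) :
    (sidePoint c θ hα hα2 hε t : ℂ) = rayPoint c (θ + ε * α) t :=
  congrArg (rayPoint c (θ + ε * α)) (max_eq_left ht)

/-- The truncation `max t 0` makes the parametrization total and continuous on the line, with the
vertex as its value for t ≤ 0. -/
theorem continuous_sidePoint (hα : 0 < α) (hα2 : α ≤ Real.pi / 2) {ε : ℝ}
    (hε : ε = 1 ∨ ε = -1) : Continuous (sidePoint c θ hα hα2 hε) :=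
  ((isometry_rayPoint c _).continuous.comp (continuous_id.max continuous_const)).subtype_mk _

theorem exists_eq_sidePoint (hα : 0 < α) (hα2 : α ≤ Real.pi / 2) (z : frontier (sector c θ α)) :
    ∃ (ε : ℝ) (hε : ε = 1 ∨ ε = -1) (t : ℝ), 0 ≤ t ∧ z = sidePoint c θ hα hα2 hε t := by
  obtain ⟨ε, hε, t, ht, h⟩ := (mem_frontier_sector_iff hα hα2).1 z.2
  exact ⟨ε, hε, t, ht, Subtype.ext (by rw [coe_sidePoint hα hα2 hε ht, h])⟩

theorem sidePoint_zero (hα : 0 < α) (hα2 : α ≤ Real.pi / 2) {ε ε' : ℝ}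
    (hε : ε = 1 ∨ ε = -1) (hε' : ε' = 1 ∨ ε' = -1) :
    sidePoint c θ hα hα2 hε 0 = sidePoint c θ hα hα2 hε' 0 :=
  Subtype.ext (by simp [sidePoint, rayPoint])

theorem isometry_sidePoint (hα : 0 < α) (hα2 : α ≤ Real.pi / 2) {ε : ℝ} (hε : ε = 1 ∨ ε = -1) :
    Isometry fun t : Set.Ioi (0 : ℝ) => sidePoint c θ hα hα2 hε t := by
  refine Isometry.of_dist_eq fun x y => ?_
  rw [Subtype.dist_eq, coe_sidePoint hα hα2 hε x.2.le, coe_sidePoint hα hα2 hε y.2.le,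
    (isometry_rayPoint _ _).dist_eq, Subtype.dist_eq]

theorem measurableEmbedding_sidePoint (hα : 0 < α) (hα2 : α ≤ Real.pi / 2) {ε : ℝ}
    (hε : ε = 1 ∨ ε = -1) :
    MeasurableEmbedding fun t : Set.Ioi (0 : ℝ) => sidePoint c θ hα hα2 hε t := by
  have : PolishSpace (Set.Ioi (0 : ℝ)) := isOpen_Ioi.polishSpace
  exact (isometry_sidePoint hα hα2 hε).continuous.measurableEmbedding
    (isometry_sidePoint hα hα2 hε).injective

/-- Arclength on the boundary of the sector is the sum of the arclengths on the two sides. -/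
theorem arclength_sector (hα : 0 < α) (hα2 : α ≤ Real.pi / 2) :
    arclength (sector c θ α) =
      Measure.map (fun t : Set.Ioi (0 : ℝ) => sidePoint c θ hα hα2 (Or.inl rfl) t)
        (Measure.hausdorffMeasure 1) +
      Measure.map (fun t : Set.Ioi (0 : ℝ) => sidePoint c θ hα hα2 (Or.inr rfl) t)
        (Measure.hausdorffMeasure 1) := by
  rw [(isometry_sidePoint hα hα2 _).map_hausdorffMeasure (Or.inl zero_le_one),
    (isometry_sidePoint hα hα2 _).map_hausdorffMeasure (Or.inl zero_le_one),
    ← Measure.restrict_union _ (measurableEmbedding_sidePoint hα hα2 _).measurableSet_range]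
  -- The isometric open sides cover the boundary except for the vertex, and a point has no length.
  · have hna := Measure.nullSingletonClass_hausdorff (frontier (sector c θ α)) zero_lt_one
    rw [arclength, eq_comm]
    set v := sidePoint c θ hα hα2 (Or.inl rfl) 0 with hv
    refine Measure.restrict_eq_self_of_ae_mem ?_
    have h0 : ∀ᵐ z ∂(Measure.hausdorffMeasure 1 : Measure (frontier (sector c θ α))), z ≠ v := by
      rw [ae_iff]
      simp
    filter_upwards [h0] with z hz
    obtain ⟨ε, hε, t, ht, rfl⟩ := exists_eq_sidePoint hα hα2 z
    rcases ht.eq_or_lt with rfl | ht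
    · exact absurd (sidePoint_zero hα hα2 _ _) hz
    · rcases hε with rfl | rfl
      · exact Or.inl ⟨⟨t, ht⟩, rfl⟩
      · exact Or.inr ⟨⟨t, ht⟩, rfl⟩
  · rw [Set.disjoint_left]
    rintro _ ⟨s, rfl⟩ ⟨t, h⟩
    have := congrArg Subtype.val h
    rw [coe_sidePoint hα hα2 _ t.2.le, coe_sidePoint hα hα2 _ s.2.le] at this
    exact (ne_of_gt s.2) (rayPoint_one_eq_rayPoint_neg_one hα hα2 s.2.le t.2.le this.symm).1

variable {E : Type*} [NormedAddCommGroup E]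

theorem map_coe_hausdorffMeasure_Ioi :
    Measure.map (Subtype.val : Set.Ioi (0 : ℝ) → ℝ) (Measure.hausdorffMeasure 1) =
      volume.restrict (Set.Ioi 0) := by
  rw [isometry_subtype_coe.map_hausdorffMeasure (Or.inl zero_le_one), hausdorffMeasure_real,
    Subtype.range_coe]

theorem measurableEmbedding_coe_Ioi : MeasurableEmbedding (Subtype.val : Set.Ioi (0 : ℝ) → ℝ) :=
  MeasurableEmbedding.subtype_coe measurableSet_Ioi

/-- The substitution s = t exp y, centred at the distance t of the point where the potential is
evaluated, so that the kernel becomes independent of t. -/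
theorem integrableOn_Ioi_iff_comp_exp [NormedSpace ℝ E] {t : ℝ} (ht : 0 < t) (G : ℝ → E) :
    IntegrableOn G (Set.Ioi 0) ↔
      Integrable fun y => (t * Real.exp y) • G (t * Real.exp y) := by
  have hd : ∀ x ∈ Set.univ, HasDerivWithinAt (fun y => t * Real.exp y) (t * Real.exp x)
      Set.univ x := fun x _ => ((Real.hasDerivAt_exp x).const_mul t).hasDerivWithinAt
  have hi : Set.InjOn (fun y => t * Real.exp y) Set.univ := fun x _ y _ h =>
    Real.exp_injective (mul_left_cancel₀ ht.ne' h)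
  have hr : (fun y => t * Real.exp y) '' Set.univ = Set.Ioi 0 := by
    ext s
    simp only [Set.image_univ, Set.mem_range, Set.mem_Ioi]
    constructor
    · rintro ⟨y, rfl⟩
      positivity
    · intro hs
      exact ⟨Real.log (s / t), by rw [Real.exp_log (by positivity)]; field_simp⟩
  have := integrableOn_image_iff_integrableOn_abs_deriv_smul MeasurableSet.univ hd hi G
  rw [hr, integrableOn_univ] at this
  rw [this]
  simp only [abs_of_pos (mul_pos ht (Real.exp_pos _))]

theorem integral_Ioi_eq_integral_comp_exp [NormedSpace ℝ E] {t : ℝ} (ht : 0 < t) (G : ℝ → E) :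
    ∫ s in Set.Ioi 0, G s = ∫ y, (t * Real.exp y) • G (t * Real.exp y) := by
  have hd : ∀ x ∈ Set.univ, HasDerivWithinAt (fun y => t * Real.exp y) (t * Real.exp x)
      Set.univ x := fun x _ => ((Real.hasDerivAt_exp x).const_mul t).hasDerivWithinAt
  have hi : Set.InjOn (fun y => t * Real.exp y) Set.univ := fun x _ y _ h =>
    Real.exp_injective (mul_left_cancel₀ ht.ne' h)
  have hr : (fun y => t * Real.exp y) '' Set.univ = Set.Ioi 0 := by
    ext s
    simp only [Set.image_univ, Set.mem_range, Set.mem_Ioi]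
    constructor
    · rintro ⟨y, rfl⟩
      positivity
    · intro hs
      exact ⟨Real.log (s / t), by rw [Real.exp_log (by positivity)]; field_simp⟩
  have := integral_image_eq_integral_abs_deriv_smul MeasurableSet.univ hd hi G
  rw [hr, setIntegral_univ] at this
  rw [this]
  simp only [abs_of_pos (mul_pos ht (Real.exp_pos _))]

theorem integrable_arclength_iff [NormedSpace ℝ E] (hα : 0 < α) (hα2 : α ≤ Real.pi / 2) {t : ℝ}
    (ht : 0 < t) (G : frontier (sector c θ α) → E) :
    Integrable G (arclength (sector c θ α)) ↔
      (Integrable fun y => (t * Real.exp y) •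
        G (sidePoint c θ hα hα2 (Or.inl rfl) (t * Real.exp y))) ∧
      Integrable fun y => (t * Real.exp y) •
        G (sidePoint c θ hα hα2 (Or.inr rfl) (t * Real.exp y)) := by
  have side : ∀ {ε : ℝ} (hε : ε = 1 ∨ ε = -1), Integrable G
      (Measure.map (fun t : Set.Ioi (0 : ℝ) => sidePoint c θ hα hα2 hε t)
        (Measure.hausdorffMeasure 1)) ↔ Integrable fun y => (t * Real.exp y) •
        G (sidePoint c θ hα hα2 hε (t * Real.exp y)) := by
    intro ε hε
    rw [(measurableEmbedding_sidePoint hα hα2 hε).integrable_map_iff,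
      ← integrableOn_Ioi_iff_comp_exp ht (fun s => G (sidePoint c θ hα hα2 hε s)), IntegrableOn,
      ← map_coe_hausdorffMeasure_Ioi, measurableEmbedding_coe_Ioi.integrable_map_iff]
    rfl
  rw [arclength_sector hα hα2, integrable_add_measure, side, side]

theorem integral_arclength [NormedSpace ℝ E] (hα : 0 < α) (hα2 : α ≤ Real.pi / 2) {t : ℝ}
    (ht : 0 < t) {G : frontier (sector c θ α) → E} (hG : Integrable G (arclength (sector c θ α))) :
    ∫ σ, G σ ∂(arclength (sector c θ α)) =
      (∫ y, (t * Real.exp y) • G (sidePoint c θ hα hα2 (Or.inl rfl) (t * Real.exp y))) +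
      ∫ y, (t * Real.exp y) • G (sidePoint c θ hα hα2 (Or.inr rfl) (t * Real.exp y)) := by
  have side : ∀ {ε : ℝ} (hε : ε = 1 ∨ ε = -1), ∫ σ, G σ
      ∂(Measure.map (fun t : Set.Ioi (0 : ℝ) => sidePoint c θ hα hα2 hε t)
        (Measure.hausdorffMeasure 1)) = ∫ y, (t * Real.exp y) •
        G (sidePoint c θ hα hα2 hε (t * Real.exp y)) := by
    intro ε hε
    rw [(measurableEmbedding_sidePoint hα hα2 hε).integral_map,
      ← integral_Ioi_eq_integral_comp_exp ht (fun s => G (sidePoint c θ hα hα2 hε s)),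
      ← map_coe_hausdorffMeasure_Ioi, measurableEmbedding_coe_Ioi.integral_map]
  rw [arclength_sector hα hα2, integrable_add_measure] at hG
  rw [arclength_sector hα hα2, integral_add_measure hG.1 hG.2, side, side]

/-- The double layer kernel in logarithmic coordinates. -/
theorem mul_doubleLayerKernel_sidePoint (hα : 0 < α) (hα2 : α ≤ Real.pi / 2) {ε : ℝ}
    (hε : ε = 1 ∨ ε = -1) {t : ℝ} (ht : 0 < t) (ϑ y : ℝ) :
    ((t * Real.exp y * doubleLayerKernel (sector c θ α)
      (sidePoint c θ hα hα2 hε (t * Real.exp y)) (rayPoint c (θ + ϑ) t) : ℝ) : ℂ) =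
      stripKernel (α - ε * ϑ) y := by
  have hs : 0 < t * Real.exp y := by positivity
  rw [coe_sidePoint hα hα2 hε hs.le, doubleLayerKernel_rayPoint hα hα2 hε hs, stripKernel_ofReal]
  congr 1
  have e : (t * Real.exp y) ^ 2 - 2 * (t * Real.exp y) * t * Real.cos (α - ε * ϑ) + t ^ 2 =
      t ^ 2 * Real.exp y * (2 * (Real.cosh y - Real.cos (α - ε * ϑ))) := by
    have : Real.exp y * Real.exp (-y) = 1 := by rw [← Real.exp_add]; simp
    rw [Real.cosh_eq]
    linear_combination (-t ^ 2) * this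
  have hne : t ^ 2 * Real.exp y ≠ 0 := by positivity
  rw [e, ← mul_div_mul_left _ (2 * Real.pi * (Real.cosh y - Real.cos (α - ε * ϑ))) hne, ← mul_div_assoc]
  congr 1 <;> ring

/-- The reflection of the sector in its axis, composed with the homothety of ratio `exp y`. -/
noncomputable def reflectScale (c : ℂ) (θ y : ℝ) (z : ℂ) : ℂ :=
  c + Real.exp y * conj ((z - c) * Complex.exp (-(θ * Complex.I))) * Complex.exp (θ * Complex.I)

theorem reflectScale_rayPoint (c : ℂ) (θ y ϑ t : ℝ) :
    reflectScale c θ y (rayPoint c (θ + ϑ) t) = rayPoint c (θ - ϑ) (t * Real.exp y) := by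
  have e : (rayPoint c (θ + ϑ) t - c) * Complex.exp (-(θ * Complex.I)) =
      t * Complex.exp (ϑ * Complex.I) := by
    rw [rayPoint, add_sub_cancel_left, mul_assoc, ← Complex.exp_add]
    congr 2
    push_cast
    ring
  have e2 : Complex.exp (-(ϑ * Complex.I)) * Complex.exp (θ * Complex.I) =
      Complex.exp ((θ - ϑ : ℝ) * Complex.I) := by
    rw [← Complex.exp_add]
    congr 1
    push_cast
    ring
  rw [reflectScale, e, map_mul, conj_exp_ofReal_mul_I, Complex.conj_ofReal, rayPoint, ← e2]
  push_cast
  ring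

theorem neg_sign {ε : ℝ} (hε : ε = 1 ∨ ε = -1) : -ε = 1 ∨ -ε = -1 := by
  rcases hε with rfl | rfl <;> norm_num

theorem reflectScale_mem_frontier (hα : 0 < α) (hα2 : α ≤ Real.pi / 2) (y : ℝ)
    (z : frontier (sector c θ α)) : reflectScale c θ y z ∈ frontier (sector c θ α) := by
  obtain ⟨ε, hε, t, ht, h⟩ := (mem_frontier_sector_iff hα hα2).1 z.2
  rw [h, reflectScale_rayPoint, sub_eq_add_neg, ← neg_mul]
  exact rayPoint_mem_frontier hα hα2 (neg_sign hε) (by positivity)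

/-- `reflectScale` as a map of the boundary. -/
noncomputable def boundaryReflectScale (hα : 0 < α) (hα2 : α ≤ Real.pi / 2) (y : ℝ)
    (z : frontier (sector c θ α)) : frontier (sector c θ α) :=
  ⟨reflectScale c θ y z, reflectScale_mem_frontier hα hα2 y z⟩

theorem continuous_boundaryReflectScale (hα : 0 < α) (hα2 : α ≤ Real.pi / 2) :
    Continuous fun p : ℝ × frontier (sector c θ α) =>
      boundaryReflectScale hα hα2 p.1 p.2 := by
  refine Continuous.subtype_mk ?_ _
  unfold reflectScale
  have h1 : Continuous fun p : ℝ × frontier (sector c θ α) => ((Real.exp p.1 : ℝ) : ℂ) :=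
    Complex.continuous_ofReal.comp (Real.continuous_exp.comp continuous_fst)
  have h2 : Continuous fun p : ℝ × frontier (sector c θ α) =>
      conj (((p.2 : ℂ) - c) * Complex.exp (-(θ * Complex.I))) :=
    Complex.continuous_conj.comp (by fun_prop)
  exact continuous_const.add ((h1.mul h2).mul continuous_const)

theorem boundaryReflectScale_sidePoint (hα : 0 < α) (hα2 : α ≤ Real.pi / 2) {ε : ℝ}
    (hε : ε = 1 ∨ ε = -1) {t : ℝ} (ht : 0 ≤ t) (y : ℝ) :
    boundaryReflectScale hα hα2 y (sidePoint c θ hα hα2 hε t) =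
      sidePoint c θ hα hα2 (neg_sign hε) (t * Real.exp y) := by
  refine Subtype.ext ?_
  rw [coe_sidePoint hα hα2 _ (by positivity)]
  show reflectScale c θ y _ = _
  rw [coe_sidePoint hα hα2 _ ht, reflectScale_rayPoint, sub_eq_add_neg, neg_mul]

theorem integrable_stripKernel_mul_comp_reflect (hα : 0 < α) (hα2 : α ≤ Real.pi / 2)
    (g : frontier (sector c θ α) →ᵇ ℂ) (z : frontier (sector c θ α)) :
    Integrable fun y : ℝ => stripKernel (2 * α) y * g (boundaryReflectScale hα hα2 y z) := by
  refine (integrable_stripKernel (γ := 2 * α) (by linarith) (by linarith)).mul_bdd (c := ‖g‖) ?_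
    (Filter.Eventually.of_forall fun y => g.norm_coe_le_norm _)
  exact (g.continuous.comp ((continuous_boundaryReflectScale hα hα2).comp
    (continuous_id.prodMk continuous_const))).aestronglyMeasurable

theorem norm_integral_stripKernel_mul_le (hα : 0 < α) (hα2 : α ≤ Real.pi / 2)
    (g : frontier (sector c θ α) →ᵇ ℂ) (z : frontier (sector c θ α)) :
    ‖∫ y : ℝ, stripKernel (2 * α) y * g (boundaryReflectScale hα hα2 y z)‖ ≤
      (Real.pi - 2 * α) / Real.pi * ‖g‖ := by
  have hi := (integrable_stripKernel (γ := 2 * α) (by linarith) (by linarith)).norm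
  rw [← integral_norm_stripKernel (γ := 2 * α) (by linarith) (by linarith), ← integral_mul_const]
  refine norm_integral_le_of_norm_le (hi.mul_const _) (Filter.Eventually.of_forall fun y => ?_)
  rw [norm_mul]
  exact mul_le_mul_of_nonneg_left (g.norm_coe_le_norm _) (norm_nonneg _)

/-- The operator of the double layer potential on the boundary of the sector. -/
noncomputable def doubleLayerOperator (c : ℂ) (θ : ℝ) (hα : 0 < α) (hα2 : α ≤ Real.pi / 2) :
    (frontier (sector c θ α) →ᵇ ℂ) →L[ℂ] (frontier (sector c θ α) →ᵇ ℂ) :=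
  LinearMap.mkContinuous
    { toFun := fun g => BoundedContinuousFunction.ofNormedAddCommGroup
        (fun z => ∫ y : ℝ, stripKernel (2 * α) y * g (boundaryReflectScale hα hα2 y z))
        (by
          -- Written with the reflected homotheties, the formula is the same at all boundary points,
          -- including the vertex, so dominated convergence gives continuity there as well.
          refine continuous_of_dominated (bound := fun y : ℝ => ‖stripKernel (2 * α) y‖ * ‖g‖)
            (fun z => (integrable_stripKernel_mul_comp_reflect hα hα2 g z).aestronglyMeasurable)
            (fun z => Filter.Eventually.of_forall fun y => ?_)
            ((integrable_stripKernel (γ := 2 * α) (by linarith) (by linarith)).norm.mul_const _)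
            (Filter.Eventually.of_forall fun y => ?_)
          · rw [norm_mul]
            exact mul_le_mul_of_nonneg_left (g.norm_coe_le_norm _) (norm_nonneg _)
          · exact continuous_const.mul (g.continuous.comp
              ((continuous_boundaryReflectScale hα hα2).comp
                (continuous_const.prodMk continuous_id))))
        ((Real.pi - 2 * α) / Real.pi * ‖g‖) (norm_integral_stripKernel_mul_le hα hα2 g)
      map_add' := fun g g' => by
        ext z
        simp only [BoundedContinuousFunction.coe_ofNormedAddCommGroup,
          BoundedContinuousFunction.coe_add, Pi.add_apply, mul_add]
        exact integral_add (integrable_stripKernel_mul_comp_reflect hα hα2 g z)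
          (integrable_stripKernel_mul_comp_reflect hα hα2 g' z)
      map_smul' := fun a g => by
        ext z
        simp only [BoundedContinuousFunction.coe_ofNormedAddCommGroup,
          BoundedContinuousFunction.coe_smul, smul_eq_mul, RingHom.id_apply, mul_left_comm _ a]
        exact integral_const_mul _ _ }
    ((Real.pi - 2 * α) / Real.pi) fun g => by
      have := Real.pi_pos
      exact BoundedContinuousFunction.norm_ofNormedAddCommGroup_le _
        (mul_nonneg (div_nonneg (by linarith) this.le) (norm_nonneg _))
        (norm_integral_stripKernel_mul_le hα hα2 g)

theorem doubleLayerOperator_apply (hα : 0 < α) (hα2 : α ≤ Real.pi / 2)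
    (g : frontier (sector c θ α) →ᵇ ℂ) (z : frontier (sector c θ α)) :
    doubleLayerOperator c θ hα hα2 g z =
      ∫ y : ℝ, stripKernel (2 * α) y * g (boundaryReflectScale hα hα2 y z) := rfl

theorem doubleLayerOperator_sidePoint (hα : 0 < α) (hα2 : α ≤ Real.pi / 2)
    (g : frontier (sector c θ α) →ᵇ ℂ) {ε : ℝ} (hε : ε = 1 ∨ ε = -1) {t : ℝ} (ht : 0 ≤ t) :
    doubleLayerOperator c θ hα hα2 g (sidePoint c θ hα hα2 hε t) =
      ∫ y : ℝ, stripKernel (2 * α) y * g (sidePoint c θ hα hα2 (neg_sign hε) (t * Real.exp y)) := by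
  simp only [doubleLayerOperator_apply, boundaryReflectScale_sidePoint hα hα2 hε ht]

/-- The kernel is nonnegative with mass 1 - 2α/π. -/
theorem norm_doubleLayerOperator_lt_one (hα : 0 < α) (hα2 : α ≤ Real.pi / 2) :
    ‖doubleLayerOperator c θ hα hα2‖ < 1 := by
  have := Real.pi_pos
  refine (LinearMap.mkContinuous_norm_le _ (div_nonneg (by linarith) this.le) _).trans_lt ?_
  rw [div_lt_one this]
  linarith

/-- In the direction ϑ the angular distances to the two sides are α - ϑ and α + ϑ. The lemma serves
both for boundary points, ϑ = ±α, and for interior ones. -/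
theorem integral_doubleLayerKernel_rayPoint (hα : 0 < α) (hα2 : α ≤ Real.pi / 2)
    (g : frontier (sector c θ α) → ℂ) {t : ℝ} (ht : 0 < t) {ϑ : ℝ}
    (h1 : Integrable fun y : ℝ => stripKernel (α - 1 * ϑ) y *
      g (sidePoint c θ hα hα2 (Or.inl rfl) (t * Real.exp y)))
    (h2 : Integrable fun y : ℝ => stripKernel (α - -1 * ϑ) y *
      g (sidePoint c θ hα hα2 (Or.inr rfl) (t * Real.exp y))) :
    Integrable (fun σ : frontier (sector c θ α) =>
      (doubleLayerKernel (sector c θ α) σ (rayPoint c (θ + ϑ) t) : ℂ) * g σ)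
      (arclength (sector c θ α)) ∧
    ∫ σ : frontier (sector c θ α),
      (doubleLayerKernel (sector c θ α) σ (rayPoint c (θ + ϑ) t) : ℂ) * g σ
      ∂(arclength (sector c θ α)) =
    (∫ y : ℝ, stripKernel (α - 1 * ϑ) y *
      g (sidePoint c θ hα hα2 (Or.inl rfl) (t * Real.exp y))) +
    ∫ y : ℝ, stripKernel (α - -1 * ϑ) y *
      g (sidePoint c θ hα hα2 (Or.inr rfl) (t * Real.exp y)) := by
  have e : ∀ {ε : ℝ} (hε : ε = 1 ∨ ε = -1) (y : ℝ), (t * Real.exp y) •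
      ((doubleLayerKernel (sector c θ α) (sidePoint c θ hα hα2 hε (t * Real.exp y))
        (rayPoint c (θ + ϑ) t) : ℂ) * g (sidePoint c θ hα hα2 hε (t * Real.exp y))) =
      stripKernel (α - ε * ϑ) y * g (sidePoint c θ hα hα2 hε (t * Real.exp y)) := by
    intro ε hε y
    rw [← mul_doubleLayerKernel_sidePoint hα hα2 hε ht, Complex.real_smul]
    push_cast
    ring
  have hi := (integrable_arclength_iff hα hα2 ht (fun σ : frontier (sector c θ α) =>
    (doubleLayerKernel (sector c θ α) σ (rayPoint c (θ + ϑ) t) : ℂ) * g σ)).2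
    ⟨by simpa only [e] using h1, by simpa only [e] using h2⟩
  refine ⟨hi, ?_⟩
  rw [integral_arclength hα hα2 ht hi]
  simp only [e]

/-- A side contributes nothing to the potential at its own points. The value at z = 0 relies on 0/0
= 0. -/
theorem stripKernel_zero_left (z : ℂ) : stripKernel 0 z = 0 := by simp [stripKernel]

theorem restrict_arclength_compl_singleton (Ω : Set ℂ) (z : frontier Ω) :
    (arclength Ω).restrict {z}ᶜ = arclength Ω := by
  have : NullSingletonClass (arclength Ω) :=
    Measure.nullSingletonClass_hausdorff (frontier Ω) zero_lt_one
  exact restrict_compl_singleton z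

theorem integral_doubleLayerKernel_sidePoint (hα : 0 < α) (hα2 : α ≤ Real.pi / 2)
    (g : frontier (sector c θ α) →ᵇ ℂ) {ε : ℝ} (hε : ε = 1 ∨ ε = -1) {t : ℝ} (ht : 0 < t) :
    Integrable (fun σ : frontier (sector c θ α) =>
      (doubleLayerKernel (sector c θ α) σ (sidePoint c θ hα hα2 hε t) : ℂ) * g σ)
      (arclength (sector c θ α)) ∧
    ∫ σ : frontier (sector c θ α),
      (doubleLayerKernel (sector c θ α) σ (sidePoint c θ hα hα2 hε t) : ℂ) * g σ
      ∂(arclength (sector c θ α)) =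
    doubleLayerOperator c θ hα hα2 g (sidePoint c θ hα hα2 hε t) := by
  have hi := integrable_stripKernel_mul_comp_reflect hα hα2 g (sidePoint c θ hα hα2 hε t)
  simp only [boundaryReflectScale_sidePoint hα hα2 hε ht.le] at hi
  rw [doubleLayerOperator_sidePoint hα hα2 g hε ht.le, coe_sidePoint hα hα2 hε ht.le]
  rcases hε with rfl | rfl
  · have e : α - -1 * (1 * α) = 2 * α := by ring
    have := integral_doubleLayerKernel_rayPoint (ϑ := 1 * α) hα hα2 g ht
      (by simp [stripKernel_zero_left]) (by rw [e]; exact hi)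
    refine ⟨this.1, this.2.trans ?_⟩
    rw [e]
    simp [stripKernel_zero_left]
  · have e : α - 1 * (-1 * α) = 2 * α := by ring
    have e0 : ∀ s, sidePoint c θ hα hα2 (neg_sign (Or.inr rfl)) s =
        sidePoint c θ hα hα2 (Or.inl rfl) s := fun s => Subtype.ext (by simp [sidePoint])
    simp only [e0] at hi ⊢
    have := integral_doubleLayerKernel_rayPoint (ϑ := -1 * α) hα hα2 g ht
      (by rw [e]; exact hi) (by simp [stripKernel_zero_left])
    refine ⟨this.1, this.2.trans ?_⟩
    rw [e]
    simp [stripKernel_zero_left]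

/-- The open sides are dense in the boundary, so the vertex is reached by continuity. -/
theorem eq_of_forall_sidePoint (hα : 0 < α) (hα2 : α ≤ Real.pi / 2)
    {f g : frontier (sector c θ α) → ℂ} (hf : Continuous f) (hg : Continuous g)
    (h : ∀ {ε : ℝ} (hε : ε = 1 ∨ ε = -1) {t : ℝ}, 0 < t →
      f (sidePoint c θ hα hα2 hε t) = g (sidePoint c θ hα hα2 hε t)) : f = g := by
  funext z
  obtain ⟨ε, hε, t, ht, rfl⟩ := exists_eq_sidePoint hα hα2 z
  rcases ht.eq_or_lt with rfl | ht
  · have l1 := ((hf.comp (continuous_sidePoint hα hα2 hε)).tendsto 0).mono_left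
      (nhdsWithin_le_nhds (s := Set.Ioi 0))
    have l2 := ((hg.comp (continuous_sidePoint hα hα2 hε)).tendsto 0).mono_left
      (nhdsWithin_le_nhds (s := Set.Ioi 0))
    refine tendsto_nhds_unique (l1.congr' ?_) l2
    filter_upwards [self_mem_nhdsWithin] with t ht using h hε ht
  · exact h hε ht

/-- The defining relation is imposed only at points with a tangent. These include both open sides,
which determine a continuous function, so the relation has exactly one continuous solution. -/
theorem isDoubleLayer_iff (hα : 0 < α) (hα2 : α ≤ Real.pi / 2)
    (g f : frontier (sector c θ α) →ᵇ ℂ) :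
    IsDoubleLayer (sector c θ α) g f ↔ f = doubleLayerOperator c θ hα hα2 g := by
  constructor
  · intro h
    refine DFunLike.coe_injective (eq_of_forall_sidePoint hα hα2 f.continuous
      (doubleLayerOperator c θ hα hα2 g).continuous fun {ε} hε {t} ht => ?_)
    have := h (sidePoint c θ hα hα2 hε t) (by
      rw [coe_sidePoint hα hα2 hε ht.le]
      exact hasTangentAt_rayPoint hα hα2 hε ht)
    rw [this.2, restrict_arclength_compl_singleton]
    exact (integral_doubleLayerKernel_sidePoint hα hα2 g hε ht).2
  · rintro rfl z hz
    obtain ⟨ε, hε, t, ht, rfl⟩ := exists_eq_sidePoint hα hα2 z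
    rw [IntegrableOn, restrict_arclength_compl_singleton]
    -- The vertex has a tangent only if α = π/2. Then the kernel vanishes almost everywhere on the
    -- boundary, and so does the operator.
    rcases ht.eq_or_lt with rfl | ht
    · rw [coe_sidePoint hα hα2 hε le_rfl] at hz
      have hα3 : α = Real.pi / 2 := by
        by_contra hne
        refine not_hasTangentAt_vertex (c := c) (θ := θ) hα (lt_of_le_of_ne hα2 hne) ?_
        simpa [rayPoint] using hz
      have hae : (fun σ : frontier (sector c θ α) => (doubleLayerKernel (sector c θ α) σ
          (sidePoint c θ hα hα2 hε 0) : ℂ) * g σ) =ᵐ[arclength (sector c θ α)] 0 := by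
        have hna := Measure.nullSingletonClass_hausdorff (frontier (sector c θ α)) zero_lt_one
        have h0 : ∀ᵐ σ ∂(arclength (sector c θ α)), σ ≠ sidePoint c θ hα hα2 hε 0 := by
          rw [ae_iff, arclength]
          simp
        filter_upwards [h0] with σ hσ
        obtain ⟨ε', hε', s, hs, rfl⟩ := exists_eq_sidePoint hα hα2 σ
        rcases hs.eq_or_lt with rfl | hs
        · exact absurd (sidePoint_zero hα hα2 _ _) hσ
        · rw [coe_sidePoint hα hα2 hε le_rfl, coe_sidePoint hα hα2 hε' hs.le,
            doubleLayerKernel_rayPoint hα hα2 hε' hs]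
          simp
      refine ⟨(integrable_zero _ _ _).congr hae.symm, ?_⟩
      rw [integral_congr_ae hae, doubleLayerOperator_apply]
      have e : ∀ z, stripKernel (2 * α) z = 0 := by
        intro z
        rw [stripKernel, hα3, mul_div_cancel₀ _ two_ne_zero]
        simp
      simp [e]
    · exact ⟨(integral_doubleLayerKernel_sidePoint hα hα2 g hε ht).1,
        (integral_doubleLayerKernel_sidePoint hα hα2 g hε ht).2.symm⟩

theorem existsUnique_add_doubleLayerOperator (hα : 0 < α) (hα2 : α ≤ Real.pi / 2)
    (f : frontier (sector c θ α) →ᵇ ℂ) : ∃! h, h + doubleLayerOperator c θ hα hα2 h = f := by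
  have hn : ‖-doubleLayerOperator c θ hα hα2‖ < 1 := by
    rw [norm_neg]
    exact norm_doubleLayerOperator_lt_one hα hα2
  have hu := isUnit_one_sub_of_norm_lt_one
    (R := (frontier (sector c θ α) →ᵇ ℂ) →L[ℂ] (frontier (sector c θ α) →ᵇ ℂ))
    (x := -doubleLayerOperator c θ hα hα2) hn
  rw [sub_neg_eq_add] at hu
  obtain ⟨u, hu⟩ := hu
  have e : ∀ h, h + doubleLayerOperator c θ hα hα2 h =
      (u : (frontier (sector c θ α) →ᵇ ℂ) →L[ℂ] (frontier (sector c θ α) →ᵇ ℂ)) h := by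
    intro h
    rw [hu]
    rfl
  simp only [e]
  refine ⟨(↑u⁻¹ : (frontier (sector c θ α) →ᵇ ℂ) →L[ℂ] (frontier (sector c θ α) →ᵇ ℂ)) f, ?_, ?_⟩
  · exact congrArg (fun T : (frontier (sector c θ α) →ᵇ ℂ) →L[ℂ] (frontier (sector c θ α) →ᵇ ℂ) =>
      T f) u.mul_inv
  · rintro h rfl
    exact (congrArg (fun T : (frontier (sector c θ α) →ᵇ ℂ) →L[ℂ] (frontier (sector c θ α) →ᵇ ℂ) =>
      T h) u.inv_mul).symm

theorem isDoubleLayer_sub_iff (hα : 0 < α) (hα2 : α ≤ Real.pi / 2)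
    (f h : frontier (sector c θ α) →ᵇ ℂ) :
    IsDoubleLayer (sector c θ α) h (f - h) ↔ h + doubleLayerOperator c θ hα hα2 h = f := by
  rw [isDoubleLayer_iff hα hα2, sub_eq_iff_eq_add', eq_comm]

theorem isNeumannInvertible_sector (hα : 0 < α) (hα2 : α ≤ Real.pi / 2) :
    IsNeumannInvertible (sector c θ α) := by
  refine ⟨fun g => ⟨_, (isDoubleLayer_iff hα hα2 g _).2 rfl⟩, fun f => ?_⟩
  simp only [isDoubleLayer_sub_iff hα hα2]
  exact existsUnique_add_doubleLayerOperator hα hα2 f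

end Boundary

/-! ### Rational functions bounded on an open set. -/

section RationalFunctions

theorem ratFunc_eval_eq (r : RatFunc ℂ) (z : ℂ) :
    r.eval (RingHom.id ℂ) z = r.num.eval z / r.denom.eval z := by
  simp [RatFunc.eval, Polynomial.eval₂_id]

/-- At a pole `RatFunc.eval` returns 0, so the hypothesis does not exclude poles by itself. Away
from the finitely many poles it gives |num| ≤ |denom|, which extends to the closure by density. A
zero of the denominator would then be a common zero, against coprimality. -/
theorem ratFunc_denom_ne_zero_and_norm_eval_le {Ω : Set ℂ} (hΩ : IsOpen Ω) {r : RatFunc ℂ}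
    (hr : ∀ z ∈ Ω, ‖r.eval (RingHom.id ℂ) z‖ ≤ 1) {z : ℂ} (hz : z ∈ closure Ω) :
    r.denom.eval z ≠ 0 ∧ ‖r.eval (RingHom.id ℂ) z‖ ≤ 1 := by
  have hfin : {w : ℂ | r.denom.eval w = 0}.Finite := by
    refine (r.denom.roots.toFinset.finite_toSet).subset fun w hw => ?_
    simpa [r.denom_ne_zero] using hw
  have hdense : Dense {w : ℂ | r.denom.eval w = 0}ᶜ := hfin.countable.dense_compl ℝ
  have hle : ‖r.num.eval z‖ ≤ ‖r.denom.eval z‖ := by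
    have hsub : closure Ω ⊆ closure (Ω ∩ {w : ℂ | r.denom.eval w = 0}ᶜ) :=
      closure_minimal (hdense.open_subset_closure_inter hΩ) isClosed_closure
    refine closure_minimal (t := {w : ℂ | ‖r.num.eval w‖ ≤ ‖r.denom.eval w‖}) ?_
      (isClosed_le r.num.continuous.norm r.denom.continuous.norm) (hsub hz)
    rintro w ⟨hw, hw0⟩
    have h1 := hr w hw
    rw [ratFunc_eval_eq, norm_div, div_le_one (norm_pos_iff.2 hw0)] at h1
    exact h1
  have hne : r.denom.eval z ≠ 0 := by
    intro h0
    rw [h0, norm_zero, norm_le_zero_iff] at hle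
    obtain ⟨a, b, hab⟩ := r.isCoprime_num_denom
    have := congrArg (Polynomial.eval z) hab
    simp [h0, hle] at this
  refine ⟨hne, ?_⟩
  rw [ratFunc_eval_eq, norm_div, div_le_one (norm_pos_iff.2 hne)]
  exact hle

theorem differentiableAt_ratFunc_eval {r : RatFunc ℂ} {z : ℂ} (h : r.denom.eval z ≠ 0) :
    DifferentiableAt ℂ (fun z => r.eval (RingHom.id ℂ) z) z := by
  simp only [ratFunc_eval_eq]
  exact r.num.differentiable.differentiableAt.div r.denom.differentiable.differentiableAt h

end RationalFunctions

/-! ### The explicit solution, the upper bound for C_N, and the reproduction of r inside. -/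

section Solution

variable {c : ℂ} {θ α : ℝ}

theorem sideFun_rayPoint {ε : ℝ} (hε : ε = 1 ∨ ε = -1) (ϑ t : ℝ) :
    sideFun c θ α ε (rayPoint c (θ + ϑ) t) = -(t * Real.sin (α - ε * ϑ)) := by
  have e : (rayPoint c (θ + ϑ) t - c) * Complex.exp (-((θ + ε * α : ℝ) * Complex.I)) =
      t * Complex.exp ((ϑ - ε * α : ℝ) * Complex.I) := by
    rw [rayPoint, add_sub_cancel_left, mul_assoc, ← Complex.exp_add]
    congr 2
    push_cast
    ring
  rw [sideFun, e, Complex.im_ofReal_mul, Complex.exp_ofReal_mul_I_im]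
  rcases hε with rfl | rfl
  · rw [one_mul, one_mul, one_mul, ← mul_neg, ← Real.sin_neg, neg_sub]
  · rw [neg_one_mul, neg_one_mul, neg_one_mul, sub_neg_eq_add, sub_neg_eq_add, add_comm]

theorem rayPoint_mem_closure (hα : 0 < α) (hα2 : α ≤ Real.pi / 2) {ϑ t : ℝ} (h1 : -α ≤ ϑ)
    (h2 : ϑ ≤ α) (ht : 0 ≤ t) : rayPoint c (θ + ϑ) t ∈ closure (sector c θ α) := by
  have hpi := Real.pi_pos
  rw [mem_closure_sector_iff hα hα2]
  intro ε hε
  rw [sideFun_rayPoint hε]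
  have : 0 ≤ Real.sin (α - ε * ϑ) := by
    rcases hε with rfl | rfl <;> exact Real.sin_nonneg_of_nonneg_of_le_pi (by linarith) (by linarith)
  have := mul_nonneg ht this
  linarith

theorem rayPoint_mem_sector (hα : 0 < α) (hα2 : α ≤ Real.pi / 2) {ϑ t : ℝ} (h1 : -α < ϑ)
    (h2 : ϑ < α) (ht : 0 < t) : rayPoint c (θ + ϑ) t ∈ sector c θ α := by
  have hpi := Real.pi_pos
  rw [mem_sector_iff hα hα2]
  intro ε hε
  rw [sideFun_rayPoint hε]
  have : 0 < Real.sin (α - ε * ϑ) := by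
    rcases hε with rfl | rfl <;> exact Real.sin_pos_of_pos_of_lt_pi (by linarith) (by linarith)
  have := mul_pos ht this
  linarith

theorem add_mul_exp_eq_rayPoint (c : ℂ) (θ t : ℝ) (w : ℂ) :
    c + t * Complex.exp (w + θ * Complex.I) = rayPoint c (θ + w.im) (t * Real.exp w.re) := by
  have : Complex.exp (w + θ * Complex.I) =
      Complex.exp w.re * Complex.exp ((θ + w.im : ℝ) * Complex.I) := by
    rw [← Complex.exp_add]
    congr 1
    conv_lhs => rw [← Complex.re_add_im w]
    push_cast
    ring
  rw [rayPoint, this]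
  push_cast
  ring

/-- A function bounded and holomorphic in the sector, in logarithmic coordinates. -/
theorem isStripFunction_comp_exp (hα : 0 < α) (hα2 : α ≤ Real.pi / 2) {r : RatFunc ℂ}
    (hr : ∀ z ∈ sector c θ α, ‖r.eval (RingHom.id ℂ) z‖ ≤ 1) {t : ℝ} (ht : 0 < t) :
    IsStripFunction α 1 fun w => r.eval (RingHom.id ℂ) (c + t * Complex.exp (w + θ * Complex.I)) := by
  have key : ∀ w : ℂ, -α ≤ w.im → w.im ≤ α →
      c + t * Complex.exp (w + θ * Complex.I) ∈ closure (sector c θ α) := by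
    intro w h1 h2
    rw [add_mul_exp_eq_rayPoint]
    exact rayPoint_mem_closure hα hα2 h1 h2 (by positivity)
  have hd : ∀ w : ℂ, -α ≤ w.im → w.im ≤ α → DifferentiableAt ℂ
      (fun w => r.eval (RingHom.id ℂ) (c + t * Complex.exp (w + θ * Complex.I))) w := by
    intro w h1 h2
    have := ratFunc_denom_ne_zero_and_norm_eval_le (isOpen_sector hα hα2) hr (key w h1 h2)
    exact (differentiableAt_ratFunc_eval this.1).comp w
      (f := fun w => c + t * Complex.exp (w + θ * Complex.I)) (by fun_prop)
  exact ⟨fun w hw => (hd w hw.1 hw.2).continuousAt.continuousWithinAt,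
    fun w hw => (hd w hw.1.le hw.2.le).differentiableWithinAt,
    fun w h1 h2 => (ratFunc_denom_ne_zero_and_norm_eval_le (isOpen_sector hα hα2) hr
      (key w h1 h2)).2⟩

/-- The contribution of the opposite side in the solution of the Neumann problem. -/
noncomputable def oppositeIntegral (hα : 0 < α) (hα2 : α ≤ Real.pi / 2)
    (f : frontier (sector c θ α) → ℂ) {ε : ℝ} (hε : ε = 1 ∨ ε = -1) (t : ℝ) : ℂ :=
  ∫ y : ℝ, sectorKernel α (ε * y : ℝ) * f (sidePoint c θ hα hα2 (neg_sign hε) (t * Real.exp y))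

theorem integrable_sectorKernel_sign (hα : 0 < α) (hα2 : α ≤ Real.pi / 2) {ε : ℝ}
    (hε : ε = 1 ∨ ε = -1) : Integrable fun y : ℝ => sectorKernel α (ε * y : ℝ) :=
  (integrable_sectorKernel hα hα2).comp_mul_left' (by rcases hε with rfl | rfl <;> norm_num)

theorem norm_sectorKernel_sign (α : ℝ) {ε : ℝ} (hε : ε = 1 ∨ ε = -1) (y : ℝ) :
    ‖sectorKernel α (ε * y : ℝ)‖ = ‖sectorKernel α y‖ := by
  rcases hε with rfl | rfl
  · rw [one_mul]
  · rw [neg_one_mul, Complex.ofReal_neg, norm_sectorKernel_neg]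

theorem continuous_oppositeIntegral (hα : 0 < α) (hα2 : α ≤ Real.pi / 2)
    (f : frontier (sector c θ α) →ᵇ ℂ) {ε : ℝ} (hε : ε = 1 ∨ ε = -1) :
    Continuous (oppositeIntegral hα hα2 f hε) := by
  have hc := f.continuous.comp (continuous_sidePoint (c := c) (θ := θ) hα hα2 (neg_sign hε))
  refine continuous_of_dominated (bound := fun y : ℝ => ‖sectorKernel α y‖ * ‖f‖)
    (fun t => ?_) (fun t => Filter.Eventually.of_forall fun y => ?_)
    ((integrable_sectorKernel hα hα2).norm.mul_const _) (Filter.Eventually.of_forall fun y => ?_)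
  · exact (integrable_sectorKernel_sign hα hα2 hε).aestronglyMeasurable.mul
      (hc.comp (by fun_prop : Continuous fun y : ℝ => t * Real.exp y)).aestronglyMeasurable
  · rw [norm_mul, norm_sectorKernel_sign α hε]
    exact mul_le_mul_of_nonneg_left (f.norm_coe_le_norm _) (norm_nonneg _)
  · exact continuous_const.mul (hc.comp (by fun_prop : Continuous fun t : ℝ => t * Real.exp y))

theorem norm_oppositeIntegral_le (hα : 0 < α) (hα2 : α ≤ Real.pi / 2)
    (f : frontier (sector c θ α) →ᵇ ℂ) {ε : ℝ} (hε : ε = 1 ∨ ε = -1) (t : ℝ) :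
    ‖oppositeIntegral hα hα2 f hε t‖ ≤ (∫ y : ℝ, ‖sectorKernel α y‖) * ‖f‖ := by
  rw [← integral_mul_const]
  refine norm_integral_le_of_norm_le ((integrable_sectorKernel hα hα2).norm.mul_const _)
    (Filter.Eventually.of_forall fun y => ?_)
  rw [norm_mul, norm_sectorKernel_sign α hε]
  exact mul_le_mul_of_nonneg_left (f.norm_coe_le_norm _) (norm_nonneg _)

theorem integrable_stripKernel_mul_side (hα : 0 < α) (hα2 : α ≤ Real.pi / 2) {γ : ℝ} (hγ : 0 < γ)
    (hγπ : γ ≤ Real.pi) (f : frontier (sector c θ α) →ᵇ ℂ) {ε : ℝ} (hε : ε = 1 ∨ ε = -1) (t : ℝ) :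
    Integrable fun y : ℝ => stripKernel γ y * f (sidePoint c θ hα hα2 hε (t * Real.exp y)) :=
  (integrable_stripKernel hγ hγπ).mul_bdd (c := ‖f‖)
    ((f.continuous.comp (continuous_sidePoint hα hα2 hε)).comp
      (by fun_prop : Continuous fun y : ℝ => t * Real.exp y)).aestronglyMeasurable
    (Filter.Eventually.of_forall fun _ => f.norm_coe_le_norm _)

theorem integrable_stripKernel_mul_oppositeIntegral (hα : 0 < α) (hα2 : α ≤ Real.pi / 2) {γ : ℝ}
    (hγ : 0 < γ) (hγπ : γ ≤ Real.pi) (f : frontier (sector c θ α) →ᵇ ℂ) {ε : ℝ}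
    (hε : ε = 1 ∨ ε = -1) (t : ℝ) :
    Integrable fun y : ℝ => stripKernel γ y * oppositeIntegral hα hα2 f hε (t * Real.exp y) :=
  (integrable_stripKernel hγ hγπ).mul_bdd (c := (∫ y : ℝ, ‖sectorKernel α y‖) * ‖f‖)
    ((continuous_oppositeIntegral hα hα2 f hε).comp
      (by fun_prop : Continuous fun y : ℝ => t * Real.exp y)).aestronglyMeasurable
    (Filter.Eventually.of_forall fun _ => norm_oppositeIntegral_le hα hα2 f hε _)

/-- `r` in logarithmic coordinates, on the sides of the sector. -/
theorem eval_comp_exp_side (hα : 0 < α) (hα2 : α ≤ Real.pi / 2) {r : RatFunc ℂ}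
    {f : frontier (sector c θ α) →ᵇ ℂ}
    (hf : ∀ z : frontier (sector c θ α), f z = r.eval (RingHom.id ℂ) z) {ε : ℝ}
    (hε : ε = 1 ∨ ε = -1) {t : ℝ} (ht : 0 < t) {w : ℂ} {y : ℝ} (hw : w = y + (ε * α : ℝ) * Complex.I) :
    r.eval (RingHom.id ℂ) (c + t * Complex.exp (w + θ * Complex.I)) =
      f (sidePoint c θ hα hα2 hε (t * Real.exp y)) := by
  rw [hf, coe_sidePoint hα hα2 hε (by positivity), add_mul_exp_eq_rayPoint, hw]
  simp

/-- The identities on the two edges of the strip, read on the sides of the sector. They express that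
f - (1/2) K f solves the equation: P f = (1/2) K f + (1/2) P K f. -/
theorem boundary_equation (hα : 0 < α) (hα2 : α ≤ Real.pi / 2) {r : RatFunc ℂ}
    (hr : ∀ z ∈ sector c θ α, ‖r.eval (RingHom.id ℂ) z‖ ≤ 1)
    {f : frontier (sector c θ α) →ᵇ ℂ}
    (hf : ∀ z : frontier (sector c θ α), f z = r.eval (RingHom.id ℂ) z) {ε : ℝ}
    (hε : ε = 1 ∨ ε = -1) {t : ℝ} (ht : 0 < t) :
    ∫ y : ℝ, stripKernel (2 * α) y * f (sidePoint c θ hα hα2 (neg_sign hε) (t * Real.exp y)) =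
      1 / 2 * oppositeIntegral hα hα2 f hε t + 1 / 2 * ∫ y : ℝ, stripKernel (2 * α) y *
        oppositeIntegral hα hα2 f (neg_sign hε) (t * Real.exp y) := by
  have hF := isStripFunction_comp_exp hα hα2 hr ht
  have e := fun {ε : ℝ} (hε : ε = 1 ∨ ε = -1) {w : ℂ} {y : ℝ} =>
    eval_comp_exp_side (c := c) (θ := θ) hα hα2 hf hε ht (w := w) (y := y)
  rcases hε with rfl | rfl
  · have := hF.boundary_identity_upper hα hα2
    convert! this using 1
    · refine integral_congr_ae (Filter.Eventually.of_forall fun y => ?_)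
      simp only
      rw [e (neg_sign (Or.inl rfl)) (w := y - α * Complex.I) (y := y) (by push_cast; ring)]
    · congr 2
      · refine integral_congr_ae (Filter.Eventually.of_forall fun y => ?_)
        simp only [one_mul]
        rw [e (neg_sign (Or.inl rfl)) (w := y - α * Complex.I) (y := y) (by push_cast; ring)]
      · refine integral_congr_ae (Filter.Eventually.of_forall fun y => ?_)
        simp only
        congr 1
        refine integral_congr_ae (Filter.Eventually.of_forall fun y' => ?_)
        simp only [neg_one_mul, Complex.ofReal_neg]
        rw [e (neg_sign (neg_sign (Or.inl rfl))) (w := y + y' + α * Complex.I) (y := y + y')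
          (by push_cast; ring), Real.exp_add, mul_assoc]
  · have := hF.boundary_identity_lower hα hα2
    convert! this using 1
    · refine integral_congr_ae (Filter.Eventually.of_forall fun y => ?_)
      simp only
      rw [e (neg_sign (Or.inr rfl)) (w := y + α * Complex.I) (y := y) (by push_cast; ring)]
    · congr 2
      · refine integral_congr_ae (Filter.Eventually.of_forall fun y => ?_)
        simp only [neg_one_mul, Complex.ofReal_neg]
        rw [e (neg_sign (Or.inr rfl)) (w := y + α * Complex.I) (y := y) (by push_cast; ring)]
      · refine integral_congr_ae (Filter.Eventually.of_forall fun y => ?_)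
        simp only
        congr 1
        refine integral_congr_ae (Filter.Eventually.of_forall fun y' => ?_)
        simp only [neg_neg, one_mul]
        rw [e (Or.inr rfl) (w := y + y' - α * Complex.I) (y := y + y')
          (by push_cast; ring), Real.exp_add, mul_assoc]

/-- Each use of the equation improves a uniform bound by the factor (π - γ)/π < 1. The norm estimate
for integrals needs no measurability of `d`. -/
theorem eq_zero_of_eq_neg_integral_stripKernel {γ : ℝ} (hγ : 0 < γ) (hγπ : γ ≤ Real.pi)
    (d : ∀ ε : ℝ, (ε = 1 ∨ ε = -1) → ℝ → ℂ) (B : ℝ)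
    (hB : ∀ (ε : ℝ) (hε : ε = 1 ∨ ε = -1) (t : ℝ), 0 < t → ‖d ε hε t‖ ≤ B)
    (hd : ∀ (ε : ℝ) (hε : ε = 1 ∨ ε = -1) (t : ℝ), 0 < t →
      d ε hε t = -∫ y : ℝ, stripKernel γ y * d (-ε) (neg_sign hε) (t * Real.exp y))
    (ε : ℝ) (hε : ε = 1 ∨ ε = -1) (t : ℝ) (ht : 0 < t) : d ε hε t = 0 := by
  have hpi := Real.pi_pos
  have hq0 : 0 ≤ (Real.pi - γ) / Real.pi := div_nonneg (by linarith) hpi.le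
  have hq1 : (Real.pi - γ) / Real.pi < 1 := by
    rw [div_lt_one hpi]
    linarith
  have hdB : ∀ (n : ℕ) (ε : ℝ) (hε : ε = 1 ∨ ε = -1) (t : ℝ), 0 < t →
      ‖d ε hε t‖ ≤ ((Real.pi - γ) / Real.pi) ^ n * B := by
    intro n
    induction n with
    | zero =>
      intro ε hε t ht
      simpa using hB ε hε t ht
    | succ n ih =>
      intro ε hε t ht
      rw [hd ε hε t ht, norm_neg, pow_succ', mul_assoc, ← integral_norm_stripKernel hγ hγπ,
        ← integral_mul_const]
      refine norm_integral_le_of_norm_le ((integrable_stripKernel hγ hγπ).norm.mul_const _)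
        (Filter.Eventually.of_forall fun y => ?_)
      rw [norm_mul, integral_norm_stripKernel hγ hγπ]
      exact mul_le_mul_of_nonneg_left (ih _ _ _ (by positivity)) (norm_nonneg _)
  rw [← norm_le_zero_iff]
  have l := (tendsto_pow_atTop_nhds_zero_of_lt_one hq0 hq1).mul_const B
  rw [zero_mul] at l
  exact ge_of_tendsto' l fun n => hdB n ε hε t ht

/-- The explicit solution of `h + P h = r` on the boundary of the sector. -/
theorem solution_sidePoint (hα : 0 < α) (hα2 : α ≤ Real.pi / 2) {r : RatFunc ℂ}
    (hr : ∀ z ∈ sector c θ α, ‖r.eval (RingHom.id ℂ) z‖ ≤ 1)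
    {f h : frontier (sector c θ α) →ᵇ ℂ}
    (hf : ∀ z : frontier (sector c θ α), f z = r.eval (RingHom.id ℂ) z)
    (hh : h + doubleLayerOperator c θ hα hα2 h = f) {ε : ℝ} (hε : ε = 1 ∨ ε = -1) {t : ℝ}
    (ht : 0 ≤ t) :
    h (sidePoint c θ hα hα2 hε t) =
      f (sidePoint c θ hα hα2 hε t) - 1 / 2 * oppositeIntegral hα hα2 f hε t := by
  have hpi := Real.pi_pos
  have hγ : 0 < 2 * α := by linarith
  have hγπ : 2 * α ≤ Real.pi := by linarith
  have hc : Continuous fun t => h (sidePoint c θ hα hα2 hε t) -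
      (f (sidePoint c θ hα hα2 hε t) - 1 / 2 * oppositeIntegral hα hα2 f hε t) :=
    (h.continuous.comp (continuous_sidePoint hα hα2 hε)).sub
      ((f.continuous.comp (continuous_sidePoint hα hα2 hε)).sub
        (continuous_const.mul (continuous_oppositeIntegral hα hα2 f hε)))
  -- The difference d between h and the candidate is bounded and satisfies d = -P d on the open
  -- sides.
  have hzero := eq_zero_of_eq_neg_integral_stripKernel hγ hγπ
    (fun ε hε t => h (sidePoint c θ hα hα2 hε t) -
      (f (sidePoint c θ hα hα2 hε t) - 1 / 2 * oppositeIntegral hα hα2 f hε t))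
    (‖h‖ + (‖f‖ + 1 / 2 * ((∫ y : ℝ, ‖sectorKernel α y‖) * ‖f‖))) (fun ε hε t ht => by
      refine (norm_sub_le _ _).trans (add_le_add (h.norm_coe_le_norm _) ((norm_sub_le _ _).trans
        (add_le_add (f.norm_coe_le_norm _) ?_)))
      have : ‖(1 / 2 : ℂ)‖ = 1 / 2 := by norm_num
      rw [norm_mul, this]
      exact mul_le_mul_of_nonneg_left (norm_oppositeIntegral_le hα hα2 f hε t) (by norm_num))
    (fun ε hε t ht => by
      have h1 := congrArg (fun g : frontier (sector c θ α) →ᵇ ℂ => g (sidePoint c θ hα hα2 hε t)) hh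
      simp only [BoundedContinuousFunction.coe_add, Pi.add_apply] at h1
      rw [doubleLayerOperator_sidePoint hα hα2 h hε ht.le] at h1
      have h2 := boundary_equation hα hα2 hr hf hε ht
      have i1 := integrable_stripKernel_mul_side hα hα2 hγ hγπ h (neg_sign hε) t
      have i2 := integrable_stripKernel_mul_side hα hα2 hγ hγπ f (neg_sign hε) t
      have i3 := integrable_stripKernel_mul_oppositeIntegral hα hα2 hγ hγπ f (neg_sign hε) t
      simp only [mul_sub, mul_left_comm _ (1 / 2 : ℂ)]
      have i4 := integral_sub i1 (i2.sub (i3.const_mul (1 / 2)))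
      simp only [Pi.sub_apply] at i4
      rw [i4, integral_sub i2 (i3.const_mul _), integral_const_mul]
      linear_combination h1 - h2)
  -- The vertex t = 0 is included by continuity.
  have hcl : Set.Ici (0 : ℝ) ⊆ {t | h (sidePoint c θ hα hα2 hε t) -
      (f (sidePoint c θ hα hα2 hε t) - 1 / 2 * oppositeIntegral hα hα2 f hε t) = 0} := by
    rw [← closure_Ioi]
    exact closure_minimal (fun t ht => hzero ε hε t ht) (isClosed_eq hc continuous_const)
  exact sub_eq_zero.1 (hcl ht)

theorem norm_le_one_of_eq_eval (hα : 0 < α) (hα2 : α ≤ Real.pi / 2) {r : RatFunc ℂ}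
    (hr : ∀ z ∈ sector c θ α, ‖r.eval (RingHom.id ℂ) z‖ ≤ 1) {f : frontier (sector c θ α) →ᵇ ℂ}
    (hf : ∀ z : frontier (sector c θ α), f z = r.eval (RingHom.id ℂ) z) : ‖f‖ ≤ 1 := by
  rw [BoundedContinuousFunction.norm_le zero_le_one]
  intro z
  rw [hf]
  exact (ratFunc_denom_ne_zero_and_norm_eval_le (isOpen_sector hα hα2) hr
    (frontier_subset_closure z.2)).2

/-- Since ‖f‖ ≤ 1, the explicit formula gives ‖h‖ ≤ 1 + 1/2 of the L¹ norm of the sector kernel. -/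
theorem constN_sector_le (hα : 0 < α) (hα2 : α ≤ Real.pi / 2) :
    constN (sector c θ α) ≤ ENNReal.ofReal
      (2 - 2 / Real.pi * Real.log (Real.tan (α * Real.pi / (4 * (Real.pi - α))))) := by
  refine sSup_le ?_
  rintro K ⟨r, f, h, hr, hf, hh, rfl⟩
  refine ENNReal.ofReal_le_ofReal ?_
  rw [isDoubleLayer_sub_iff hα hα2] at hh
  have hf1 := norm_le_one_of_eq_eval hα hα2 hr hf
  have hk := integral_norm_sectorKernel hα hα2
  have hk0 : 0 ≤ ∫ x : ℝ, ‖sectorKernel α x‖ := integral_nonneg fun _ => norm_nonneg _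
  have : ‖h‖ ≤ 1 + 1 / 2 * ∫ x : ℝ, ‖sectorKernel α x‖ := by
    rw [BoundedContinuousFunction.norm_le (by positivity)]
    intro z
    obtain ⟨ε, hε, t, ht, rfl⟩ := exists_eq_sidePoint hα hα2 z
    rw [solution_sidePoint hα hα2 hr hf hh hε ht]
    refine (norm_sub_le _ _).trans (add_le_add ((f.norm_coe_le_norm _).trans hf1) ?_)
    rw [norm_mul]
    have e : ‖(1 / 2 : ℂ)‖ = 1 / 2 := by norm_num
    rw [e]
    refine mul_le_mul_of_nonneg_left ((norm_oppositeIntegral_le hα hα2 f hε t).trans ?_)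
      (by norm_num)
    nlinarith
  linarith

/-- The double layer potential of the solution reproduces `r` in the sector. -/
theorem integral_solution (hα : 0 < α) (hα2 : α ≤ Real.pi / 2) {r : RatFunc ℂ}
    (hr : ∀ z ∈ sector c θ α, ‖r.eval (RingHom.id ℂ) z‖ ≤ 1)
    {f h : frontier (sector c θ α) →ᵇ ℂ}
    (hf : ∀ z : frontier (sector c θ α), f z = r.eval (RingHom.id ℂ) z)
    (hh : h + doubleLayerOperator c θ hα hα2 h = f) {t : ℝ} (ht : 0 < t) {ϑ : ℝ} (h0 : 0 < ϑ)
    (h1 : ϑ < α) :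
    Integrable (fun σ : frontier (sector c θ α) =>
      (doubleLayerKernel (sector c θ α) σ (rayPoint c (θ + ϑ) t) : ℂ) * h σ)
      (arclength (sector c θ α)) ∧
    ∫ σ : frontier (sector c θ α),
      (doubleLayerKernel (sector c θ α) σ (rayPoint c (θ + ϑ) t) : ℂ) * h σ
      ∂(arclength (sector c θ α)) = r.eval (RingHom.id ℂ) (rayPoint c (θ + ϑ) t) := by
  have hpi := Real.pi_pos
  have e1 : α - 1 * ϑ = α - ϑ := by ring
  have e2 : α - -1 * ϑ = α + ϑ := by ring
  have g1 : 0 < α - ϑ := by linarith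
  have g2 : α - ϑ ≤ Real.pi := by linarith
  have g3 : 0 < α + ϑ := by linarith
  have g4 : α + ϑ ≤ Real.pi := by linarith
  have hi := integral_doubleLayerKernel_rayPoint hα hα2 h ht (ϑ := ϑ)
    (by rw [e1]; exact integrable_stripKernel_mul_side hα hα2 g1 g2 h _ t)
    (by rw [e2]; exact integrable_stripKernel_mul_side hα hα2 g3 g4 h _ t)
  refine ⟨hi.1, hi.2.trans ?_⟩
  rw [e1, e2]
  have hsplit : ∀ {γ : ℝ}, 0 < γ → γ ≤ Real.pi → ∀ {ε : ℝ} (hε : ε = 1 ∨ ε = -1),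
      ∫ y : ℝ, stripKernel γ y * h (sidePoint c θ hα hα2 hε (t * Real.exp y)) =
      (∫ y : ℝ, stripKernel γ y * f (sidePoint c θ hα hα2 hε (t * Real.exp y))) -
        1 / 2 * ∫ y : ℝ, stripKernel γ y * oppositeIntegral hα hα2 f hε (t * Real.exp y) := by
    intro γ hγ hγπ ε hε
    have i2 := integrable_stripKernel_mul_side hα hα2 hγ hγπ f hε t
    have i3 := integrable_stripKernel_mul_oppositeIntegral hα hα2 hγ hγπ f hε t
    rw [← integral_const_mul, ← integral_sub i2 (i3.const_mul _)]
    refine integral_congr_ae (Filter.Eventually.of_forall fun y => ?_)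
    simp only [solution_sidePoint hα hα2 hr hf hh hε (mul_pos ht (Real.exp_pos y)).le]
    ring
  rw [hsplit g1 g2, hsplit g3 g4]
  -- After the substitution of the explicit solution, the claim is the interior identity in the
  -- strip, rewritten in terms of f on the two sides.
  have key := (isStripFunction_comp_exp hα hα2 hr ht).interior_identity hα2 h0 h1
  have e := fun {ε : ℝ} (hε : ε = 1 ∨ ε = -1) {w : ℂ} {y : ℝ} =>
    eval_comp_exp_side (c := c) (θ := θ) hα hα2 hf hε ht (w := w) (y := y)
  have k1 : ∀ y : ℝ, r.eval (RingHom.id ℂ) (c + t * Complex.exp (y + α * Complex.I +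
      θ * Complex.I)) = f (sidePoint c θ hα hα2 (Or.inl rfl) (t * Real.exp y)) := fun y =>
    e (Or.inl rfl) (by push_cast; ring)
  have k2 : ∀ y : ℝ, r.eval (RingHom.id ℂ) (c + t * Complex.exp (y - α * Complex.I +
      θ * Complex.I)) = f (sidePoint c θ hα hα2 (Or.inr rfl) (t * Real.exp y)) := fun y =>
    e (Or.inr rfl) (by push_cast; ring)
  have k3 : ∀ y : ℝ, ∫ y' : ℝ, sectorKernel α (-y') * r.eval (RingHom.id ℂ) (c + t *
      Complex.exp (y + y' + α * Complex.I + θ * Complex.I)) =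
      oppositeIntegral hα hα2 f (Or.inr rfl) (t * Real.exp y) := by
    intro y
    refine integral_congr_ae (Filter.Eventually.of_forall fun y' => ?_)
    simp only [neg_one_mul, Complex.ofReal_neg]
    rw [e (neg_sign (Or.inr rfl)) (w := y + y' + α * Complex.I) (y := y + y')
      (by push_cast; ring), Real.exp_add, mul_assoc]
  have k4 : ∀ y : ℝ, ∫ y' : ℝ, sectorKernel α y' * r.eval (RingHom.id ℂ) (c + t *
      Complex.exp (y + y' - α * Complex.I + θ * Complex.I)) =
      oppositeIntegral hα hα2 f (Or.inl rfl) (t * Real.exp y) := by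
    intro y
    refine integral_congr_ae (Filter.Eventually.of_forall fun y' => ?_)
    simp only [one_mul]
    rw [e (neg_sign (Or.inl rfl)) (w := y + y' - α * Complex.I) (y := y + y')
      (by push_cast; ring), Real.exp_add, mul_assoc]
  have k5 : c + t * Complex.exp (ϑ * Complex.I + θ * Complex.I) = rayPoint c (θ + ϑ) t := by
    rw [rayPoint]
    push_cast
    ring_nf
  simp only [k1, k2, k3, k4, k5] at key
  linear_combination key

end Solution

/-! ### Elementary estimates for the lower bound. -/

section LowerBound

variable {c : ℂ} {θ α : ℝ}

theorem phase_eq (hα2 : α ≤ Real.pi / 2) :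
    Real.pi / (4 * (Real.pi - α)) * (2 * (Real.pi - 2 * α)) =
      Real.pi / 2 - 2 * (Real.pi / (4 * (Real.pi - α))) * α := by
  have hpi := Real.pi_pos
  have hb : Real.pi - α ≠ 0 := by linarith
  field_simp
  ring

theorem scale_le_half (hα2 : α ≤ Real.pi / 2) : Real.pi / (4 * (Real.pi - α)) ≤ 1 / 2 := by
  have hpi := Real.pi_pos
  rw [div_le_div_iff₀ (by linarith) two_pos]
  linarith

/-- The shifted cosh is Cp + iSs. Its squared modulus is S² + p², because C² = S² + 1 and s² + p² =
1. -/
theorem sectorKernel_ofReal (hα : 0 < α) (hα2 : α ≤ Real.pi / 2) (x : ℝ) {S C s p : ℝ}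
    (hS : S = Real.sinh (Real.pi / (4 * (Real.pi - α)) * x))
    (hC : C = Real.cosh (Real.pi / (4 * (Real.pi - α)) * x))
    (hs : s = Real.sin (Real.pi / (4 * (Real.pi - α)) * (2 * (Real.pi - 2 * α))))
    (hp : p = Real.cos (Real.pi / (4 * (Real.pi - α)) * (2 * (Real.pi - 2 * α)))) :
    0 < S ^ 2 + p ^ 2 ∧ sectorKernel α x =
      ((1 / (4 * (Real.pi - α)) * s / (C * (S ^ 2 + p ^ 2)) : ℝ) : ℂ) *
        (((C * p : ℝ) : ℂ) - ((S * s : ℝ) : ℂ) * Complex.I) := by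
  have hpi := Real.pi_pos
  have hb : 0 < Real.pi - α := by linarith
  obtain ⟨b1, b2⟩ := scaled_im_bounds hα hα2 (z := x) (by simp) (by simpa using hα.le)
  have c1 := complex_cosh_ne_zero_of_abs_im_lt b1
  have c2 := complex_cosh_ne_zero_of_abs_im_lt b2
  have hsp : s ^ 2 + p ^ 2 = 1 := by rw [hs, hp, Real.sin_sq_add_cos_sq]
  have hCS : C ^ 2 = S ^ 2 + 1 := by
    have := Real.cosh_sq (Real.pi / (4 * (Real.pi - α)) * x)
    rw [hS, hC]
    linarith
  have hp0 : 0 < p := by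
    rw [hp]
    obtain ⟨p1, p2⟩ := phase_bounds hα hα2
    exact Real.cos_pos_of_mem_Ioo ⟨by linarith, p2⟩
  have hpos : 0 < S ^ 2 + p ^ 2 := by positivity
  refine ⟨hpos, ?_⟩
  have hC0 : 0 < C := by rw [hC]; exact Real.cosh_pos _
  rw [sectorKernel_eq_div α c1 c2]
  have e1 : Complex.cosh ((Real.pi / (4 * (Real.pi - α)) : ℝ) * x) = C := by
    rw [hC]
    push_cast
    rfl
  have e2 : Complex.cosh ((Real.pi / (4 * (Real.pi - α)) : ℝ) *
      (x + (2 * (Real.pi - 2 * α) : ℝ) * Complex.I)) = C * p + S * s * Complex.I := by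
    rw [mul_add, ← mul_assoc, ← Complex.ofReal_mul, Complex.cosh_add, Complex.cosh_mul_I,
      Complex.sinh_mul_I, ← Complex.ofReal_mul, hC, hS, hs, hp]
    push_cast
    ring
  rw [e1, e2]
  rw [e2] at c2
  have hC0' : (C : ℂ) ≠ 0 := by exact_mod_cast hC0.ne'
  have hpos' : (S : ℂ) ^ 2 + (p : ℂ) ^ 2 ≠ 0 := by exact_mod_cast hpos.ne'
  have hb' : (Real.pi : ℂ) - α ≠ 0 := by exact_mod_cast hb.ne'
  rw [← hs]
  have key : ((C : ℂ) * p + S * s * Complex.I) * (C * p - S * s * Complex.I) = S ^ 2 + p ^ 2 := by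
    have h1 : (C : ℂ) ^ 2 = S ^ 2 + 1 := by exact_mod_cast hCS
    have h2 : (s : ℂ) ^ 2 + p ^ 2 = 1 := by exact_mod_cast hsp
    linear_combination (-(S : ℂ) ^ 2 * s ^ 2) * Complex.I_sq + (p : ℂ) ^ 2 * h1 + (S : ℂ) ^ 2 * h2
  push_cast
  rw [← key, div_eq_iff (mul_ne_zero c2 hC0')]
  have c3 : (C : ℂ) * p - S * s * Complex.I ≠ 0 := by
    intro h0
    rw [h0, mul_zero] at key
    exact hpos' key.symm
  generalize (C : ℂ) * p + S * s * Complex.I = A at *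
  generalize (C : ℂ) * p - S * s * Complex.I = B at *
  field_simp

/-- The function y cosh y - sinh y vanishes at 0 and has derivative y sinh y. -/
theorem cosh_le_exp_abs_bound {x : ℝ} (h0 : 0 < x) : Real.sinh x ≤ x * Real.cosh x := by
  have hd : ∀ y : ℝ, HasDerivAt (fun y => y * Real.cosh y - Real.sinh y)
      (y * Real.sinh y) y := by
    intro y
    have := ((hasDerivAt_id y).mul (Real.hasDerivAt_cosh y)).sub (Real.hasDerivAt_sinh y)
    convert! this using 1
    simp
  have hmono : MonotoneOn (fun y => y * Real.cosh y - Real.sinh y) (Set.Ici 0) := by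
    refine monotoneOn_of_deriv_nonneg (convex_Ici 0)
      (fun y _ => (hd y).continuousAt.continuousWithinAt)
      (fun y _ => (hd y).differentiableAt.differentiableWithinAt) fun y hy => ?_
    rw [interior_Ici] at hy
    rw [(hd y).deriv]
    exact mul_nonneg (le_of_lt hy) (Real.sinh_nonneg_iff.2 (le_of_lt hy))
  have := hmono (Set.mem_Ici.2 le_rfl) (Set.mem_Ici.2 h0.le) h0.le
  simp at this
  linarith

theorem one_sub_le_mul_one_sub {a b e : ℝ} (ha : 1 - e ≤ a) (ha1 : a ≤ 1)
    (hb1 : b ≤ 1) {e' : ℝ} (hb : 1 - e' ≤ b) : 1 - (e + e') ≤ a * b := by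
  nlinarith

/-- It collects the relative errors of the four factors in `lower_bound_elementary`. In units of α/y
the terms with α count at most 1, 2 and 4, hence the 7. -/
theorem error_bound_elementary {y : ℝ} (hα : 0 < α) (hy : 2 * α ≤ y) (hy1 : y ≤ 1) :
    1 - (7 * α / y + y ^ 2) ≤ 1 - (α ^ 2 + y ^ 2 / 4 + 4 * α ^ 2 / y ^ 2 + 4 * α / y) := by
  have hy0 : 0 < y := by linarith
  have h1 : α ^ 2 ≤ α / y := by
    rw [le_div_iff₀ hy0, pow_two, mul_assoc]
    have : α * y ≤ 1 := by nlinarith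
    nlinarith
  have h2 : 4 * α ^ 2 / y ^ 2 ≤ 2 * (α / y) := by
    have e : 4 * α ^ 2 / y ^ 2 = 2 * (α / y) * (2 * α / y) := by
      field_simp
      norm_num
    rw [e]
    have : 2 * α / y ≤ 1 := by rwa [div_le_one hy0]
    exact mul_le_of_le_one_right (by positivity) this
  have h3 : 7 * α / y = 7 * (α / y) := mul_div_assoc _ _ _
  have h4 : 4 * α / y = 4 * (α / y) := mul_div_assoc _ _ _
  have h5 := sq_nonneg y
  rw [h3, h4]
  linarith

/-- The elementary estimate behind the lower bound for the solution. -/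
theorem lower_bound_elementary (hα : 0 < α) {l y S C s p T : ℝ} (hl0 : 0 < l) (hl : l ≤ 1 / 2)
    (hy : 2 * α ≤ y) (hy1 : y ≤ 1) (hS : S = Real.sinh (l * y)) (hC : C = Real.cosh (l * y))
    (hsp : s ^ 2 + p ^ 2 = 1) (hp0 : 0 ≤ p) (hp : p ≤ 2 * l * α) (hT1 : T ≤ 1) (hT0 : 0 ≤ T)
    (hT : 1 - 4 * α / y ≤ T) :
    (1 / y - 7 * α / y ^ 2 - y) ≤ l * (s ^ 2 * S * T / (C * (S ^ 2 + p ^ 2))) := by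
  have hy0 : 0 < y := by linarith
  have hx0 : 0 < l * y := by positivity
  have hC1 : 1 ≤ C := by rw [hC]; exact Real.one_le_cosh _
  have hSx : l * y ≤ S := by rw [hS]; exact Real.self_le_sinh_iff.2 hx0.le
  have hS0 : 0 < S := by linarith
  have hSC : S ≤ l * y * C := by rw [hS, hC]; exact cosh_le_exp_abs_bound hx0
  have hCS : C ^ 2 = S ^ 2 + 1 := by
    rw [hS, hC]
    have := Real.cosh_sq (l * y)
    linarith
  -- The quantity is compared with 1/y by means of four factors close to 1, namely s², 1/C², S²/(S²
  -- + p²) and T. Each has its own lower bound, and the errors add up.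
  have f1 : 1 - α ^ 2 ≤ s ^ 2 := by
    have : p ≤ α := by nlinarith
    nlinarith
  have f1' : s ^ 2 ≤ 1 := by nlinarith
  have f2 : 1 - y ^ 2 / 4 ≤ 1 / C ^ 2 := by
    have h1 : S ^ 2 ≤ (l * y) ^ 2 * C ^ 2 := by
      rw [← mul_pow]
      exact pow_le_pow_left₀ hS0.le hSC 2
    have h2 : (l * y) ^ 2 ≤ y ^ 2 / 4 := by
      have : l ^ 2 ≤ 1 / 4 := by nlinarith
      rw [mul_pow]
      nlinarith [sq_nonneg y]
    rw [le_div_iff₀ (by positivity)]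
    nlinarith [sq_nonneg C]
  have f2' : 1 / C ^ 2 ≤ 1 := by
    rw [div_le_one (by positivity)]
    nlinarith
  have f3 : 1 - 4 * α ^ 2 / y ^ 2 ≤ S ^ 2 / (S ^ 2 + p ^ 2) := by
    have h1 : p ^ 2 * y ^ 2 ≤ 4 * α ^ 2 * S ^ 2 := by
      have : p * y ≤ 2 * α * S := by nlinarith
      have h0 : 0 ≤ p * y := by positivity
      nlinarith
    rw [le_div_iff₀ (by positivity), sub_mul, one_mul, div_mul_eq_mul_div, sub_le_iff_le_add,
      ← sub_le_iff_le_add', le_div_iff₀ (by positivity)]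
    nlinarith [mul_nonneg (sq_nonneg α) (sq_nonneg p)]
  have f3' : S ^ 2 / (S ^ 2 + p ^ 2) ≤ 1 := by
    rw [div_le_one (by positivity)]
    nlinarith [sq_nonneg p]
  have f4 := one_sub_le_mul_one_sub f1 f1' f2' f2
  have g4 : s ^ 2 * (1 / C ^ 2) ≤ 1 := mul_le_one₀ f1' (by positivity) f2'
  have f5 := one_sub_le_mul_one_sub f4 g4 f3' f3
  have g5 : s ^ 2 * (1 / C ^ 2) * (S ^ 2 / (S ^ 2 + p ^ 2)) ≤ 1 :=
    mul_le_one₀ g4 (by positivity) f3'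
  have f6 := one_sub_le_mul_one_sub f5 g5 hT1 hT
  have f7 : 1 - (7 * α / y + y ^ 2) ≤ s ^ 2 * (1 / C ^ 2) * (S ^ 2 / (S ^ 2 + p ^ 2)) * T := by
    exact (error_bound_elementary hα hy hy1).trans f6
  have f8 : s ^ 2 * (1 / C ^ 2) * (S ^ 2 / (S ^ 2 + p ^ 2)) * T ≤
      y * (l * (s ^ 2 * S * T / (C * (S ^ 2 + p ^ 2)))) := by
    have e1 : s ^ 2 * (1 / C ^ 2) * (S ^ 2 / (S ^ 2 + p ^ 2)) * T =
        s ^ 2 * S * T / (C ^ 2 * (S ^ 2 + p ^ 2)) * S := by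
      field_simp
    have e2 : y * (l * (s ^ 2 * S * T / (C * (S ^ 2 + p ^ 2)))) =
        s ^ 2 * S * T / (C ^ 2 * (S ^ 2 + p ^ 2)) * (l * y * C) := by
      field_simp
    rw [e1, e2]
    exact mul_le_mul_of_nonneg_left hSC (by positivity)
  have e : 1 / y - 7 * α / y ^ 2 - y = (1 - (7 * α / y + y ^ 2)) / y := by
    field_simp
    ring
  rw [e, div_le_iff₀ hy0, mul_comm _ y]
  exact f7.trans f8

/-- The quotient is the real part of the test function on a side. It is close to 1 because cosh u -
sinh u + q ≤ 2 while cosh u ≥ u. -/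
theorem one_sub_two_div_le_sinh_div {u q : ℝ} (hu : 0 < u) (h0 : 0 ≤ q) (h1 : q ≤ 1) :
    1 - 2 / u ≤ Real.sinh u / (Real.cosh u + q) := by
  have hc : 1 ≤ Real.cosh u := Real.one_le_cosh u
  have hs : 0 < Real.sinh u := Real.sinh_pos_iff.2 hu
  have h2 : u ≤ Real.cosh u := by
    have := one_add_sq_div_two_le_cosh u
    nlinarith [sq_nonneg (u - 1)]
  have h3 : Real.cosh u - Real.sinh u ≤ 1 := by
    rw [Real.cosh_sub_sinh]
    exact Real.exp_le_one_iff.2 (by linarith)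
  rw [le_div_iff₀ (by linarith), sub_mul, one_mul]
  have h4 : 2 ≤ 2 / u * (Real.cosh u + q) := by
    rw [div_mul_eq_mul_div, le_div_iff₀ hu]
    nlinarith
  linarith

/-- The Cayley transform of exp(u - iv) is tanh((u - iv)/2), here split into its real and imaginary
parts. -/
theorem exp_sub_one_div_exp_add_one (u v : ℝ) (h : 0 < Real.cosh u + Real.cos v) :
    (Complex.exp (u - v * Complex.I) - 1) / (Complex.exp (u - v * Complex.I) + 1) =
      ((Real.sinh u / (Real.cosh u + Real.cos v) : ℝ) : ℂ) -
        ((Real.sin v / (Real.cosh u + Real.cos v) : ℝ) : ℂ) * Complex.I := by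
  have h' : (Real.cosh u : ℂ) + Real.cos v ≠ 0 := by exact_mod_cast h.ne'
  have e : Complex.exp (u - v * Complex.I) =
      Real.exp u * ((Real.cos v : ℂ) - Real.sin v * Complex.I) := by
    have : (u : ℂ) - v * Complex.I = u + (-v : ℝ) * Complex.I := by push_cast; ring
    rw [this, Complex.exp_add, Complex.exp_mul_I]
    push_cast
    rw [Complex.cos_neg, Complex.sin_neg]
    ring
  have hE : (Real.exp u : ℂ) * (Real.exp (-u) : ℂ) = 1 := by
    rw [← Complex.ofReal_mul, ← Real.exp_add]; simp
  have hcs : (Real.sin v : ℂ) ^ 2 + (Real.cos v : ℂ) ^ 2 = 1 := by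
    exact_mod_cast Real.sin_sq_add_cos_sq v
  have hch : (Real.cosh u : ℂ) = (Real.exp u + Real.exp (-u)) / 2 := by
    rw [Real.cosh_eq]; push_cast; rfl
  have hsh : (Real.sinh u : ℂ) = (Real.exp u - Real.exp (-u)) / 2 := by
    rw [Real.sinh_eq]; push_cast; rfl
  have hne : Complex.exp (u - v * Complex.I) + 1 ≠ 0 := by
    intro h0
    have h1 : Complex.exp (u - v * Complex.I) = -1 := eq_neg_of_add_eq_zero_left h0
    rw [e] at h1
    have hr := congrArg Complex.re h1
    have hi := congrArg Complex.im h1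
    simp only [Complex.sub_re, Complex.sub_im,
      Complex.ofReal_re, Complex.ofReal_im, Complex.mul_re, Complex.mul_im, Complex.I_re,
      Complex.I_im, Complex.neg_re, Complex.neg_im, Complex.one_re, Complex.one_im] at hr hi
    have hex := Real.exp_pos u
    have hsin : Real.sin v = 0 := by
      have : Real.exp u * Real.sin v = 0 := by linarith
      exact (mul_eq_zero.1 this).resolve_left hex.ne'
    have hc2 : Real.cos v ^ 2 = 1 := by
      have := Real.sin_sq_add_cos_sq v
      rw [hsin] at this
      linarith
    have hc1 : Real.cos v = -1 := by
      have : Real.cos v < 0 := by nlinarith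
      nlinarith
    have hu : Real.exp u = 1 := by
      rw [hc1] at hr
      linarith
    have hu0 : u = 0 := by simpa using hu
    rw [hu0, hc1] at h
    simp at h
  have e3 : ((Real.sinh u / (Real.cosh u + Real.cos v) : ℝ) : ℂ) -
        ((Real.sin v / (Real.cosh u + Real.cos v) : ℝ) : ℂ) * Complex.I =
      ((Real.sinh u : ℂ) - Real.sin v * Complex.I) / ((Real.cosh u : ℂ) + Real.cos v) := by
    rw [Complex.ofReal_div, Complex.ofReal_div, Complex.ofReal_add]
    ring
  rw [e3, div_eq_div_iff hne h', e, hch, hsh]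
  linear_combination ((Real.cos v : ℂ) - Real.sin v * Complex.I) * hE + (Real.exp u : ℂ) * hcs -
    (Real.exp u : ℂ) * (Real.sin v : ℂ) ^ 2 * Complex.I_sq
end LowerBound

/-! ### The test function and the asymptotics of C_N. -/

section Asymptotics

variable {c : ℂ} {θ α : ℝ}

theorem exists_boundary_function (hα : 0 < α) (hα2 : α ≤ Real.pi / 2) {r : RatFunc ℂ}
    (hr : ∀ z ∈ sector c θ α, ‖r.eval (RingHom.id ℂ) z‖ ≤ 1) :
    ∃ f : frontier (sector c θ α) →ᵇ ℂ,
      ∀ z : frontier (sector c θ α), f z = r.eval (RingHom.id ℂ) z := by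
  have h := fun z : frontier (sector c θ α) =>
    ratFunc_denom_ne_zero_and_norm_eval_le (isOpen_sector hα hα2) hr (frontier_subset_closure z.2)
  refine ⟨BoundedContinuousFunction.ofNormedAddCommGroup
    (fun z : frontier (sector c θ α) => r.eval (RingHom.id ℂ) z) ?_ 1 fun z => (h z).2,
    fun z => rfl⟩
  rw [continuous_iff_continuousAt]
  intro z
  exact (differentiableAt_ratFunc_eval (h z).1).continuousAt.comp
    (f := fun z : frontier (sector c θ α) => (z : ℂ)) continuous_subtype_val.continuousAt

theorem exists_solution (hα : 0 < α) (hα2 : α ≤ Real.pi / 2) {r : RatFunc ℂ}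
    (hr : ∀ z ∈ sector c θ α, ‖r.eval (RingHom.id ℂ) z‖ ≤ 1) :
    ∃ f h : frontier (sector c θ α) →ᵇ ℂ,
      (∀ z : frontier (sector c θ α), f z = r.eval (RingHom.id ℂ) z) ∧
      h + doubleLayerOperator c θ hα hα2 h = f ∧
      ENNReal.ofReal (2 * ‖h‖) ≤ constN (sector c θ α) := by
  obtain ⟨f, hf⟩ := exists_boundary_function hα hα2 hr
  obtain ⟨h, hh, -⟩ := existsUnique_add_doubleLayerOperator hα hα2 f
  exact ⟨f, h, hf, hh, le_sSup ⟨r, f, h, hr, hf, (isDoubleLayer_sub_iff hα hα2 f h).2 hh, rfl⟩⟩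

/-- The fraction p/q need not be reduced, but the reduced denominator divides q and so does not
vanish at z either. -/
theorem ratFunc_eval_div {p q : Polynomial ℂ} {z : ℂ} (hq : q.eval z ≠ 0) :
    (algebraMap (Polynomial ℂ) (RatFunc ℂ) p / algebraMap (Polynomial ℂ) (RatFunc ℂ) q).eval
      (RingHom.id ℂ) z = p.eval z / q.eval z := by
  have hq0 : q ≠ 0 := by
    rintro rfl
    simp at hq
  set r := algebraMap (Polynomial ℂ) (RatFunc ℂ) p / algebraMap (Polynomial ℂ) (RatFunc ℂ) q with hr
  have hd : r.denom.eval z ≠ 0 := by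
    obtain ⟨s, hs⟩ := RatFunc.denom_div_dvd p q
    intro h0
    rw [hs, Polynomial.eval_mul, h0, zero_mul] at hq
    exact hq rfl
  have hmul : r.num * q = p * r.denom := (RatFunc.num_mul_eq_mul_denom_iff hq0).2 hr
  have := congrArg (Polynomial.eval z) hmul
  rw [Polynomial.eval_mul, Polynomial.eval_mul] at this
  rw [ratFunc_eval_eq, div_eq_div_iff hd hq, this]

/-- The power map of the sector followed by a Cayley transform. -/
noncomputable def cayleyPower (c : ℂ) (θ : ℝ) (N : ℕ) : RatFunc ℂ :=
  algebraMap (Polynomial ℂ) (RatFunc ℂ)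
    ((Polynomial.C (Complex.exp (-(θ * Complex.I))) * (Polynomial.X - Polynomial.C c)) ^ N - 1) /
  algebraMap (Polynomial ℂ) (RatFunc ℂ)
    ((Polynomial.C (Complex.exp (-(θ * Complex.I))) * (Polynomial.X - Polynomial.C c)) ^ N + 1)

theorem cayleyPower_eval {N : ℕ} {z W : ℂ}
    (hW : W = (Complex.exp (-(θ * Complex.I)) * (z - c)) ^ N) (h : W + 1 ≠ 0) :
    (cayleyPower c θ N).eval (RingHom.id ℂ) z = (W - 1) / (W + 1) := by
  rw [cayleyPower, ratFunc_eval_div]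
  · simp [hW]
  · simpa [hW] using h

theorem exp_neg_mul_rayPoint_sub_pow (ϑ t : ℝ) (N : ℕ) :
    (Complex.exp (-(θ * Complex.I)) * (rayPoint c (θ + ϑ) t - c)) ^ N =
      (t ^ N : ℝ) * Complex.exp ((N * ϑ : ℝ) * Complex.I) := by
  have : Complex.exp (-(θ * Complex.I)) * (rayPoint c (θ + ϑ) t - c) =
      t * Complex.exp (ϑ * Complex.I) := by
    rw [rayPoint, add_sub_cancel_left, mul_left_comm, ← Complex.exp_add]
    congr 2
    push_cast
    ring
  rw [this, mul_pow, ← Complex.exp_nat_mul]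
  push_cast
  ring_nf

theorem add_one_ne_zero_of_re_nonneg {W : ℂ} (h : 0 ≤ W.re) : W + 1 ≠ 0 := by
  intro h0
  have := congrArg Complex.re h0
  simp at this
  linarith

theorem norm_cayley_le_one {W : ℂ} (h : 0 ≤ W.re) : ‖(W - 1) / (W + 1)‖ ≤ 1 := by
  rw [norm_div, div_le_one (norm_pos_iff.2 (add_one_ne_zero_of_re_nonneg h)),
    ← abs_norm, ← abs_norm (W + 1), ← sq_le_sq, ← Complex.normSq_eq_norm_sq,
    ← Complex.normSq_eq_norm_sq, Complex.normSq_apply, Complex.normSq_apply]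
  simp
  nlinarith

theorem re_pow_nonneg {N : ℕ} (hN : N * α ≤ Real.pi / 2) {ϑ t : ℝ}
    (h1 : -α ≤ ϑ) (h2 : ϑ ≤ α) (ht : 0 ≤ t) :
    0 ≤ ((t ^ N : ℝ) * Complex.exp ((N * ϑ : ℝ) * Complex.I)).re := by
  rw [Complex.re_ofReal_mul, Complex.exp_ofReal_mul_I_re]
  refine mul_nonneg (by positivity) (Real.cos_nonneg_of_mem_Icc ⟨?_, ?_⟩) <;> nlinarith

theorem exists_eq_rayPoint_of_mem_sector {z : ℂ} (hz : z ∈ sector c θ α) :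
    z = rayPoint c (θ + Complex.arg ((z - c) * Complex.exp (-(θ * Complex.I)))) ‖z - c‖ ∧
      0 < ‖z - c‖ := by
  refine ⟨?_, norm_pos_iff.2 (sub_ne_zero.2 hz.1)⟩
  set ζ := (z - c) * Complex.exp (-(θ * Complex.I)) with hζ
  have hn : ‖z - c‖ = ‖ζ‖ := by
    have : -(θ * Complex.I) = ((-θ : ℝ) : ℂ) * Complex.I := by push_cast; ring
    rw [hζ, norm_mul, this, Complex.norm_exp_ofReal_mul_I, mul_one]
  have e : Complex.exp ((θ + Complex.arg ζ : ℝ) * Complex.I) =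
      Complex.exp (Complex.arg ζ * Complex.I) * Complex.exp (θ * Complex.I) := by
    rw [← Complex.exp_add]
    congr 1
    push_cast
    ring
  rw [rayPoint, e, ← mul_assoc, hn, Complex.norm_mul_exp_arg_mul_I, hζ, mul_assoc,
    ← Complex.exp_add]
  simp

/-- When Nα ≤ π/2, the N-th power maps the sector into the closed right half-plane, which the Cayley
transform maps into the closed unit disc. -/
theorem norm_cayleyPower_eval_le {N : ℕ} (hN : N * α ≤ Real.pi / 2) {z : ℂ}
    (hz : z ∈ sector c θ α) : ‖(cayleyPower c θ N).eval (RingHom.id ℂ) z‖ ≤ 1 := by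
  obtain ⟨h1, h2⟩ := exists_eq_rayPoint_of_mem_sector hz
  have h3 := abs_lt.1 hz.2
  have hre := re_pow_nonneg hN h3.1.le h3.2.le h2.le
  rw [← exp_neg_mul_rayPoint_sub_pow (c := c) (θ := θ), ← h1] at hre
  rw [cayleyPower_eval rfl (add_one_ne_zero_of_re_nonneg hre)]
  exact norm_cayley_le_one hre

/-- The imaginary part of the integrand for the extremal example, up to sign. -/
noncomputable def exampleIntegrand (α : ℝ) (N : ℕ) (y : ℝ) : ℝ :=
  1 / (4 * (Real.pi - α)) *
    Real.sin (Real.pi / (4 * (Real.pi - α)) * (2 * (Real.pi - 2 * α))) /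
    (Real.cosh (Real.pi / (4 * (Real.pi - α)) * y) *
      (Real.sinh (Real.pi / (4 * (Real.pi - α)) * y) ^ 2 +
        Real.cos (Real.pi / (4 * (Real.pi - α)) * (2 * (Real.pi - 2 * α))) ^ 2)) *
    (Real.sin (Real.pi / (4 * (Real.pi - α)) * (2 * (Real.pi - 2 * α))) *
      (Real.sinh (Real.pi / (4 * (Real.pi - α)) * y) *
        (Real.sinh (N * y) / (Real.cosh (N * y) + Real.cos (N * α)))) +
      Real.cosh (Real.pi / (4 * (Real.pi - α)) * y) *
        Real.cos (Real.pi / (4 * (Real.pi - α)) * (2 * (Real.pi - 2 * α))) *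
        (Real.sin (N * α) / (Real.cosh (N * y) + Real.cos (N * α))))

theorem exampleIntegrand_neg (α : ℝ) (N : ℕ) (y : ℝ) :
    exampleIntegrand α N (-y) = exampleIntegrand α N y := by
  simp only [exampleIntegrand, mul_neg, Real.sinh_neg, Real.cosh_neg, neg_div, neg_mul, neg_neg,
    even_two, Even.neg_pow]

theorem exampleIntegrand_abs (α : ℝ) (N : ℕ) (y : ℝ) :
    exampleIntegrand α N |y| = exampleIntegrand α N y := by
  rcases abs_choice y with h | h <;> rw [h]
  exact exampleIntegrand_neg α N y

theorem cosh_add_cos_pos {N : ℕ} (hα : 0 < α) (hN : N * α ≤ Real.pi / 2) (u : ℝ) :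
    0 < Real.cosh u + Real.cos (N * α) := by
  have h1 := Real.one_le_cosh u
  have hpi := Real.pi_pos
  have h2 : 0 ≤ Real.cos (N * α) := Real.cos_nonneg_of_mem_Icc ⟨by
    have : 0 ≤ N * α := by positivity
    linarith, hN⟩
  linarith

theorem exampleIntegrand_nonneg {N : ℕ} (hα : 0 < α) (hα2 : α ≤ Real.pi / 2)
    (hN : N * α ≤ Real.pi / 2) {y : ℝ} (hy : 0 ≤ y) : 0 ≤ exampleIntegrand α N y := by
  have hpi := Real.pi_pos
  have hb : 0 < Real.pi - α := by linarith
  obtain ⟨p1, p2⟩ := phase_bounds hα hα2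
  have h1 := cosh_add_cos_pos hα hN (N * y)
  have hs : 0 ≤ Real.sin (Real.pi / (4 * (Real.pi - α)) * (2 * (Real.pi - 2 * α))) :=
    Real.sin_nonneg_of_nonneg_of_le_pi p1 (by linarith)
  have hp : 0 ≤ Real.cos (Real.pi / (4 * (Real.pi - α)) * (2 * (Real.pi - 2 * α))) :=
    Real.cos_nonneg_of_mem_Icc ⟨by linarith, p2.le⟩
  have hv : 0 ≤ Real.sin (N * α) :=
    Real.sin_nonneg_of_nonneg_of_le_pi (by positivity) (by linarith)
  have hS : 0 ≤ Real.sinh (Real.pi / (4 * (Real.pi - α)) * y) :=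
    Real.sinh_nonneg_iff.2 (by positivity)
  have hS' : 0 ≤ Real.sinh (N * y) := Real.sinh_nonneg_iff.2 (by positivity)
  have hC := Real.cosh_pos (Real.pi / (4 * (Real.pi - α)) * y)
  unfold exampleIntegrand
  positivity

/-- For 2α ≤ y ≤ 1 the real part of the test function is nearly 1, as Ny is large compared with y/α,
up to a constant factor, and the integrand behaves like 1/(πy). The term with sin(Nα) is nonnegative
and is dropped. -/
theorem le_exampleIntegrand {N : ℕ} (hα : 0 < α) (hα4 : α ≤ 1 / 4) (hN : N * α ≤ Real.pi / 2)
    (hN2 : 1 / (2 * α) ≤ N) {y : ℝ} (hy : 2 * α ≤ y) (hy1 : y ≤ 1) :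
    1 / Real.pi * (1 / y - 7 * α / y ^ 2 - y) ≤ exampleIntegrand α N y := by
  have hpi := Real.pi_pos
  have hpi3 := Real.pi_gt_three
  have hα2 : α ≤ Real.pi / 2 := by linarith
  have hb : 0 < Real.pi - α := by linarith
  have hy0 : 0 < y := by linarith
  have hN0 : (0 : ℝ) < N := lt_of_lt_of_le (by positivity) hN2
  obtain ⟨p1, p2⟩ := phase_bounds hα hα2
  have hph := phase_eq (α := α) hα2
  have hl := scale_le_half (α := α) hα2
  have h1 := cosh_add_cos_pos hα hN (N * y)
  have hl0 : 0 < Real.pi / (4 * (Real.pi - α)) := by positivity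
  have hl4 : 1 / (4 * (Real.pi - α)) = 1 / Real.pi * (Real.pi / (4 * (Real.pi - α))) := by
    field_simp
  unfold exampleIntegrand
  rw [hl4]
  set l := Real.pi / (4 * (Real.pi - α)) with hldef
  set s := Real.sin (l * (2 * (Real.pi - 2 * α))) with hs
  set p := Real.cos (l * (2 * (Real.pi - 2 * α))) with hp
  have hp0 : 0 ≤ p := Real.cos_nonneg_of_mem_Icc ⟨by linarith, p2.le⟩
  have hs0 : 0 ≤ s := Real.sin_nonneg_of_nonneg_of_le_pi p1 (by linarith)
  have hpl : p ≤ 2 * l * α := by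
    rw [hp, hph, Real.cos_pi_div_two_sub]
    exact Real.sin_le (by positivity)
  have hq0 : 0 ≤ Real.cos (N * α) := Real.cos_nonneg_of_mem_Icc ⟨by
    have : 0 ≤ N * α := by positivity
    linarith, hN⟩
  have hS'0 : 0 < Real.sinh (N * y) := Real.sinh_pos_iff.2 (by positivity)
  have hT := one_sub_two_div_le_sinh_div (u := N * y) (by positivity) hq0 (Real.cos_le_one _)
  set T := Real.sinh (N * y) / (Real.cosh (N * y) + Real.cos (N * α)) with hTdef
  have hT0 : 0 ≤ T := by positivity
  have hT1 : T ≤ 1 := by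
    rw [hTdef, div_le_one h1]
    linarith [Real.sinh_lt_cosh (N * y)]
  have hT2 : 1 - 4 * α / y ≤ T := by
    refine le_trans ?_ hT
    have : 2 / (N * y) ≤ 4 * α / y := by
      rw [div_le_div_iff₀ (by positivity) hy0]
      rw [div_le_iff₀ (by positivity)] at hN2
      nlinarith
    linarith
  have hmain := lower_bound_elementary (s := s) hα hl0 hl hy hy1 rfl rfl
    (Real.sin_sq_add_cos_sq _) hp0 hpl hT1 hT0 hT2
  set S := Real.sinh (l * y) with hS
  set C := Real.cosh (l * y) with hC
  have hC0 : 0 < C := Real.cosh_pos _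
  have hS0 : 0 < S := Real.sinh_pos_iff.2 (by positivity)
  have hv : 0 ≤ Real.sin (N * α) :=
    Real.sin_nonneg_of_nonneg_of_le_pi (by positivity) (by linarith)
  have hb0 : 0 ≤ C * p * (Real.sin (N * α) / (Real.cosh (N * y) + Real.cos (N * α))) := by
    positivity
  have hA : 0 ≤ 1 / Real.pi * l * s / (C * (S ^ 2 + p ^ 2)) := by positivity
  calc 1 / Real.pi * (1 / y - 7 * α / y ^ 2 - y)
      ≤ 1 / Real.pi * (l * (s ^ 2 * S * T / (C * (S ^ 2 + p ^ 2)))) :=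
        mul_le_mul_of_nonneg_left hmain (by positivity)
    _ = 1 / Real.pi * l * s / (C * (S ^ 2 + p ^ 2)) * (s * (S * T)) := by
        rw [div_mul_eq_mul_div, ← mul_assoc, ← mul_div_assoc]
        ring
    _ ≤ _ := mul_le_mul_of_nonneg_left (by linarith) hA

/-- The primitive is log y + 7α/y - y²/2. The 4 is 7/2, from the middle term at y = 2α, plus 1/2,
from the last one at y = 1. -/
theorem integral_lower_bound (hα : 0 < α) (hα4 : α ≤ 1 / 4) :
    Real.log (1 / α) - Real.log 2 - 4 ≤ ∫ y in (2 * α)..1, (1 / y - 7 * α / y ^ 2 - y) := by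
  have hmem : ∀ y ∈ Set.uIcc (2 * α) 1, 0 < y := by
    intro y hy
    rw [Set.uIcc_of_le (by linarith)] at hy
    linarith [hy.1]
  have hd : ∀ y ∈ Set.uIcc (2 * α) 1, HasDerivAt (fun y => Real.log y + 7 * α * y⁻¹ - y ^ 2 / 2)
      (1 / y - 7 * α / y ^ 2 - y) y := by
    intro y hy
    have hy0 := (hmem y hy).ne'
    have := ((Real.hasDerivAt_log hy0).add ((hasDerivAt_inv hy0).const_mul (7 * α))).sub
      ((hasDerivAt_pow 2 y).div_const 2)
    convert! this using 1
    simp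
    ring
  have hc : ContinuousOn (fun y : ℝ => 1 / y - 7 * α / y ^ 2 - y) (Set.uIcc (2 * α) 1) := by
    refine ((continuousOn_const.div continuousOn_id fun y hy => (hmem y hy).ne').sub
      (continuousOn_const.div (continuousOn_id.pow 2) fun y hy => ?_)).sub continuousOn_id
    exact pow_ne_zero 2 (hmem y hy).ne'
  rw [intervalIntegral.integral_eq_sub_of_hasDerivAt hd hc.intervalIntegrable, Real.log_one,
    Real.log_mul two_ne_zero hα.ne', one_div, Real.log_inv]
  have : 7 * α * (2 * α)⁻¹ = 7 / 2 := by field_simp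
  rw [this]
  nlinarith

/-- The integrand is even and nonnegative on the positive half-line. Evenness doubles the constant
1/π, and only the range 2α ≤ y ≤ 1 is kept. -/
theorem lower_bound_integral_exampleIntegrand {N : ℕ} (hα : 0 < α) (hα4 : α ≤ 1 / 4)
    (hN : N * α ≤ Real.pi / 2) (hN2 : 1 / (2 * α) ≤ N) (hi : Integrable (exampleIntegrand α N)) :
    2 / Real.pi * (Real.log (1 / α) - Real.log 2 - 4) ≤ ∫ y, exampleIntegrand α N y := by
  have hpi := Real.pi_pos
  have hpi3 := Real.pi_gt_three
  have e : ∫ y, exampleIntegrand α N y = 2 * ∫ y in Set.Ioi 0, exampleIntegrand α N y := by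
    rw [← integral_comp_abs]
    simp only [exampleIntegrand_abs]
  have h1 : ∫ y in Set.Ioc (2 * α) 1, exampleIntegrand α N y ≤
      ∫ y in Set.Ioi 0, exampleIntegrand α N y := by
    refine setIntegral_mono_set hi.integrableOn ?_ ?_
    · filter_upwards [ae_restrict_mem measurableSet_Ioi] with y hy
      exact exampleIntegrand_nonneg hα (by linarith) hN (le_of_lt hy)
    · refine Filter.Eventually.of_forall fun y hy => ?_
      have : 2 * α < y := hy.1
      exact lt_trans (by linarith) this
  have h2 : ∫ y in (2 * α)..1, 1 / Real.pi * (1 / y - 7 * α / y ^ 2 - y) ≤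
      ∫ y in (2 * α)..1, exampleIntegrand α N y := by
    refine intervalIntegral.integral_mono_on (by linarith) ?_ hi.intervalIntegrable
      fun y hy => le_exampleIntegrand hα hα4 hN hN2 hy.1 hy.2
    refine ContinuousOn.intervalIntegrable ?_
    have hmem : ∀ y ∈ Set.uIcc (2 * α) 1, y ≠ 0 := by
      intro y hy
      rw [Set.uIcc_of_le (by linarith)] at hy
      linarith [hy.1]
    exact continuousOn_const.mul (((continuousOn_const.div continuousOn_id hmem).sub
      (continuousOn_const.div (continuousOn_id.pow 2) fun y hy => pow_ne_zero 2 (hmem y hy))).sub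
      continuousOn_id)
  rw [intervalIntegral.integral_const_mul] at h2
  rw [intervalIntegral.integral_of_le (b := 1) (f := exampleIntegrand α N) (by linarith)] at h2
  have h3 := integral_lower_bound hα hα4
  have h4 := mul_le_mul_of_nonneg_left h3 (by positivity : 0 ≤ 1 / Real.pi)
  rw [e]
  have : 2 / Real.pi = 2 * (1 / Real.pi) := by ring
  rw [this, mul_assoc]
  linarith

theorem neg_im_sectorKernel_mul {N : ℕ} (hα : 0 < α) (hα2 : α ≤ Real.pi / 2)
    (hN : N * α ≤ Real.pi / 2) (y : ℝ) :
    -(sectorKernel α y * (cayleyPower c θ N).eval (RingHom.id ℂ)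
      (rayPoint c (θ + -1 * α) (1 * Real.exp y))).im = exampleIntegrand α N y := by
  have hre := re_pow_nonneg hN (ϑ := -1 * α) (t := 1 * Real.exp y) (by linarith) (by linarith)
    (by positivity)
  have e1 : (((1 * Real.exp y) ^ N : ℝ) : ℂ) * Complex.exp ((N * (-1 * α) : ℝ) * Complex.I) =
      Complex.exp ((N * y : ℝ) - (N * α : ℝ) * Complex.I) := by
    rw [one_mul, ← Real.exp_nat_mul, Complex.ofReal_exp, ← Complex.exp_add]
    congr 1
    push_cast
    ring
  have hW := exp_neg_mul_rayPoint_sub_pow (c := c) (θ := θ) (-1 * α) (1 * Real.exp y) N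
  rw [cayleyPower_eval hW.symm (add_one_ne_zero_of_re_nonneg hre), e1,
    exp_sub_one_div_exp_add_one _ _ (cosh_add_cos_pos hα hN _),
    (sectorKernel_ofReal hα hα2 y rfl rfl rfl rfl).2, mul_assoc, Complex.im_ofReal_mul,
    exampleIntegrand]
  simp only [Complex.mul_im, Complex.sub_re, Complex.sub_im, Complex.ofReal_re, Complex.ofReal_im,
    Complex.mul_re, Complex.I_re, Complex.I_im]
  ring

theorem constN_sector_ge (hα : 0 < α) (hα4 : α ≤ 1 / 4) :
    ENNReal.ofReal (2 / Real.pi * (Real.log (1 / α) - Real.log 2 - 4) - 2) ≤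
      constN (sector c θ α) := by
  have hpi := Real.pi_pos
  have hpi3 := Real.pi_gt_three
  have hα2 : α ≤ Real.pi / 2 := by linarith
  -- The largest power that keeps the image of the sector in the right half-plane. The assumption α
  -- ≤ 1/4 leaves room for the rounding, so that N ≥ 1/(2α).
  set N := ⌊Real.pi / (2 * α)⌋₊ with hNdef
  have hN : N * α ≤ Real.pi / 2 := by
    have := Nat.floor_le (by positivity : 0 ≤ Real.pi / (2 * α))
    rw [le_div_iff₀ (by positivity)] at this
    linarith
  have hN2 : 1 / (2 * α) ≤ N := by
    have h1 := (Nat.lt_floor_add_one (Real.pi / (2 * α))).le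
    have h2 : 1 / (2 * α) + 1 ≤ Real.pi / (2 * α) := by
      rw [← sub_nonneg]
      have : Real.pi / (2 * α) - (1 / (2 * α) + 1) = (Real.pi - 1 - 2 * α) / (2 * α) := by
        field_simp
        ring
      rw [this]
      exact div_nonneg (by linarith) (by positivity)
    linarith
  obtain ⟨f, h, hf, hh, hle⟩ := exists_solution (c := c) (θ := θ) (r := cayleyPower c θ N) hα hα2
    fun z hz => norm_cayleyPower_eval_le hN hz
  refine (ENNReal.ofReal_le_ofReal ?_).trans hle
  have hr : ∀ z ∈ sector c θ α, ‖(cayleyPower c θ N).eval (RingHom.id ℂ) z‖ ≤ 1 :=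
    fun z hz => norm_cayleyPower_eval_le hN hz
  have hsol := solution_sidePoint hα hα2 hr hf hh (Or.inl rfl) (t := 1) zero_le_one
  have hf1 := (f.norm_coe_le_norm (sidePoint c θ hα hα2 (Or.inl rfl) 1)).trans
    (norm_le_one_of_eq_eval hα hα2 hr hf)
  have hh1 := h.norm_coe_le_norm (sidePoint c θ hα hα2 (Or.inl rfl) 1)
  have hint : Integrable fun y : ℝ => sectorKernel α y *
      f (sidePoint c θ hα hα2 (neg_sign (Or.inl rfl)) (1 * Real.exp y)) :=
    (integrable_sectorKernel hα hα2).mul_bdd (c := ‖f‖)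
      ((f.continuous.comp (continuous_sidePoint hα hα2 _)).comp
        (by fun_prop : Continuous fun y : ℝ => 1 * Real.exp y)).aestronglyMeasurable
      (Filter.Eventually.of_forall fun _ => f.norm_coe_le_norm _)
  have hex : ∀ y : ℝ, -(sectorKernel α y *
      f (sidePoint c θ hα hα2 (neg_sign (Or.inl rfl)) (1 * Real.exp y))).im =
      exampleIntegrand α N y := by
    intro y
    rw [hf, coe_sidePoint hα hα2 _ (by positivity), neg_im_sectorKernel_mul hα hα2 hN]
  have hi : Integrable (exampleIntegrand α N) :=
    hint.im.neg.congr (Filter.Eventually.of_forall hex)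
  have him : -(oppositeIntegral hα hα2 f (Or.inl rfl) 1).im = ∫ y, exampleIntegrand α N y := by
    simp only [oppositeIntegral, one_mul (_ : ℝ)]
    simp only [← hex, integral_neg, one_mul (Real.exp _)]
    congr 1
    simp only [one_mul (Real.exp _)] at hint
    exact (Complex.imCLM.integral_comp_comm hint).symm
  have hlow := lower_bound_integral_exampleIntegrand hα hα4 hN hN2 hi
  rw [← him] at hlow
  have habs := (neg_le_abs _).trans
    (Complex.abs_im_le_norm (oppositeIntegral hα hα2 f (Or.inl rfl) 1))
  -- Half of the opposite integral is f - h at the chosen point; hence 2‖h‖ is at least the opposite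
  -- integral minus 2.
  have hopp : ‖(1 / 2 : ℂ) * oppositeIntegral hα hα2 f (Or.inl rfl) 1‖ ≤ 1 + ‖h‖ := by
    have e : (1 / 2 : ℂ) * oppositeIntegral hα hα2 f (Or.inl rfl) 1 =
        f (sidePoint c θ hα hα2 (Or.inl rfl) 1) - h (sidePoint c θ hα hα2 (Or.inl rfl) 1) := by
      rw [hsol]
      ring
    rw [e]
    exact (norm_sub_le _ _).trans (add_le_add hf1 hh1)
  rw [norm_mul] at hopp
  have e : ‖(1 / 2 : ℂ)‖ = 1 / 2 := by norm_num
  rw [e] at hopp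
  linarith

/-- This is tan x ≥ x, together with απ/(4(π - α)) ≥ α/4. -/
theorem neg_log_tan_le (hα : 0 < α) (hα2 : α ≤ Real.pi / 2) :
    -Real.log (Real.tan (α * Real.pi / (4 * (Real.pi - α)))) ≤ Real.log (1 / α) + Real.log 4 := by
  have hpi := Real.pi_pos
  have hb : 0 < Real.pi - α := by linarith
  have h1 : α / 4 ≤ α * Real.pi / (4 * (Real.pi - α)) := by
    rw [div_le_div_iff₀ (by norm_num) (by positivity)]
    nlinarith
  have h2 : α * Real.pi / (4 * (Real.pi - α)) < Real.pi / 2 := by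
    rw [div_lt_div_iff₀ (by positivity) two_pos]
    nlinarith
  have h3 := Real.le_tan (by linarith) h2
  have h4 : Real.log (α / 4) ≤ Real.log (Real.tan (α * Real.pi / (4 * (Real.pi - α)))) :=
    Real.log_le_log (by positivity) (h1.trans h3)
  rw [Real.log_div hα.ne' (by norm_num)] at h4
  rw [one_div, Real.log_inv]
  linarith

theorem exists_asymptotic_bound : ∃ K : ℝ, ∀ (c : ℂ) (θ α : ℝ), 0 < α → α ≤ Real.pi / 2 →
    |(constN (sector c θ α)).toReal - 2 / Real.pi * Real.log (1 / α)| ≤ K := by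
  have hpi := Real.pi_pos
  have hpi3 := Real.pi_gt_three
  refine ⟨2 + 2 / Real.pi * (Real.log 4 + Real.log 2 + 4), fun c θ α hα hα2 => ?_⟩
  have hup := constN_sector_le (c := c) (θ := θ) hα hα2
  have htan := neg_log_tan_le hα hα2
  have hpp : 0 < 2 / Real.pi := by positivity
  have hl2 : 0 < Real.log 2 := Real.log_pos (by norm_num)
  have hl4 : 0 < Real.log 4 := Real.log_pos (by norm_num)
  have hmono : ∀ {a b : ℝ}, a ≤ b → 2 / Real.pi * a ≤ 2 / Real.pi * b := fun h =>
    mul_le_mul_of_nonneg_left h hpp.le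
  have hnonneg : 0 ≤ 2 - 2 / Real.pi * Real.log (Real.tan (α * Real.pi / (4 * (Real.pi - α)))) := by
    have h1 := integral_norm_sectorKernel hα hα2
    have h2 : 0 ≤ ∫ x : ℝ, ‖sectorKernel α x‖ := integral_nonneg fun _ => norm_nonneg _
    linarith
  have hup' := ENNReal.toReal_le_of_le_ofReal hnonneg hup
  have h0 : 0 ≤ (constN (sector c θ α)).toReal := ENNReal.toReal_nonneg
  have hfin : constN (sector c θ α) ≠ ⊤ := ne_top_of_le_ne_top ENNReal.ofReal_ne_top hup
  rw [abs_le]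
  constructor
  · rcases le_total α (1 / 4) with h | h
    · have hlow := constN_sector_ge (c := c) (θ := θ) hα h
      have h3 := (ENNReal.ofReal_le_iff_le_toReal hfin).1 hlow
      have h5 : 0 ≤ 2 / Real.pi * Real.log 4 := by positivity
      linarith
    · have h3 : Real.log (1 / α) ≤ Real.log 4 := by
        refine Real.log_le_log (by positivity) ?_
        rw [div_le_iff₀ hα]
        linarith
      have h4 := hmono h3
      have h5 : 0 ≤ 2 / Real.pi * Real.log 2 := by positivity
      linarith
  · have h3 := hmono htan
    have h5 : 0 ≤ 2 / Real.pi * Real.log 2 := by positivity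
    linarith

end Asymptotics

/-! ### Resolvent integrals in a Banach algebra and transfer of identities from scalars. -/

section ResolventIntegrals

theorem ring_inverse_eq_of_mul_eq_one {𝒜 : Type*} [Ring 𝒜] {a b : 𝒜} (h1 : a * b = 1)
    (h2 : b * a = 1) : Ring.inverse a = b :=
  Ring.inverse_unit ⟨a, b, h1, h2⟩

variable {𝒜 : Type*} [NormedRing 𝒜] [NormedAlgebra ℂ 𝒜]

/-- The difference of the resolvents of `T` and of `0` at the point `b`. -/
noncomputable def resolventDiff (b : ℂ) (T : 𝒜) : 𝒜 :=
  Ring.inverse (algebraMap ℂ 𝒜 b - T) - algebraMap ℂ 𝒜 b⁻¹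

/-- Subtracting the resolvent of 0 gains a factor 1/b. The difference decays quadratically along the
unbounded boundary, where a single resolvent would not be integrable against a bounded density. -/
theorem resolventDiff_eq_mul {b : ℂ} (hb : b ≠ 0) {T : 𝒜} (hT : IsUnit (algebraMap ℂ 𝒜 b - T)) :
    resolventDiff b T = Ring.inverse (algebraMap ℂ 𝒜 b - T) * (b⁻¹ • T) := by
  have h1 := Ring.inverse_mul_cancel _ hT
  have h2 : b⁻¹ • T = 1 - (algebraMap ℂ 𝒜 b - T) * algebraMap ℂ 𝒜 b⁻¹ := by
    rw [sub_mul, ← map_mul, mul_inv_cancel₀ hb, map_one, ← Algebra.commutes, ← Algebra.smul_def]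
    abel
  rw [resolventDiff, h2, mul_sub, ← mul_assoc, h1, one_mul, mul_one]

/-- The Neumann series of the resolvent without its first term. -/
theorem hasSum_resolventDiff [CompleteSpace 𝒜] {b : ℂ} {T : 𝒜} (h : ‖T‖ < ‖b‖) :
    HasSum (fun n : ℕ => b⁻¹ ^ (n + 2) • T ^ (n + 1)) (resolventDiff b T) := by
  have hb : b ≠ 0 := norm_pos_iff.1 ((norm_nonneg _).trans_lt h)
  have hx : ‖b⁻¹ • T‖ < 1 := by
    rw [norm_smul, norm_inv, inv_mul_lt_one₀ (norm_pos_iff.2 hb)]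
    exact h
  have hu : IsUnit (1 - b⁻¹ • T) := isUnit_one_sub_of_norm_lt_one hx
  have e : algebraMap ℂ 𝒜 b - T = algebraMap ℂ 𝒜 b * (1 - b⁻¹ • T) := by
    rw [mul_sub, mul_one, ← Algebra.smul_def, smul_smul, mul_inv_cancel₀ hb, one_smul]
  have hmm : algebraMap ℂ 𝒜 b * algebraMap ℂ 𝒜 b⁻¹ = 1 := by
    rw [← map_mul, mul_inv_cancel₀ hb, map_one]
  have hinv : Ring.inverse (algebraMap ℂ 𝒜 b - T) =
      b⁻¹ • Ring.inverse (1 - b⁻¹ • T) := by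
    rw [Algebra.smul_def]
    apply ring_inverse_eq_of_mul_eq_one
    · rw [e, mul_assoc, ← mul_assoc (1 - b⁻¹ • T), ← Algebra.commutes, mul_assoc,
        Ring.mul_inverse_cancel _ hu, mul_one, hmm]
    · rw [e, mul_assoc, ← mul_assoc (Ring.inverse (1 - b⁻¹ • T)), ← Algebra.commutes b, mul_assoc,
        Ring.inverse_mul_cancel _ hu, mul_one, ← map_mul, inv_mul_cancel₀ hb, map_one]
  have hgeo := NormedRing.inverse_one_sub (b⁻¹ • T) hx
  have hsum : HasSum (fun n : ℕ => (b⁻¹ • T) ^ n) (Ring.inverse (1 - b⁻¹ • T)) := by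
    rw [← geom_series_eq_inverse _ hx]
    exact (summable_geometric_of_norm_lt_one hx).hasSum
  have hsum1 : HasSum (fun n : ℕ => (b⁻¹ • T) ^ (n + 1)) (Ring.inverse (1 - b⁻¹ • T) - 1) := by
    rw [hasSum_nat_add_iff 1]
    simpa using hsum
  have := hsum1.const_smul b⁻¹
  convert! this using 1
  · funext n
    rw [smul_pow, smul_smul]
    congr 1
    ring
  · rw [resolventDiff, hinv, smul_sub, Algebra.algebraMap_eq_smul_one]

/-- The coefficients of `Q * B - P`, where `B` is a power series. -/
noncomputable def productCoeff (P Q : Polynomial ℂ) (B : ℕ → ℂ) (n : ℕ) : ℂ :=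
  (∑ kl ∈ Finset.HasAntidiagonal.antidiagonal n, Q.coeff kl.1 * B kl.2) - P.coeff n

theorem hasSum_polynomial_aeval (P : Polynomial ℂ) (T : 𝒜) :
    HasSum (fun n => P.coeff n • T ^ n) (Polynomial.aeval T P) ∧
      Summable fun n => ‖P.coeff n • T ^ n‖ := by
  have hz : ∀ n ∉ Finset.range (P.natDegree + 1), P.coeff n • T ^ n = 0 := by
    intro n hn
    rw [Polynomial.coeff_eq_zero_of_natDegree_lt (by simpa [Nat.lt_succ_iff] using hn), zero_smul]
  constructor
  · rw [Polynomial.aeval_eq_sum_range]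
    exact hasSum_sum_of_ne_finset_zero hz
  · exact summable_of_ne_finset_zero (s := Finset.range (P.natDegree + 1)) fun n hn => by
      rw [hz n hn, norm_zero]

theorem hasSum_productCoeff [CompleteSpace 𝒜] (P Q : Polynomial ℂ) (B : ℕ → ℂ) {T S : 𝒜}
    (hB : HasSum (fun n => B n • T ^ n) S) (hBn : Summable fun n => ‖B n • T ^ n‖) :
    HasSum (fun n => productCoeff P Q B n • T ^ n)
      (Polynomial.aeval T Q * S - Polynomial.aeval T P) := by
  obtain ⟨hQ, hQn⟩ := hasSum_polynomial_aeval Q T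
  have hmul := tsum_mul_tsum_eq_tsum_sum_antidiagonal_of_summable_norm hQn hBn
  have hsum := (summable_norm_sum_mul_antidiagonal_of_summable_norm hQn hBn).of_norm
  rw [hQ.tsum_eq, hB.tsum_eq] at hmul
  have := hsum.hasSum
  rw [← hmul] at this
  convert! this.sub (hasSum_polynomial_aeval P T).1 using 1
  funext n
  rw [productCoeff, sub_smul, Finset.sum_smul]
  congr 1
  refine Finset.sum_congr rfl fun kl hkl => ?_
  rw [smul_mul_smul_comm, ← pow_add, Finset.HasAntidiagonal.mem_antidiagonal.1 hkl]

/-- Uniqueness of power series. It turns an identity for small scalars into one for coefficients,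
which holds in every Banach algebra. -/
theorem eq_zero_of_hasSum_zero {a : ℕ → ℂ} {ρ : ℝ} (hρ : 0 < ρ)
    (h : ∀ ζ : ℂ, ‖ζ‖ < ρ → HasSum (fun n => a n * ζ ^ n) 0) : a = 0 := by
  have hp : HasFPowerSeriesAt (fun _ : ℂ => (0 : ℂ)) (FormalMultilinearSeries.ofScalars ℂ a) 0 := by
    rw [hasFPowerSeriesAt_iff]
    filter_upwards [Metric.ball_mem_nhds (0 : ℂ) hρ] with ζ hζ
    have := h ζ (by simpa using hζ)
    simpa [FormalMultilinearSeries.coeff_ofScalars, mul_comm] using this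
  have h0 := hp.eq_zero
  funext n
  have := congrArg (fun p : FormalMultilinearSeries ℂ ℂ ℂ => p.coeff n) h0
  rw [FormalMultilinearSeries.coeff_ofScalars] at this
  exact this

variable {X : Type*} [TopologicalSpace X] [MeasurableSpace X]

/-- A density `w` with respect to `μ` on a curve parametrized by `b`, with the bounds that make its
resolvent integrals converge. -/
structure CauchyData (μ : Measure X) (b w : X → ℂ) (τ : X → ℝ) (κ W : ℝ) : Prop where
  continuous : Continuous b
  aestronglyMeasurable : AEStronglyMeasurable w μ
  norm_le : ∀ x, ‖w x‖ ≤ W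
  one_le : ∀ x, 1 ≤ τ x
  integrable : Integrable (fun x => (τ x)⁻¹ ^ 2) μ
  pos : 0 < κ
  le_norm : ∀ x, κ * τ x ≤ ‖b x‖

namespace CauchyData

variable {μ : Measure X} {b w : X → ℂ} {τ : X → ℝ} {κ W : ℝ}

theorem ne_zero (h : CauchyData μ b w τ κ W) (x : X) : b x ≠ 0 := by
  have := h.pos
  have := h.one_le x
  exact norm_pos_iff.1 (lt_of_lt_of_le (by positivity) (h.le_norm x))

theorem le_norm' (h : CauchyData μ b w τ κ W) (x : X) : κ ≤ ‖b x‖ :=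
  (le_mul_of_one_le_right h.pos.le (h.one_le x)).trans (h.le_norm x)

theorem norm_inv_le (h : CauchyData μ b w τ κ W) (x : X) : ‖(b x)⁻¹‖ ≤ κ⁻¹ * (τ x)⁻¹ := by
  have h1 := h.pos
  have h2 := h.one_le x
  rw [norm_inv, ← mul_inv]
  exact inv_anti₀ (by positivity) (h.le_norm x)

theorem norm_mul_inv_pow_le (h : CauchyData μ b w τ κ W) (n : ℕ) (x : X) :
    ‖w x * (b x)⁻¹ ^ (n + 2)‖ ≤ W * κ⁻¹ ^ (n + 2) * (τ x)⁻¹ ^ 2 := by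
  have h1 := h.pos
  have h2 := h.one_le x
  have hW := (norm_nonneg _).trans (h.norm_le x)
  rw [norm_mul, norm_pow, mul_assoc]
  refine mul_le_mul (h.norm_le x) ?_ (by positivity) hW
  calc ‖(b x)⁻¹‖ ^ (n + 2) ≤ (κ⁻¹ * (τ x)⁻¹) ^ (n + 2) :=
        pow_le_pow_left₀ (norm_nonneg _) (h.norm_inv_le x) _
    _ = κ⁻¹ ^ (n + 2) * ((τ x)⁻¹ ^ n * (τ x)⁻¹ ^ 2) := by rw [mul_pow, pow_add (τ x)⁻¹]
    _ ≤ κ⁻¹ ^ (n + 2) * (1 * (τ x)⁻¹ ^ 2) := by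
        have : (τ x)⁻¹ ^ n ≤ 1 := pow_le_one₀ (by positivity) (inv_le_one_of_one_le₀ h2)
        gcongr
    _ = _ := by rw [one_mul]

theorem continuous_inverse [CompleteSpace 𝒜] (h : CauchyData μ b w τ κ W) {T : 𝒜}
    (hu : ∀ x, IsUnit (algebraMap ℂ 𝒜 (b x) - T)) :
    Continuous fun x => Ring.inverse (algebraMap ℂ 𝒜 (b x) - T) := by
  rw [continuous_iff_continuousAt]
  intro x
  obtain ⟨v, hv⟩ := hu x
  have h1 := NormedRing.inverse_continuousAt v
  rw [hv] at h1
  exact ContinuousAt.comp (f := fun x => algebraMap ℂ 𝒜 (b x) - T) h1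
    (((continuous_algebraMap ℂ 𝒜).comp h.continuous).sub continuous_const).continuousAt

/-- The bound for the resolvent that makes the resolvent integral converge. -/
def ResolventBound (b : X → ℂ) (τ : X → ℝ) (C : ℝ) (T : 𝒜) : Prop :=
  ∀ x, IsUnit (algebraMap ℂ 𝒜 (b x) - T) ∧ ‖Ring.inverse (algebraMap ℂ 𝒜 (b x) - T)‖ ≤ C * (τ x)⁻¹

theorem norm_smul_resolventDiff_le (h : CauchyData μ b w τ κ W) {T : 𝒜} {C : ℝ}
    (hT : ResolventBound b τ C T) (x : X) :
    ‖w x • resolventDiff (b x) T‖ ≤ W * (C * κ⁻¹ * ‖T‖) * (τ x)⁻¹ ^ 2 := by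
  have hW := (norm_nonneg _).trans (h.norm_le x)
  rw [resolventDiff_eq_mul (h.ne_zero x) (hT x).1, norm_smul, mul_assoc]
  refine mul_le_mul (h.norm_le x) ((norm_mul_le _ _).trans ?_) (norm_nonneg _) hW
  rw [norm_smul]
  calc _ ≤ (C * (τ x)⁻¹) * (κ⁻¹ * (τ x)⁻¹ * ‖T‖) := by
        refine mul_le_mul (hT x).2 ?_ (by positivity) ((norm_nonneg _).trans (hT x).2)
        exact mul_le_mul_of_nonneg_right (h.norm_inv_le x) (norm_nonneg _)
    _ = _ := by ring

variable [OpensMeasurableSpace X]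

theorem aestronglyMeasurable_mul_inv_pow (h : CauchyData μ b w τ κ W) (n : ℕ) :
    AEStronglyMeasurable (fun x => w x * (b x)⁻¹ ^ (n + 2)) μ :=
  h.aestronglyMeasurable.mul ((h.continuous.inv₀ h.ne_zero).pow _).aestronglyMeasurable

theorem integrable_mul_inv_pow (h : CauchyData μ b w τ κ W) (n : ℕ) :
    Integrable (fun x => w x * (b x)⁻¹ ^ (n + 2)) μ :=
  (h.integrable.const_mul (W * κ⁻¹ ^ (n + 2))).mono' (h.aestronglyMeasurable_mul_inv_pow n)
    (Filter.Eventually.of_forall (h.norm_mul_inv_pow_le n))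

/-- The Taylor coefficients of the resolvent integral. -/
noncomputable def coeff (_ : CauchyData μ b w τ κ W) (r₀ : ℂ) : ℕ → ℂ
  | 0 => r₀
  | n + 1 => ∫ x, w x * (b x)⁻¹ ^ (n + 2) ∂μ

/-- Termwise integration of the Neumann series. The coefficients do not depend on the algebra, and
the sum converges because ‖T‖ < κ ≤ |b|. -/
theorem hasSum_coeff [CompleteSpace 𝒜] (h : CauchyData μ b w τ κ W) (r₀ : ℂ) {T : 𝒜}
    (hT : ‖T‖ < κ) :
    HasSum (fun n => h.coeff r₀ n • T ^ n)
      (algebraMap ℂ 𝒜 r₀ + ∫ x, w x • resolventDiff (b x) T ∂μ) ∧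
    Summable fun n => ‖h.coeff r₀ n • T ^ n‖ := by
  have hκ := h.pos
  set I : ℝ := ∫ x, (τ x)⁻¹ ^ 2 ∂μ with hI
  have hint : ∀ n : ℕ, Integrable (fun x => w x • ((b x)⁻¹ ^ (n + 2) • T ^ (n + 1))) μ := by
    intro n
    simp only [smul_smul]
    exact (h.integrable_mul_inv_pow n).smul_const _
  have hgeo : Summable fun n : ℕ => W * κ⁻¹ ^ 2 * I * ‖T‖ * (κ⁻¹ * ‖T‖) ^ n := by
    refine (summable_geometric_of_lt_one (by positivity) ?_).mul_left _
    rw [inv_mul_lt_one₀ hκ]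
    exact hT
  have hTn : ∀ n : ℕ, ‖T ^ (n + 1)‖ ≤ ‖T‖ ^ (n + 1) := fun n => norm_pow_le' T (Nat.succ_pos n)
  have hb : ∀ n : ℕ, ∫ x, ‖w x • ((b x)⁻¹ ^ (n + 2) • T ^ (n + 1))‖ ∂μ ≤
      W * κ⁻¹ ^ 2 * I * ‖T‖ * (κ⁻¹ * ‖T‖) ^ n := by
    intro n
    have e : W * κ⁻¹ ^ 2 * I * ‖T‖ * (κ⁻¹ * ‖T‖) ^ n =
        ∫ x, W * κ⁻¹ ^ (n + 2) * (τ x)⁻¹ ^ 2 * ‖T‖ ^ (n + 1) ∂μ := by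
      rw [integral_mul_const, integral_const_mul, ← hI, mul_pow, pow_succ ‖T‖ n, pow_add κ⁻¹]
      ring
    rw [e]
    refine integral_mono (hint n).norm ((h.integrable.const_mul _).mul_const _) fun x => ?_
    simp only [smul_smul]
    rw [norm_smul]
    exact mul_le_mul (h.norm_mul_inv_pow_le n x) (hTn n) (norm_nonneg _)
      ((norm_nonneg _).trans (h.norm_mul_inv_pow_le n x))
  have hsn : Summable fun n : ℕ => ∫ x, ‖w x • ((b x)⁻¹ ^ (n + 2) • T ^ (n + 1))‖ ∂μ :=
    hgeo.of_nonneg_of_le (fun n => integral_nonneg fun _ => norm_nonneg _) hb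
  have hmain := hasSum_integral_of_summable_integral_norm hint hsn
  have hpt : ∀ x, ∑' n : ℕ, w x • ((b x)⁻¹ ^ (n + 2) • T ^ (n + 1)) =
      w x • resolventDiff (b x) T := fun x =>
    ((hasSum_resolventDiff (hT.trans_le (h.le_norm' x))).const_smul (w x)).tsum_eq
  simp only [hpt] at hmain
  have hco : ∀ n : ℕ, ∫ x, w x • ((b x)⁻¹ ^ (n + 2) • T ^ (n + 1)) ∂μ =
      h.coeff r₀ (n + 1) • T ^ (n + 1) := by
    intro n
    simp only [smul_smul]
    rw [integral_smul_const]
    rfl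
  simp only [hco] at hmain
  constructor
  · rw [← hasSum_nat_add_iff' 1]
    simpa [coeff, Algebra.algebraMap_eq_smul_one] using hmain
  · rw [← summable_nat_add_iff 1]
    refine hsn.of_nonneg_of_le (fun n => norm_nonneg _) fun n => ?_
    rw [← hco]
    exact norm_integral_le_integral_norm _

/-- Transfer of a polynomial relation from scalars to elements of small norm. -/
theorem small_identity [CompleteSpace 𝒜] (h : CauchyData μ b w τ κ W) {r₀ : ℂ}
    {P Q : Polynomial ℂ} {ρ : ℝ} (hρ : 0 < ρ)
    (hs : ∀ ζ : ℂ, ‖ζ‖ < ρ → Q.eval ζ * (r₀ + ∫ x, w x * resolventDiff (b x) ζ ∂μ) = P.eval ζ)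
    {T : 𝒜} (hT : ‖T‖ < κ) :
    Polynomial.aeval T Q * (algebraMap ℂ 𝒜 r₀ + ∫ x, w x • resolventDiff (b x) T ∂μ) =
      Polynomial.aeval T P := by
  -- The scalar identity on a disc kills all coefficients of Q times the series minus P; the same
  -- coefficients govern the series at T.
  have hc : productCoeff P Q (h.coeff r₀) = 0 := by
    refine eq_zero_of_hasSum_zero (lt_min hρ h.pos) fun ζ hζ => ?_
    obtain ⟨h1, h2⟩ := h.hasSum_coeff (𝒜 := ℂ) r₀ (hζ.trans_le (min_le_right _ _))
    have := hasSum_productCoeff P Q _ h1 h2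
    have h3 := hs ζ (hζ.trans_le (min_le_left _ _))
    simp only [smul_eq_mul, Polynomial.coe_aeval_eq_eval, Algebra.algebraMap_self,
      RingHom.id_apply] at this
    rwa [h3, sub_self] at this
  obtain ⟨h1, h2⟩ := h.hasSum_coeff r₀ hT
  have := hasSum_productCoeff P Q _ h1 h2
  simp only [hc, Pi.zero_apply, zero_smul] at this
  exact sub_eq_zero.1 (this.unique hasSum_zero)

variable [SecondCountableTopology X]

theorem integrable_smul_resolventDiff [CompleteSpace 𝒜] (h : CauchyData μ b w τ κ W) {T : 𝒜}
    {C : ℝ} (hT : ResolventBound b τ C T) :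
    Integrable (fun x => w x • resolventDiff (b x) T) μ := by
  refine (h.integrable.const_mul _).mono' ?_
    (Filter.Eventually.of_forall (h.norm_smul_resolventDiff_le hT))
  refine h.aestronglyMeasurable.smul (Continuous.aestronglyMeasurable ?_)
  exact (h.continuous_inverse fun x => (hT x).1).sub
    ((continuous_algebraMap ℂ 𝒜).comp (h.continuous.inv₀ h.ne_zero))

/-- Differentiation under the integral. The derivative contains the resolvent twice, so the uniform
bound C/τ yields the integrable majorant 1/τ². -/
theorem differentiableOn_integral [CompleteSpace 𝒜] (h : CauchyData μ b w τ κ W) {T : 𝒜} {C : ℝ}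
    {U : Set ℂ} (hU : IsOpen U) (hb : ∀ s ∈ U, ResolventBound b τ C (s • T)) :
    DifferentiableOn ℂ (fun s : ℂ => ∫ x, w x • resolventDiff (b x) (s • T) ∂μ) U := by
  intro s hs
  have hder : ∀ x, ∀ s ∈ U, HasDerivAt (fun s : ℂ => w x • resolventDiff (b x) (s • T))
      (w x • (Ring.inverse (algebraMap ℂ 𝒜 (b x) - s • T) * T *
        Ring.inverse (algebraMap ℂ 𝒜 (b x) - s • T))) s := by
    intro x s hs
    obtain ⟨v, hv⟩ := (hb s hs x).1
    have h1 := hasFDerivAt_ringInverse (𝕜 := ℂ) v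
    rw [hv] at h1
    have h2 : HasDerivAt (fun s : ℂ => algebraMap ℂ 𝒜 (b x) - s • T) (-T) s := by
      simpa using ((hasDerivAt_id s).smul_const T).const_sub (algebraMap ℂ 𝒜 (b x))
    have h3 := ((h1.comp_hasDerivAt s h2).sub_const (algebraMap ℂ 𝒜 (b x)⁻¹)).const_smul (w x)
    convert! h3 using 2
    rw [← hv, Ring.inverse_unit]
    simp
  have hbound : ∀ x, ∀ s ∈ U, ‖w x • (Ring.inverse (algebraMap ℂ 𝒜 (b x) - s • T) * T *
      Ring.inverse (algebraMap ℂ 𝒜 (b x) - s • T))‖ ≤ W * (C ^ 2 * ‖T‖) * (τ x)⁻¹ ^ 2 := by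
    intro x s hs
    have hW := (norm_nonneg _).trans (h.norm_le x)
    have h2 := (hb s hs x).2
    rw [norm_smul, mul_assoc W]
    refine mul_le_mul (h.norm_le x) ?_ (norm_nonneg _) hW
    calc _ ≤ ‖Ring.inverse (algebraMap ℂ 𝒜 (b x) - s • T)‖ * ‖T‖ *
          ‖Ring.inverse (algebraMap ℂ 𝒜 (b x) - s • T)‖ :=
        (norm_mul_le _ _).trans (mul_le_mul_of_nonneg_right (norm_mul_le _ _) (norm_nonneg _))
      _ ≤ (C * (τ x)⁻¹) * ‖T‖ * (C * (τ x)⁻¹) := by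
        have h0 : 0 ≤ C * (τ x)⁻¹ := (norm_nonneg _).trans h2
        exact mul_le_mul (mul_le_mul_of_nonneg_right h2 (norm_nonneg _)) h2 (norm_nonneg _)
          (mul_nonneg h0 (norm_nonneg _))
      _ = _ := by ring
  have hmeas : AEStronglyMeasurable (fun x => w x • (Ring.inverse (algebraMap ℂ 𝒜 (b x) - s • T) *
      T * Ring.inverse (algebraMap ℂ 𝒜 (b x) - s • T))) μ := by
    have hc := h.continuous_inverse (T := s • T) fun x => (hb s hs x).1
    exact h.aestronglyMeasurable.smul
      (Continuous.aestronglyMeasurable ((hc.mul continuous_const).mul hc))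
  have key := hasDerivAt_integral_of_dominated_loc_of_deriv_le (μ := μ) (hU.mem_nhds hs)
    (F := fun (s : ℂ) x => w x • resolventDiff (b x) (s • T))
    (Filter.eventually_of_mem (hU.mem_nhds hs) fun s hs =>
      (h.integrable_smul_resolventDiff (hb s hs)).aestronglyMeasurable)
    (h.integrable_smul_resolventDiff (hb s hs)) hmeas
    (Filter.Eventually.of_forall hbound) (h.integrable.const_mul _)
    (Filter.Eventually.of_forall hder)
  exact key.2.differentiableAt.differentiableWithinAt

/-- Transfer of a polynomial relation for a resolvent integral from scalars to an element of a
Banach algebra that is connected to `0` through elements with a uniform resolvent bound. -/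
theorem identity [CompleteSpace 𝒜] (h : CauchyData μ b w τ κ W) {r₀ : ℂ}
    {P Q : Polynomial ℂ} {ρ : ℝ} (hρ : 0 < ρ)
    (hs : ∀ ζ : ℂ, ‖ζ‖ < ρ → Q.eval ζ * (r₀ + ∫ x, w x * resolventDiff (b x) ζ ∂μ) = P.eval ζ)
    {T : 𝒜} {C : ℝ} {U : Set ℂ} (hU : IsOpen U) (hUc : IsPreconnected U) (h0 : 0 ∈ U) (h1 : 1 ∈ U)
    (hb : ∀ s ∈ U, ResolventBound b τ C (s • T)) :
    Polynomial.aeval T Q * (algebraMap ℂ 𝒜 r₀ + ∫ x, w x • resolventDiff (b x) T ∂μ) =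
      Polynomial.aeval T P := by
  have hpoly : ∀ R : Polynomial ℂ, Differentiable ℂ fun s : ℂ => Polynomial.aeval (s • T) R := by
    intro R
    simp only [Polynomial.aeval_eq_sum_range]
    refine Differentiable.fun_sum fun i _ => ?_
    exact ((differentiable_id.smul_const T).pow i).const_smul (R.coeff i)
  have hd : DifferentiableOn ℂ (fun s : ℂ => Polynomial.aeval (s • T) Q *
      (algebraMap ℂ 𝒜 r₀ + ∫ x, w x • resolventDiff (b x) (s • T) ∂μ) -
      Polynomial.aeval (s • T) P) U :=
    ((hpoly Q).differentiableOn.mul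
      ((differentiableOn_const _).add (h.differentiableOn_integral hU hb))).sub
      (hpoly P).differentiableOn
  -- Near s = 0 the element s • T is small and the power series identity applies; analytic
  -- continuation in s reaches s = 1.
  have hz := (hd.analyticOnNhd hU).eqOn_zero_of_preconnected_of_eventuallyEq_zero hUc h0 (by
    have hcont : ContinuousAt (fun s : ℂ => ‖s • T‖) 0 := by fun_prop
    have hev : ∀ᶠ s : ℂ in nhds 0, ‖s • T‖ < κ := by
      refine hcont.eventually_lt_const ?_
      simpa using h.pos
    filter_upwards [hev] with s hs'
    exact sub_eq_zero.2 (h.small_identity hρ hs hs'))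
  have := hz h1
  simp only [one_smul, Pi.zero_apply] at this
  exact sub_eq_zero.1 this

end CauchyData

end ResolventIntegrals

/-! ### Numerical range and coercivity. -/

section Coercivity

variable {H : Type*} [NormedAddCommGroup H] [InnerProductSpace ℂ H]

/-- If the numerical range of `X` lies at distance `δ` from a half-plane with boundary point `z`,
then `z - X` is coercive. -/
theorem coercive_sub_of_numRange {X : H →L[ℂ] H} {z n : ℂ} {δ : ℝ}
    (h : ∀ w ∈ numRange X, δ ≤ (conj n * (z - w)).re) (x : H) :
    δ * ‖x‖ ^ 2 ≤ (conj n * inner ℂ x ((algebraMap ℂ (H →L[ℂ] H) z - X) x)).re := by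
  rcases eq_or_ne x 0 with rfl | hx
  · simp
  have hx0 : 0 < ‖x‖ := norm_pos_iff.2 hx
  set v : H := ((‖x‖⁻¹ : ℝ) : ℂ) • x with hv
  have hv1 : ‖v‖ = 1 := by
    rw [hv, norm_smul, Complex.norm_real, norm_inv, norm_norm, inv_mul_cancel₀ hx0.ne']
  have hxv : x = ((‖x‖ : ℝ) : ℂ) • v := by
    rw [hv, smul_smul, ← Complex.ofReal_mul, mul_inv_cancel₀ hx0.ne', Complex.ofReal_one, one_smul]
  have h1 := h _ ⟨v, hv1, rfl⟩
  have e : inner ℂ x ((algebraMap ℂ (H →L[ℂ] H) z - X) x) =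
      ((‖x‖ ^ 2 : ℝ) : ℂ) * (z - inner ℂ v (X v)) := by
    have e1 : inner ℂ v ((algebraMap ℂ (H →L[ℂ] H) z - X) v) = z - inner ℂ v (X v) := by
      have : (algebraMap ℂ (H →L[ℂ] H) z - X) v = z • v - X v := by
        rw [Algebra.algebraMap_eq_smul_one]
        rfl
      rw [this, inner_sub_right, inner_smul_right, inner_self_eq_norm_sq_to_K, hv1]
      simp
    conv_lhs => rw [hxv]
    rw [map_smul, inner_smul_left, inner_smul_right, e1, Complex.conj_ofReal]
    push_cast
    ring
  rw [e, mul_left_comm, Complex.re_ofReal_mul, mul_comm δ]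
  exact mul_le_mul_of_nonneg_left h1 (by positivity)

theorem mul_norm_le_of_coercive {B : H →L[ℂ] H} {n : ℂ} (hn : ‖n‖ = 1) {δ : ℝ}
    (h : ∀ x, δ * ‖x‖ ^ 2 ≤ (conj n * inner ℂ x (B x)).re) (x : H) : δ * ‖x‖ ≤ ‖B x‖ := by
  rcases eq_or_ne x 0 with rfl | hx
  · simp
  have hx0 : 0 < ‖x‖ := norm_pos_iff.2 hx
  have h1 : (conj n * inner ℂ x (B x)).re ≤ ‖x‖ * ‖B x‖ := by
    refine (Complex.re_le_norm _).trans ?_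
    rw [norm_mul, RCLike.norm_conj, hn, one_mul]
    exact norm_inner_le_norm x (B x)
  have h2 := (h x).trans h1
  have h3 : (δ * ‖x‖) * ‖x‖ ≤ ‖B x‖ * ‖x‖ := by nlinarith
  exact le_of_mul_le_mul_right h3 hx0

/-- The Lax–Milgram argument, after a rotation by the unimodular n. -/
theorem isUnit_of_coercive [CompleteSpace H] {B : H →L[ℂ] H} {n : ℂ} (hn : ‖n‖ = 1) {δ : ℝ}
    (hδ : 0 < δ) (h : ∀ x, δ * ‖x‖ ^ 2 ≤ (conj n * inner ℂ x (B x)).re) : IsUnit B := by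
  refine ContinuousLinearMap.isUnit_of_forall_le_norm_inner_map B (c := ⟨δ, hδ.le⟩) hδ fun x => ?_
  rw [norm_inner_symm]
  calc ‖x‖ ^ 2 * δ = δ * ‖x‖ ^ 2 := mul_comm _ _
    _ ≤ (conj n * inner ℂ x (B x)).re := h x
    _ ≤ ‖conj n * inner ℂ x (B x)‖ := Complex.re_le_norm _
    _ = _ := by rw [norm_mul, RCLike.norm_conj, hn, one_mul]

theorem norm_inverse_le_of_bound {B : H →L[ℂ] H} (hB : IsUnit B) {k : ℝ} (hk : 0 < k)
    (h : ∀ x, k * ‖x‖ ≤ ‖B x‖) : ‖Ring.inverse B‖ ≤ k⁻¹ := by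
  refine ContinuousLinearMap.opNorm_le_bound _ (by positivity) fun x => ?_
  have h1 := h (Ring.inverse B x)
  have h2 : B (Ring.inverse B x) = x :=
    congrArg (fun T : H →L[ℂ] H => T x) (Ring.mul_inverse_cancel B hB)
  rw [h2] at h1
  rw [inv_mul_eq_div, le_div_iff₀ hk, mul_comm]
  exact h1

/-- A bound uniform in t, useful near the vertex, and one growing with t, useful at infinity, are
merged into a bound proportional to 1 + t. They meet at t = D + δ, which determines the constant. -/
theorem lower_bound_combine {δ D t a y : ℝ} (hδ : 0 < δ) (hD : 0 ≤ D) (ha : 0 ≤ a)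
    (h1 : δ * a ≤ y) (h2 : (t - D) * a ≤ y) : δ / (1 + D + δ) * (1 + t) * a ≤ y := by
  have hp : 0 < 1 + D + δ := by linarith
  rcases le_total t (D + δ) with h | h
  · refine le_trans (mul_le_mul_of_nonneg_right ?_ ha) h1
    rw [div_mul_eq_mul_div, div_le_iff₀ hp]
    nlinarith
  · refine le_trans (mul_le_mul_of_nonneg_right ?_ ha) h2
    rw [div_mul_eq_mul_div, div_le_iff₀ hp]
    nlinarith

theorem numRange_norm_le {X : H →L[ℂ] H} {w : ℂ} (hw : w ∈ numRange X) : ‖w‖ ≤ ‖X‖ := by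
  obtain ⟨x, hx, rfl⟩ := hw
  refine (norm_inner_le_norm x (X x)).trans ?_
  rw [hx, one_mul]
  simpa [hx] using X.le_opNorm x

theorem isCompact_closure_numRange (X : H →L[ℂ] H) : IsCompact (closure (numRange X)) := by
  refine Metric.isCompact_of_isClosed_isBounded isClosed_closure (Bornology.IsBounded.closure ?_)
  refine (Metric.isBounded_closedBall (x := (0 : ℂ)) (r := ‖X‖)).subset fun w hw => ?_
  simpa using numRange_norm_le hw

end Coercivity

/-! ### Resolvent estimates on the boundary of the sector. -/

section SectorResolvent

variable {c : ℂ} {θ α : ℝ}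

theorem outwardNormal_norm_le_one (Ω : Set ℂ) (z : ℂ) : ‖outwardNormal Ω z‖ ≤ 1 := by
  rw [outwardNormal]
  split_ifs with h
  · exact h.choose_spec.1.1.le
  · simp

theorem ae_arclength_of_forall_sidePoint (hα : 0 < α) (hα2 : α ≤ Real.pi / 2)
    {p : frontier (sector c θ α) → Prop}
    (h : ∀ {ε : ℝ} (hε : ε = 1 ∨ ε = -1) {t : ℝ}, 0 < t → p (sidePoint c θ hα hα2 hε t)) :
    ∀ᵐ z ∂(arclength (sector c θ α)), p z := by
  have hna := Measure.nullSingletonClass_hausdorff (frontier (sector c θ α)) zero_lt_one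
  have h0 : ∀ᵐ z ∂(arclength (sector c θ α)), z ≠ sidePoint c θ hα hα2 (Or.inl rfl) 0 := by
    rw [ae_iff, arclength]
    simp
  filter_upwards [h0] with z hz
  obtain ⟨ε, hε, t, ht, rfl⟩ := exists_eq_sidePoint hα hα2 z
  rcases ht.eq_or_lt with rfl | ht
  · exact absurd (sidePoint_zero hα hα2 _ _) hz
  · exact h hε ht

theorem aestronglyMeasurable_outwardNormal (hα : 0 < α) (hα2 : α ≤ Real.pi / 2) :
    AEStronglyMeasurable (fun σ : frontier (sector c θ α) => outwardNormal (sector c θ α) σ)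
      (arclength (sector c θ α)) := by
  rw [arclength_sector hα hα2, aestronglyMeasurable_add_measure_iff]
  have side : ∀ {ε : ℝ} (hε : ε = 1 ∨ ε = -1), AEStronglyMeasurable
      (fun σ : frontier (sector c θ α) => outwardNormal (sector c θ α) σ)
      (Measure.map (fun t : Set.Ioi (0 : ℝ) => sidePoint c θ hα hα2 hε t)
        (Measure.hausdorffMeasure 1)) := by
    intro ε hε
    rw [(measurableEmbedding_sidePoint hα hα2 hε).aestronglyMeasurable_map_iff]
    refine (aestronglyMeasurable_const (b := sideNormal θ α ε)).congr
      (Filter.Eventually.of_forall fun t => ?_)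
    simp only [Function.comp_apply]
    rw [coe_sidePoint hα hα2 hε t.2.le, outwardNormal_rayPoint hα hα2 hε t.2]
  exact ⟨side _, side _⟩

theorem norm_sidePoint_sub_vertex (hα : 0 < α) (hα2 : α ≤ Real.pi / 2) {ε : ℝ}
    (hε : ε = 1 ∨ ε = -1) {t : ℝ} (ht : 0 ≤ t) :
    ‖(sidePoint c θ hα hα2 hε t : ℂ) - c‖ = t := by
  rw [coe_sidePoint hα hα2 hε ht, rayPoint_sub_vertex, abs_of_nonneg ht]

theorem integrable_inv_one_add_norm_sq (hα : 0 < α) (hα2 : α ≤ Real.pi / 2) :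
    Integrable (fun σ : frontier (sector c θ α) => (1 + ‖(σ : ℂ) - c‖)⁻¹ ^ 2)
      (arclength (sector c θ α)) := by
  have hi : IntegrableOn (fun s : ℝ => (1 + s)⁻¹ ^ 2) (Set.Ioi 0) := by
    refine Integrable.mono' (integrable_inv_one_add_sq.integrableOn (s := Set.Ioi 0)) ?_ ?_
    · refine ContinuousOn.aestronglyMeasurable ?_ measurableSet_Ioi
      refine (ContinuousOn.inv₀ (by fun_prop) fun s hs => ?_).pow 2
      have : 0 < s := hs
      positivity
    · filter_upwards [ae_restrict_mem measurableSet_Ioi] with s hs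
      have : 0 < s := hs
      rw [Real.norm_of_nonneg (by positivity), inv_pow]
      exact inv_anti₀ (by positivity) (by nlinarith)
  rw [integrableOn_Ioi_iff_comp_exp one_pos] at hi
  rw [integrable_arclength_iff hα hα2 one_pos]
  have e : ∀ {ε : ℝ} (hε : ε = 1 ∨ ε = -1) (y : ℝ),
      ‖(sidePoint c θ hα hα2 hε (1 * Real.exp y) : ℂ) - c‖ = 1 * Real.exp y :=
    fun hε y => norm_sidePoint_sub_vertex hα hα2 hε (by positivity)
  simp only [e]
  exact ⟨hi, hi⟩

/-- The affine form of `sideFun`. -/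
theorem re_conj_sideNormal_mul_sub (hα : 0 < α) (hα2 : α ≤ Real.pi / 2) {ε : ℝ}
    (hε : ε = 1 ∨ ε = -1) {t : ℝ} (ht : 0 ≤ t) (z : ℂ) :
    (conj (sideNormal θ α ε) * ((sidePoint c θ hα hα2 hε t : ℂ) - z)).re = -sideFun c θ α ε z := by
  rw [coe_sidePoint hα hα2 hε ht, ← re_conj_sideNormal_mul c z θ α ε t, ← Complex.neg_re, ← mul_neg,
    neg_sub]

theorem re_conj_sideNormal_mul_sub' (z w : ℂ) (ε : ℝ) :
    (conj (sideNormal θ α ε) * (z - w)).re = sideFun c θ α ε z - sideFun c θ α ε w := by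
  rw [← re_conj_sideNormal_mul c z θ α ε 0, ← re_conj_sideNormal_mul c w θ α ε 0, ← Complex.sub_re,
    ← mul_sub]
  congr 2
  ring

/-- By compactness, K has a positive distance to both side lines. -/
theorem exists_sideFun_le {K : Set ℂ} (hα : 0 < α) (hα2 : α ≤ Real.pi / 2) (hK : IsCompact K)
    (h : K ⊆ sector c θ α) :
    ∃ δ > 0, ∀ w ∈ K, ∀ ε : ℝ, ε = 1 ∨ ε = -1 → sideFun c θ α ε w ≤ -δ := by
  have side : ∀ {ε : ℝ}, ε = 1 ∨ ε = -1 → ∃ δ > 0, ∀ w ∈ K, sideFun c θ α ε w ≤ -δ := by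
    intro ε hε
    obtain ⟨a, ha, hb⟩ := hK.exists_forall_le' (f := fun w => -sideFun c θ α ε w) (a := 0)
      (continuous_sideFun c θ α ε).neg.continuousOn
      fun w hw => neg_pos.2 ((mem_sector_iff hα hα2).1 (h hw) ε hε)
    exact ⟨a, ha, fun w hw => le_neg.1 (hb w hw)⟩
  obtain ⟨a, ha, ha'⟩ := side (Or.inl rfl)
  obtain ⟨b, hb, hb'⟩ := side (Or.inr rfl)
  refine ⟨min a b, lt_min ha hb, fun w hw ε hε => ?_⟩
  rcases hε with rfl | rfl
  · exact (ha' w hw).trans (neg_le_neg (min_le_left _ _))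
  · exact (hb' w hw).trans (neg_le_neg (min_le_right _ _))

/-- A uniform lower bound for the distance from a point of the sector to the boundary. -/
theorem exists_le_norm_sub (hα : 0 < α) (hα2 : α ≤ Real.pi / 2) {z : ℂ} (hz : z ∈ sector c θ α) :
    ∃ κ > 0, ∀ σ : frontier (sector c θ α), κ * (1 + ‖(σ : ℂ) - c‖) ≤ ‖(σ : ℂ) - z‖ := by
  obtain ⟨δ, hδ, h⟩ := exists_sideFun_le hα hα2 (isCompact_singleton (x := z)) (by simpa using hz)
  refine ⟨δ / (1 + ‖z - c‖ + δ), by positivity, fun σ => ?_⟩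
  obtain ⟨ε, hε, t, ht, rfl⟩ := exists_eq_sidePoint hα hα2 σ
  have h1 : δ * 1 ≤ ‖(sidePoint c θ hα hα2 hε t : ℂ) - z‖ := by
    have h2 := h z rfl ε hε
    have h3 := re_conj_sideNormal_mul_sub (c := c) (θ := θ) hα hα2 hε ht z
    have h4 := Complex.re_le_norm
      (conj (sideNormal θ α ε) * ((sidePoint c θ hα hα2 hε t : ℂ) - z))
    rw [norm_mul, RCLike.norm_conj, norm_sideNormal hε, one_mul] at h4
    linarith
  have h2 : (‖(sidePoint c θ hα hα2 hε t : ℂ) - c‖ - ‖z - c‖) * 1 ≤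
      ‖(sidePoint c θ hα hα2 hε t : ℂ) - z‖ := by
    rw [mul_one]
    have := norm_sub_norm_le ((sidePoint c θ hα hα2 hε t : ℂ) - c) (z - c)
    simpa using this
  have := lower_bound_combine hδ (norm_nonneg (z - c)) zero_le_one h1 h2
  simpa using this

theorem cauchyData_sector (hα : 0 < α) (hα2 : α ≤ Real.pi / 2) {z : ℂ} {κ : ℝ} (hκ : 0 < κ)
    (hz : ∀ σ : frontier (sector c θ α), κ * (1 + ‖(σ : ℂ) - c‖) ≤ ‖(σ : ℂ) - z‖)
    (f : frontier (sector c θ α) →ᵇ ℂ) :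
    CauchyData (arclength (sector c θ α)) (fun σ : frontier (sector c θ α) => (σ : ℂ) - z)
      (fun σ => f σ * outwardNormal (sector c θ α) σ) (fun σ => 1 + ‖(σ : ℂ) - c‖) κ ‖f‖ where
  continuous := by fun_prop
  aestronglyMeasurable :=
    f.continuous.aestronglyMeasurable.mul (aestronglyMeasurable_outwardNormal hα hα2)
  norm_le σ := by
    rw [norm_mul]
    exact (mul_le_mul (f.norm_coe_le_norm σ) (outwardNormal_norm_le_one _ _) (norm_nonneg _)
      (norm_nonneg _)).trans_eq (mul_one _)
  one_le σ := by simp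
  integrable := integrable_inv_one_add_norm_sq hα hα2
  pos := hκ
  le_norm := hz

theorem resolventBound_scalar {κ : ℝ} (hκ : 0 < κ) {z : ℂ}
    (hz : ∀ σ : frontier (sector c θ α), κ * (1 + ‖(σ : ℂ) - c‖) ≤ ‖(σ : ℂ) - z‖) {ζ : ℂ}
    (hζ : ‖ζ‖ < κ / 2) :
    CauchyData.ResolventBound (fun σ : frontier (sector c θ α) => (σ : ℂ) - z)
      (fun σ => 1 + ‖(σ : ℂ) - c‖) (κ / 2)⁻¹ ζ := by
  intro σ
  have h1 := hz σ
  have h2 := norm_sub_norm_le ((σ : ℂ) - z) ζ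
  have h3 : 0 ≤ κ * ‖(σ : ℂ) - c‖ := by positivity
  have h4 : κ / 2 * (1 + ‖(σ : ℂ) - c‖) ≤ ‖(σ : ℂ) - z - ζ‖ := by nlinarith
  have h5 : 0 < κ / 2 * (1 + ‖(σ : ℂ) - c‖) := by positivity
  refine ⟨isUnit_iff_ne_zero.2 (norm_pos_iff.1 (h5.trans_le h4)), ?_⟩
  simp only [Algebra.algebraMap_self, RingHom.id_apply, Ring.inverse_eq_inv', norm_inv]
  rw [← mul_inv]
  exact inv_anti₀ h5 h4

end SectorResolvent

/-! ### The Cauchy representation for scalars. -/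

/-- A holomorphic function whose conjugate agrees with a holomorphic function is constant. -/
theorem eq_of_conj_eq_of_differentiableOn {F G : ℂ → ℂ} {ρ : ℝ}
    (hF : DifferentiableOn ℂ F (Metric.ball 0 ρ)) (hG : DifferentiableOn ℂ G (Metric.ball 0 ρ))
    (h : ∀ z ∈ Metric.ball (0 : ℂ) ρ, F z = conj (G z)) {z : ℂ} (hz : z ∈ Metric.ball (0 : ℂ) ρ) :
    F z = F 0 := by
  have hder : Set.EqOn (deriv F) 0 (Metric.ball 0 ρ) := by
    intro w hw
    have hnhds := Metric.isOpen_ball.mem_nhds hw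
    have h1 := ((hF.differentiableAt hnhds).hasDerivAt.hasFDerivAt.restrictScalars ℝ)
    have h2 := ((hG.differentiableAt hnhds).hasDerivAt.hasFDerivAt.restrictScalars ℝ)
    have h3 := (Complex.conjCLE.toContinuousLinearMap.hasFDerivAt (x := G w)).comp w h2
    have h4 : HasFDerivAt F _ w := h3.congr_of_eventuallyEq
      (Filter.eventuallyEq_of_mem hnhds fun z hz => h z hz)
    have h5 := h1.unique h4
    -- The real derivative of F is complex linear and that of the conjugate of G is antilinear.
    -- Comparing them on 1 and i forces F' = 0.
    have e1 := congrArg (fun L : ℂ →L[ℝ] ℂ => L 1) h5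
    have e2 := congrArg (fun L : ℂ →L[ℝ] ℂ => L Complex.I) h5
    simp at e1 e2
    rw [← e1] at e2
    have e3 : Complex.I * (2 * deriv F w) = 0 := by linear_combination e2
    simpa using e3
  exact Metric.isOpen_ball.is_const_of_deriv_eq_zero (convex_ball _ _).isPreconnected hF hder hz
    (Metric.mem_ball_self (Metric.pos_of_mem_ball hz))

section ScalarIdentity

variable {c : ℂ} {θ α : ℝ}

/-- The base point has angle α/2, off the axis, because `integral_solution` is available only for 0
< ϑ < α. A neighbourhood of one such point suffices for the analytic continuation. -/
theorem eventually_eq_rayPoint (hα : 0 < α) (hα2 : α ≤ Real.pi / 2) :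
    ∀ᶠ z in nhds (rayPoint c (θ + α / 2) 1),
      z ∈ sector c θ α ∧ ∃ ϑ t : ℝ, 0 < ϑ ∧ ϑ < α ∧ 0 < t ∧ z = rayPoint c (θ + ϑ) t := by
  have hpi := Real.pi_pos
  have hmem : rayPoint c (θ + α / 2) 1 ∈ sector c θ α :=
    rayPoint_mem_sector hα hα2 (by linarith) (by linarith) one_pos
  set g : ℂ → ℂ := fun z => (z - c) * Complex.exp (-(θ * Complex.I)) with hg
  have hval : g (rayPoint c (θ + α / 2) 1) = Complex.exp ((α / 2 : ℝ) * Complex.I) := by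
    rw [hg]
    simp only [rayPoint, add_sub_cancel_left, Complex.ofReal_one, one_mul]
    rw [← Complex.exp_add]
    congr 1
    push_cast
    ring
  have harg : Complex.arg (g (rayPoint c (θ + α / 2) 1)) = α / 2 := by
    rw [hval, Complex.arg_exp_mul_I, toIocMod_eq_self]
    constructor <;> linarith
  have hcont : ContinuousAt (fun z => Complex.arg (g z)) (rayPoint c (θ + α / 2) 1) := by
    refine ContinuousAt.comp (f := g) (Complex.continuousAt_arg ?_) (by fun_prop)
    rw [hval, Complex.mem_slitPlane_iff_arg]
    rw [hval] at harg
    exact ⟨by rw [harg]; linarith, Complex.exp_ne_zero _⟩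
  filter_upwards [(isOpen_sector hα hα2).mem_nhds hmem,
    hcont.eventually_const_lt (u := 0) (by simp only [harg]; linarith),
    hcont.eventually_lt_const (u := α) (by simp only [harg]; linarith)] with z h1 h2 h3
  obtain ⟨h4, h5⟩ := exists_eq_rayPoint_of_mem_sector h1
  exact ⟨h1, _, _, h2, h3, h5, h4⟩

/-- The double layer kernel is 1/π times the real part of ν/(σ - z); hence increments split into a
holomorphic part in ζ and its conjugate. -/
theorem two_pi_mul_doubleLayerKernel_sub (Ω : Set ℂ) (σ z ζ : ℂ) :
    2 * Real.pi * ((doubleLayerKernel Ω σ (z + ζ) : ℂ) - doubleLayerKernel Ω σ z) =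
      outwardNormal Ω σ * resolventDiff (σ - z) ζ +
        conj (outwardNormal Ω σ * resolventDiff (σ - z) ζ) := by
  have hpi : (Real.pi : ℂ) ≠ 0 := Complex.ofReal_ne_zero.2 Real.pi_ne_zero
  have e : outwardNormal Ω σ * resolventDiff (σ - z) ζ =
      outwardNormal Ω σ / (σ - (z + ζ)) - outwardNormal Ω σ / (σ - z) := by
    simp only [resolventDiff, Algebra.algebraMap_self, RingHom.id_apply, Ring.inverse_eq_inv']
    rw [← sub_sub]
    ring
  rw [Complex.add_conj, e, doubleLayerKernel, doubleLayerKernel, Complex.sub_re]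
  push_cast
  field_simp

/-- Near a point of the upper half of the sector, the solution of the boundary equation with data
`r` represents `r` by a Cauchy integral, and its conjugate has vanishing Cauchy integral. -/
theorem scalar_identity (hα : 0 < α) (hα2 : α ≤ Real.pi / 2) {r : RatFunc ℂ}
    (hr : ∀ z ∈ sector c θ α, ‖r.eval (RingHom.id ℂ) z‖ ≤ 1)
    {f h : frontier (sector c θ α) →ᵇ ℂ}
    (hf : ∀ z : frontier (sector c θ α), f z = r.eval (RingHom.id ℂ) z)
    (hh : h + doubleLayerOperator c θ hα hα2 h = f) :
    ∃ ρ > 0, ∀ ζ : ℂ, ‖ζ‖ < ρ →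
      r.denom.eval (rayPoint c (θ + α / 2) 1 + ζ) ≠ 0 ∧
      2 * Real.pi * r.eval (RingHom.id ℂ) (rayPoint c (θ + α / 2) 1) +
        ∫ σ : frontier (sector c θ α), h σ * outwardNormal (sector c θ α) σ *
          resolventDiff ((σ : ℂ) - rayPoint c (θ + α / 2) 1) ζ ∂(arclength (sector c θ α)) =
        2 * Real.pi * r.eval (RingHom.id ℂ) (rayPoint c (θ + α / 2) 1 + ζ) ∧
      ∫ σ : frontier (sector c θ α), star h σ * outwardNormal (sector c θ α) σ *
          resolventDiff ((σ : ℂ) - rayPoint c (θ + α / 2) 1) ζ ∂(arclength (sector c θ α)) = 0 := by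
  set z₀ := rayPoint c (θ + α / 2) 1 with hz₀
  have hmem : z₀ ∈ sector c θ α :=
    rayPoint_mem_sector hα hα2 (by linarith) (by linarith) one_pos
  obtain ⟨κ, hκ, hle⟩ := exists_le_norm_sub hα hα2 hmem
  obtain ⟨ρ₁, hρ₁, hball⟩ := Metric.eventually_nhds_iff.1
    (eventually_eq_rayPoint (c := c) (θ := θ) hα hα2)
  set ρ := min ρ₁ (κ / 2) with hρ
  have hρ0 : 0 < ρ := lt_min hρ₁ (by positivity)
  have hnear : ∀ ζ ∈ Metric.ball (0 : ℂ) ρ, z₀ + ζ ∈ sector c θ α ∧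
      ∃ ϑ t : ℝ, 0 < ϑ ∧ ϑ < α ∧ 0 < t ∧ z₀ + ζ = rayPoint c (θ + ϑ) t := by
    intro ζ hζ
    refine hball ?_
    rw [dist_eq_norm, add_sub_cancel_left]
    exact (mem_ball_zero_iff.1 hζ).trans_le (min_le_left _ _)
  have hb : ∀ ζ ∈ Metric.ball (0 : ℂ) ρ, CauchyData.ResolventBound
      (fun σ : frontier (sector c θ α) => (σ : ℂ) - z₀) (fun σ => 1 + ‖(σ : ℂ) - c‖)
      (κ / 2)⁻¹ (ζ • (1 : ℂ)) := by
    intro ζ hζ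
    rw [smul_eq_mul, mul_one]
    exact resolventBound_scalar hκ hle ((mem_ball_zero_iff.1 hζ).trans_le (min_le_right _ _))
  have d1 := (cauchyData_sector hα hα2 hκ hle h).differentiableOn_integral Metric.isOpen_ball hb
  have d2 := (cauchyData_sector hα hα2 hκ hle (star h)).differentiableOn_integral
    Metric.isOpen_ball hb
  have i1 := fun ζ hζ =>
    (cauchyData_sector hα hα2 hκ hle h).integrable_smul_resolventDiff (hb ζ hζ)
  have i2 := fun ζ hζ =>
    (cauchyData_sector hα hα2 hκ hle (star h)).integrable_smul_resolventDiff (hb ζ hζ)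
  simp only [smul_eq_mul, mul_one] at d1 d2 i1 i2
  set G₁ : ℂ → ℂ := fun ζ => ∫ σ : frontier (sector c θ α),
    h σ * outwardNormal (sector c θ α) σ * resolventDiff ((σ : ℂ) - z₀) ζ
      ∂(arclength (sector c θ α)) with hG₁
  set G₂ : ℂ → ℂ := fun ζ => ∫ σ : frontier (sector c θ α),
    star h σ * outwardNormal (sector c θ α) σ * resolventDiff ((σ : ℂ) - z₀) ζ
      ∂(arclength (sector c θ α)) with hG₂
  have hG0 : ∀ {g : frontier (sector c θ α) →ᵇ ℂ}, ∫ σ : frontier (sector c θ α),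
      g σ * outwardNormal (sector c θ α) σ * resolventDiff ((σ : ℂ) - z₀) (0 : ℂ)
      ∂(arclength (sector c θ α)) = 0 := by
    simp [resolventDiff]
  have hden : ∀ ζ ∈ Metric.ball (0 : ℂ) ρ, r.denom.eval (z₀ + ζ) ≠ 0 := fun ζ hζ =>
    (ratFunc_denom_ne_zero_and_norm_eval_le (isOpen_sector hα hα2) hr
      (subset_closure (hnear ζ hζ).1)).1
  have hrep : ∀ ζ ∈ Metric.ball (0 : ℂ) ρ, Integrable (fun σ : frontier (sector c θ α) =>
        (doubleLayerKernel (sector c θ α) σ (z₀ + ζ) : ℂ) * h σ) (arclength (sector c θ α)) ∧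
      ∫ σ : frontier (sector c θ α), (doubleLayerKernel (sector c θ α) σ (z₀ + ζ) : ℂ) * h σ
        ∂(arclength (sector c θ α)) = r.eval (RingHom.id ℂ) (z₀ + ζ) := by
    intro ζ hζ
    obtain ⟨-, ϑ, t, h1, h2, h3, h4⟩ := hnear ζ hζ
    rw [h4]
    exact integral_solution hα hα2 hr hf hh h3 h1 h2
  have h00 := hrep 0 (Metric.mem_ball_self hρ0)
  rw [add_zero] at h00
  -- A function holomorphic in ζ equals the conjugate of another one, so both are constant. They
  -- vanish at ζ = 0.
  have hsum : ∀ ζ ∈ Metric.ball (0 : ℂ) ρ,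
      2 * Real.pi * (r.eval (RingHom.id ℂ) (z₀ + ζ) - r.eval (RingHom.id ℂ) z₀) - G₁ ζ =
        conj (G₂ ζ) := by
    intro ζ hζ
    rw [sub_eq_iff_eq_add', ← (hrep ζ hζ).2, ← h00.2, ← integral_sub (hrep ζ hζ).1 h00.1,
      ← integral_const_mul, hG₁, hG₂]
    simp only
    have i3 : Integrable (fun σ : frontier (sector c θ α) => conj (star h σ *
        outwardNormal (sector c θ α) σ * resolventDiff ((σ : ℂ) - z₀) ζ))
        (arclength (sector c θ α)) :=
      (LinearIsometryEquiv.integrable_comp_iff Complex.conjLIE).2 (i2 ζ hζ)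
    rw [← integral_conj, ← integral_add (i1 ζ hζ) i3]
    refine integral_congr_ae (Filter.Eventually.of_forall fun σ => ?_)
    simp only
    rw [← sub_mul, ← mul_assoc, two_pi_mul_doubleLayerKernel_sub]
    simp only [map_mul, BoundedContinuousFunction.star_apply, RCLike.star_def, Complex.conj_conj]
    ring
  have hF : DifferentiableOn ℂ (fun ζ => 2 * Real.pi * (r.eval (RingHom.id ℂ) (z₀ + ζ) -
      r.eval (RingHom.id ℂ) z₀) - G₁ ζ) (Metric.ball 0 ρ) := by
    refine DifferentiableOn.sub ?_ d1
    intro ζ hζ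
    have h1 : DifferentiableAt ℂ (fun ζ => r.eval (RingHom.id ℂ) (z₀ + ζ)) ζ :=
      (differentiableAt_ratFunc_eval (hden ζ hζ)).comp ζ (by fun_prop)
    exact ((h1.sub_const _).const_mul _).differentiableWithinAt
  refine ⟨ρ, hρ0, fun ζ hζ => ?_⟩
  have hζ' : ζ ∈ Metric.ball (0 : ℂ) ρ := by simpa using hζ
  have hconst := eq_of_conj_eq_of_differentiableOn hF d2 hsum hζ'
  have hG₁0 : G₁ 0 = 0 := hG0
  simp only [add_zero, sub_self, mul_zero, hG₁0] at hconst
  refine ⟨hden ζ hζ', ?_, ?_⟩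
  · linear_combination -hconst
  · have := hsum ζ hζ'
    rw [hconst] at this
    exact (map_eq_zero _).1 this.symm

end ScalarIdentity

/-! ### Transfer of the Cauchy representation to operators. -/

section OperatorCalculus

variable {c : ℂ} {θ α : ℝ} {H : Type*} [NormedAddCommGroup H] [InnerProductSpace ℂ H]

theorem exists_mem_numRange_of_mem_numRange_smul {A : H →L[ℂ] H} {s z w : ℂ}
    (hw : w ∈ numRange (s • (A - algebraMap ℂ (H →L[ℂ] H) z))) :
    ∃ a ∈ numRange A, w = s * (a - z) ∧ ‖a - z‖ ≤ ‖A - algebraMap ℂ (H →L[ℂ] H) z‖ := by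
  obtain ⟨x, hx, rfl⟩ := hw
  have e : inner ℂ x ((A - algebraMap ℂ (H →L[ℂ] H) z) x) = inner ℂ x (A x) - z := by
    have : (A - algebraMap ℂ (H →L[ℂ] H) z) x = A x - z • x := by
      rw [Algebra.algebraMap_eq_smul_one]
      rfl
    rw [this, inner_sub_right, inner_smul_right, inner_self_eq_norm_sq_to_K, hx]
    simp
  refine ⟨_, ⟨x, hx, rfl⟩, ?_, ?_⟩
  · rw [smul_apply, inner_smul_right, e]
  · rw [← e]
    exact numRange_norm_le ⟨x, hx, rfl⟩

/-- For s in [0, 1] the numerical range of z + s(A - z) lies in the convex hull of z and W(A), at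
distance at least δ from both side lines. Coercivity thus bounds the resolvent uniformly in σ, and
the triangle inequality adds decay for large σ. -/
theorem exists_resolventBound [CompleteSpace H] (hα : 0 < α) (hα2 : α ≤ Real.pi / 2) {z : ℂ}
    (hz : z ∈ sector c θ α) {A : H →L[ℂ] H} (hA : closure (numRange A) ⊆ sector c θ α) :
    ∃ (C : ℝ) (U : Set ℂ), IsOpen U ∧ IsPreconnected U ∧ 0 ∈ U ∧ 1 ∈ U ∧ ∀ s ∈ U,
      CauchyData.ResolventBound (fun σ : frontier (sector c θ α) => (σ : ℂ) - z)
        (fun σ => 1 + ‖(σ : ℂ) - c‖) C (s • (A - algebraMap ℂ (H →L[ℂ] H) z)) := by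
  obtain ⟨δ, hδ, hside⟩ := exists_sideFun_le hα hα2
    ((isCompact_closure_numRange A).union (isCompact_singleton (x := z)))
    (Set.union_subset hA (by simpa using hz))
  have hsz := hside z (Or.inr rfl)
  set T : H →L[ℂ] H := A - algebraMap ℂ (H →L[ℂ] H) z with hT
  -- Analytic continuation needs an open set of complex parameters s. Thickening [0, 1] by η costs
  -- at most δ/2 of the distance to the sides.
  set η : ℝ := min 1 (δ / (2 * (‖T‖ + 1))) with hη
  have hη0 : 0 < η := lt_min one_pos (by positivity)
  have hηT : η * ‖T‖ ≤ δ / 2 := by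
    have h1 : η * ‖T‖ ≤ δ / (2 * (‖T‖ + 1)) * (‖T‖ + 1) :=
      mul_le_mul (min_le_right _ _) (by linarith) (norm_nonneg _) (by positivity)
    refine h1.trans_eq ?_
    field_simp
  set I : Set ℂ := (fun x : ℝ => (x : ℂ)) '' Set.Icc 0 1 with hI
  have hconv : Convex ℝ I := (convex_Icc (0 : ℝ) 1).linear_image Complex.ofRealCLM.toLinearMap
  have hsub : I ⊆ Metric.thickening η I := Metric.self_subset_thickening hη0 I
  have hpt : ∀ s ∈ Metric.thickening η I, ∀ {ε : ℝ} (hε : ε = 1 ∨ ε = -1) {t : ℝ}, 0 ≤ t → ∀ x : H,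
      δ / 2 * ‖x‖ ^ 2 ≤ (conj (sideNormal θ α ε) * inner ℂ x ((algebraMap ℂ (H →L[ℂ] H)
        ((sidePoint c θ hα hα2 hε t : ℂ) - z) - s • T) x)).re := by
    intro s hs ε hε t ht
    obtain ⟨_, ⟨v, hv, rfl⟩, hsv⟩ := Metric.mem_thickening_iff.1 hs
    rw [dist_eq_norm] at hsv
    refine coercive_sub_of_numRange fun w hw => ?_
    obtain ⟨a, ha, rfl, haT⟩ := exists_mem_numRange_of_mem_numRange_smul hw
    have h1 := hside a (Or.inl (subset_closure ha)) ε hε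
    have h2 := hsz ε hε
    have e : conj (sideNormal θ α ε) * ((sidePoint c θ hα hα2 hε t : ℂ) - z - s * (a - z)) =
        conj (sideNormal θ α ε) * ((sidePoint c θ hα hα2 hε t : ℂ) - z) -
        (v : ℂ) * (conj (sideNormal θ α ε) * (a - z)) -
        conj (sideNormal θ α ε) * ((s - v) * (a - z)) := by ring
    have h3 : (conj (sideNormal θ α ε) * ((s - v) * (a - z))).re ≤ δ / 2 := by
      refine (Complex.re_le_norm _).trans ?_
      rw [norm_mul, RCLike.norm_conj, norm_sideNormal hε, one_mul, norm_mul]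
      exact (mul_le_mul hsv.le haT (norm_nonneg _) hη0.le).trans hηT
    rw [e, Complex.sub_re, Complex.sub_re, Complex.re_ofReal_mul,
      re_conj_sideNormal_mul_sub hα hα2 hε ht, re_conj_sideNormal_mul_sub' (c := c)]
    nlinarith [hv.1, hv.2]
  refine ⟨(δ / 2 / (1 + (‖z - c‖ + 2 * ‖T‖) + δ / 2))⁻¹, Metric.thickening η I,
    Metric.isOpen_thickening, (hconv.thickening η).isPreconnected,
    hsub ⟨0, by simp⟩, hsub ⟨1, by simp⟩, fun s hs σ => ?_⟩
  obtain ⟨ε, hε, t, ht, rfl⟩ := exists_eq_sidePoint hα hα2 σ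
  have hco := hpt s hs hε ht
  have hunit := isUnit_of_coercive (norm_sideNormal hε) (half_pos hδ) hco
  refine ⟨hunit, ?_⟩
  rw [← mul_inv]
  have hs2 : ‖s‖ ≤ 2 := by
    obtain ⟨_, ⟨v, hv, rfl⟩, hsv⟩ := Metric.mem_thickening_iff.1 hs
    rw [dist_eq_norm] at hsv
    have h1 := norm_le_norm_add_norm_sub' s (v : ℂ)
    rw [Complex.norm_real, Real.norm_of_nonneg hv.1] at h1
    have h2 := min_le_left 1 (δ / (2 * (‖T‖ + 1)))
    linarith [hv.2]
  refine norm_inverse_le_of_bound hunit (by positivity) fun x => ?_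
  refine lower_bound_combine (half_pos hδ) (by positivity) (norm_nonneg _)
    (mul_norm_le_of_coercive (norm_sideNormal hε) hco x) ?_
  have e : (algebraMap ℂ (H →L[ℂ] H) ((sidePoint c θ hα hα2 hε t : ℂ) - z) - s • T) x =
      ((sidePoint c θ hα hα2 hε t : ℂ) - z) • x - s • T x := by
    rw [Algebra.algebraMap_eq_smul_one]
    rfl
  rw [e]
  have h1 := norm_sub_norm_le (((sidePoint c θ hα hα2 hε t : ℂ) - z) • x) (s • T x)
  rw [norm_smul, norm_smul] at h1
  have h2 : ‖s‖ * ‖T x‖ ≤ 2 * (‖T‖ * ‖x‖) :=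
    mul_le_mul hs2 (T.le_opNorm x) (norm_nonneg _) zero_le_two
  have h3 : ‖(sidePoint c θ hα hα2 hε t : ℂ) - c‖ - ‖z - c‖ ≤
      ‖(sidePoint c θ hα hα2 hε t : ℂ) - z‖ := by
    have := norm_sub_norm_le ((sidePoint c θ hα hα2 hε t : ℂ) - c) (z - c)
    simpa using this
  have h4 := mul_le_mul_of_nonneg_right h3 (norm_nonneg x)
  linarith

theorem isUnit_algebraMap_sub [CompleteSpace H] (hα : 0 < α) (hα2 : α ≤ Real.pi / 2)
    {A : H →L[ℂ] H} (hA : closure (numRange A) ⊆ sector c θ α) {z : ℂ} (hz : z ∉ sector c θ α) :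
    IsUnit (algebraMap ℂ (H →L[ℂ] H) z - A) := by
  obtain ⟨δ, hδ, hside⟩ := exists_sideFun_le hα hα2 (isCompact_closure_numRange A) hA
  rw [mem_sector_iff hα hα2] at hz
  push Not at hz
  obtain ⟨ε, hε, hz⟩ := hz
  refine isUnit_of_coercive (norm_sideNormal (θ := θ) (α := α) hε) hδ
    (coercive_sub_of_numRange fun w hw => ?_)
  rw [re_conj_sideNormal_mul_sub' (c := c)]
  linarith [hside w (subset_closure hw) ε hε]

/-- The spectrum of A lies in the sector, and q(A) is, up to a nonzero constant, a product of
factors A - k over the roots k of q. -/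
theorem isUnit_aeval [CompleteSpace H] (hα : 0 < α) (hα2 : α ≤ Real.pi / 2)
    {A : H →L[ℂ] H} (hA : closure (numRange A) ⊆ sector c θ α) {q : Polynomial ℂ} (hq : q ≠ 0)
    (h : ∀ z ∈ sector c θ α, q.eval z ≠ 0) : IsUnit (Polynomial.aeval A q) := by
  have hprod := (IsAlgClosed.splits q).eq_prod_roots
  rw [hprod, map_mul, Polynomial.aeval_C]
  refine IsUnit.mul ((isUnit_iff_ne_zero.2 (Polynomial.leadingCoeff_ne_zero.2 hq)).map _) ?_
  by_contra hn
  obtain ⟨k, hk, hk0⟩ := spectrum.exists_mem_of_not_isUnit_aeval_prod hn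
  refine h k ?_ hk0
  by_contra hkn
  exact hk (isUnit_algebraMap_sub hα hα2 hA hkn)

/-- The Cauchy integral formula for `r(A)`, and the vanishing of the conjugate Cauchy integral. -/
theorem operator_identity [CompleteSpace H] (hα : 0 < α) (hα2 : α ≤ Real.pi / 2) {r : RatFunc ℂ}
    (hr : ∀ z ∈ sector c θ α, ‖r.eval (RingHom.id ℂ) z‖ ≤ 1)
    {f h : frontier (sector c θ α) →ᵇ ℂ}
    (hf : ∀ z : frontier (sector c θ α), f z = r.eval (RingHom.id ℂ) z)
    (hh : h + doubleLayerOperator c θ hα hα2 h = f)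
    {A : H →L[ℂ] H} (hA : closure (numRange A) ⊆ sector c θ α) :
    ∃ z, z = rayPoint c (θ + α / 2) 1 ∧
      (∀ g : frontier (sector c θ α) →ᵇ ℂ, Integrable (fun σ : frontier (sector c θ α) =>
        (g σ * outwardNormal (sector c θ α) σ) •
          resolventDiff ((σ : ℂ) - z) (A - algebraMap ℂ (H →L[ℂ] H) z))
        (arclength (sector c θ α))) ∧
      algebraMap ℂ (H →L[ℂ] H) (2 * Real.pi * r.eval (RingHom.id ℂ) z) +
        ∫ σ : frontier (sector c θ α), (h σ * outwardNormal (sector c θ α) σ) •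
          resolventDiff ((σ : ℂ) - z) (A - algebraMap ℂ (H →L[ℂ] H) z)
          ∂(arclength (sector c θ α)) = (2 * Real.pi : ℂ) • ratEval r A ∧
      ∫ σ : frontier (sector c θ α), (star h σ * outwardNormal (sector c θ α) σ) •
          resolventDiff ((σ : ℂ) - z) (A - algebraMap ℂ (H →L[ℂ] H) z)
          ∂(arclength (sector c θ α)) = 0 := by
  obtain ⟨ρ, hρ, hsc⟩ := scalar_identity hα hα2 hr hf hh
  refine ⟨_, rfl, ?_⟩
  set z := rayPoint c (θ + α / 2) 1 with hz
  have hmem : z ∈ sector c θ α :=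
    rayPoint_mem_sector hα hα2 (by linarith) (by linarith) one_pos
  obtain ⟨κ, hκ, hle⟩ := exists_le_norm_sub hα hα2 hmem
  obtain ⟨C, U, hU, hUc, h0, h1, hb⟩ := exists_resolventBound hα hα2 hmem hA
  set T : H →L[ℂ] H := A - algebraMap ℂ (H →L[ℂ] H) z with hT
  have hcomp : ∀ p : Polynomial ℂ, Polynomial.aeval T (p.comp (Polynomial.X + Polynomial.C z)) =
      Polynomial.aeval A p := by
    intro p
    rw [Polynomial.aeval_comp, map_add, Polynomial.aeval_X, Polynomial.aeval_C, hT, sub_add_cancel]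
  refine ⟨fun g => ?_, ?_, ?_⟩
  · have := (cauchyData_sector hα hα2 hκ hle g).integrable_smul_resolventDiff (hb 1 h1)
    rwa [one_smul] at this
  -- The scalar identity is multiplied by the denominator of r to become polynomial. It is shifted
  -- to the base point, so that the polynomials act on A - z.
  · have key := (cauchyData_sector hα hα2 hκ hle h).identity
      (r₀ := 2 * Real.pi * r.eval (RingHom.id ℂ) z)
      (P := Polynomial.C (2 * Real.pi : ℂ) * r.num.comp (Polynomial.X + Polynomial.C z))
      (Q := r.denom.comp (Polynomial.X + Polynomial.C z)) hρ (fun ζ hζ => by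
        obtain ⟨e1, e2, -⟩ := hsc ζ hζ
        rw [e2, ratFunc_eval_eq]
        simp only [Polynomial.eval_comp, Polynomial.eval_add, Polynomial.eval_X,
          Polynomial.eval_C, Polynomial.eval_mul]
        rw [add_comm z ζ] at e1 ⊢
        field_simp) hU hUc h0 h1 hb
    rw [hcomp, map_mul (Polynomial.aeval T), hcomp, Polynomial.aeval_C] at key
    have hunit : IsUnit (Polynomial.aeval A r.denom) := isUnit_aeval hα hα2 hA r.denom_ne_zero
      fun z hz => (ratFunc_denom_ne_zero_and_norm_eval_le (isOpen_sector hα hα2) hr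
        (subset_closure hz)).1
    have hcomm : Commute (Polynomial.aeval A r.denom) (Polynomial.aeval A r.num) := by
      rw [Commute, SemiconjBy, ← map_mul, ← map_mul, mul_comm]
    refine hunit.mul_left_cancel (key.trans ?_)
    rw [ratEval, mul_smul_comm, ← mul_assoc, hcomm.eq, mul_assoc, Ring.mul_inverse_cancel _ hunit,
      mul_one, Algebra.smul_def]
  · have key := (cauchyData_sector hα hα2 hκ hle (star h)).identity
      (r₀ := 0) (P := 0) (Q := 1) hρ (fun ζ hζ => by
        rw [(hsc ζ hζ).2.2]
        simp) hU hUc h0 h1 hb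
    simpa using key

end OperatorCalculus

theorem ratEval_one {H : Type*} [NormedAddCommGroup H] [InnerProductSpace ℂ H] (A : H →L[ℂ] H) :
    ratEval 1 A = 1 := by
  simp [ratEval]

/-! ### The positive operator density. -/

section PoissonOperator

variable {H : Type*} [NormedAddCommGroup H] [InnerProductSpace ℂ H] [CompleteSpace H]

/-- The operator valued density `(1 / 2π) (ν (σ - A)⁻¹ + (ν (σ - A)⁻¹)†)`. -/
noncomputable def poissonOperator (Ω : Set ℂ) (A : H →L[ℂ] H) (σ : ℂ) : H →L[ℂ] H :=
  ((2 * Real.pi : ℂ)⁻¹) • (outwardNormal Ω σ • Ring.inverse (algebraMap ℂ (H →L[ℂ] H) σ - A) +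
    ContinuousLinearMap.adjoint
      (outwardNormal Ω σ • Ring.inverse (algebraMap ℂ (H →L[ℂ] H) σ - A)))

theorem two_pi_mul_inner_poissonOperator (Ω : Set ℂ) (A : H →L[ℂ] H) (σ : ℂ) (y x : H) :
    2 * Real.pi * inner ℂ y (poissonOperator Ω A σ x) =
      outwardNormal Ω σ * inner ℂ y (Ring.inverse (algebraMap ℂ (H →L[ℂ] H) σ - A) x) +
      conj (outwardNormal Ω σ *
        inner ℂ x (Ring.inverse (algebraMap ℂ (H →L[ℂ] H) σ - A) y)) := by
  have hpi : (2 * Real.pi : ℂ) ≠ 0 := mul_ne_zero two_ne_zero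
    (Complex.ofReal_ne_zero.2 Real.pi_ne_zero)
  rw [poissonOperator, smul_apply, inner_smul_right, mul_inv_cancel_left₀ hpi, add_apply,
    inner_add_right, ContinuousLinearMap.adjoint_inner_right, smul_apply, smul_apply,
    inner_smul_right, inner_smul_left, map_mul, inner_conj_symm]

theorem conj_inner_poissonOperator (Ω : Set ℂ) (A : H →L[ℂ] H) (σ : ℂ) (y x : H) :
    conj (inner ℂ y (poissonOperator Ω A σ x)) = inner ℂ x (poissonOperator Ω A σ y) := by
  have hpi : (2 * Real.pi : ℂ) ≠ 0 := mul_ne_zero two_ne_zero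
    (Complex.ofReal_ne_zero.2 Real.pi_ne_zero)
  have h1 := congrArg conj (two_pi_mul_inner_poissonOperator Ω A σ y x)
  have h2 := two_pi_mul_inner_poissonOperator Ω A σ x y
  rw [map_mul, map_add, Complex.conj_conj, map_mul, Complex.conj_ofReal, map_ofNat, add_comm] at h1
  exact mul_left_cancel₀ hpi (h1.trans h2.symm)

variable {c : ℂ} {θ α : ℝ}

/-- With v = (σ - A)⁻¹x, the real part of ν⟨x, v⟩ is that of its conjugate ν̄⟨v, (σ - A)v⟩. The
latter is nonnegative because W(A) lies in the half-plane supporting the sector at σ. -/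
theorem ae_poissonOperator_nonneg (hα : 0 < α) (hα2 : α ≤ Real.pi / 2) {A : H →L[ℂ] H}
    (hA : closure (numRange A) ⊆ sector c θ α) :
    ∀ᵐ σ : frontier (sector c θ α) ∂(arclength (sector c θ α)),
      ∀ x, 0 ≤ (inner ℂ x (poissonOperator (sector c θ α) A σ x)).re := by
  obtain ⟨δ, hδ, hside⟩ := exists_sideFun_le hα hα2 (isCompact_closure_numRange A) hA
  refine ae_arclength_of_forall_sidePoint hα hα2 fun {ε} hε {t} ht x => ?_
  have hco := fun x => coercive_sub_of_numRange (X := A) (n := sideNormal θ α ε)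
    (z := (sidePoint c θ hα hα2 hε t : ℂ)) (δ := δ) (fun w hw => by
      rw [re_conj_sideNormal_mul_sub hα hα2 hε ht.le]
      linarith [hside w (subset_closure hw) ε hε]) x
  have hu := isUnit_of_coercive (norm_sideNormal hε) hδ hco
  set σ : ℂ := (sidePoint c θ hα hα2 hε t : ℂ) with hσ
  have hν : outwardNormal (sector c θ α) σ = sideNormal θ α ε := by
    rw [hσ, coe_sidePoint hα hα2 hε ht.le, outwardNormal_rayPoint hα hα2 hε ht]
  have h1 := congrArg Complex.re (two_pi_mul_inner_poissonOperator (sector c θ α) A σ x x)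
  set v := Ring.inverse (algebraMap ℂ (H →L[ℂ] H) σ - A) x with hv
  have hx : (algebraMap ℂ (H →L[ℂ] H) σ - A) v = x :=
    congrArg (fun T : H →L[ℂ] H => T x) (Ring.mul_inverse_cancel _ hu)
  have h2 := hco v
  rw [hx, ← Complex.conj_re, map_mul, Complex.conj_conj, inner_conj_symm] at h2
  have e : (2 * Real.pi : ℂ) = ((2 * Real.pi : ℝ) : ℂ) := by push_cast; rfl
  rw [e, Complex.re_ofReal_mul, Complex.add_re, Complex.conj_re, hν] at h1
  have h3 : 0 ≤ δ * ‖v‖ ^ 2 := by positivity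
  have hpi := Real.pi_pos
  have h4 : 0 ≤ 2 * Real.pi * (inner ℂ x (poissonOperator (sector c θ α) A σ x)).re := by
    rw [h1]
    linarith
  exact nonneg_of_mul_nonneg_right h4 (by positivity)

/-- The functional calculus as an integral against the operator valued density. -/
theorem integral_mul_inner_poissonOperator (hα : 0 < α) (hα2 : α ≤ Real.pi / 2) {r : RatFunc ℂ}
    (hr : ∀ z ∈ sector c θ α, ‖r.eval (RingHom.id ℂ) z‖ ≤ 1)
    {f h : frontier (sector c θ α) →ᵇ ℂ}
    (hf : ∀ z : frontier (sector c θ α), f z = r.eval (RingHom.id ℂ) z)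
    (hh : h + doubleLayerOperator c θ hα hα2 h = f)
    {A : H →L[ℂ] H} (hA : closure (numRange A) ⊆ sector c θ α) (y x : H) :
    Integrable (fun σ : frontier (sector c θ α) =>
      h σ * inner ℂ y (poissonOperator (sector c θ α) A σ x)) (arclength (sector c θ α)) ∧
    ∫ σ : frontier (sector c θ α), h σ * inner ℂ y (poissonOperator (sector c θ α) A σ x)
      ∂(arclength (sector c θ α)) = inner ℂ y (ratEval r A x) := by
  have hpi : (2 * Real.pi : ℂ) ≠ 0 := mul_ne_zero two_ne_zero
    (Complex.ofReal_ne_zero.2 Real.pi_ne_zero)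
  obtain ⟨z, hz, hint, e1, e2⟩ := operator_identity hα hα2 hr hf hh hA
  obtain ⟨j1, j2⟩ := integral_solution hα hα2 hr hf hh one_pos (half_pos hα) (half_lt_self hα)
  rw [← hz] at j1 j2
  set L : H → H → (H →L[ℂ] H) →L[ℂ] ℂ := fun y x =>
    (innerSL ℂ y).comp (ContinuousLinearMap.apply ℂ H x) with hL
  have hLa : ∀ y x (X : H →L[ℂ] H), L y x X = inner ℂ y (X x) := fun _ _ _ => rfl
  have hLalg : ∀ y x (b : ℂ), L y x (algebraMap ℂ (H →L[ℂ] H) b) = b * inner ℂ y x := by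
    intro y x b
    rw [hLa, Algebra.algebraMap_eq_smul_one, smul_apply, inner_smul_right]
    rfl
  set S : ℂ → H →L[ℂ] H := fun σ =>
    resolventDiff (σ - z) (A - algebraMap ℂ (H →L[ℂ] H) z) with hS
  have hSL : ∀ (σ : ℂ) y x, L y x (S σ) =
      inner ℂ y (Ring.inverse (algebraMap ℂ (H →L[ℂ] H) σ - A) x) - (σ - z)⁻¹ * inner ℂ y x := by
    intro σ y x
    rw [hS]
    simp only [resolventDiff]
    rw [map_sub (L y x), hLalg, hLa, map_sub, sub_sub_sub_cancel_right]
  have i1 : Integrable (fun σ : frontier (sector c θ α) =>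
      h σ * outwardNormal (sector c θ α) σ * L y x (S σ)) (arclength (sector c θ α)) := by
    simpa only [map_smul, smul_eq_mul] using (L y x).integrable_comp (hint h)
  have i2 : Integrable (fun σ : frontier (sector c θ α) =>
      conj (star h σ * outwardNormal (sector c θ α) σ * L x y (S σ)))
      (arclength (sector c θ α)) := by
    refine (LinearIsometryEquiv.integrable_comp_iff Complex.conjLIE).2 ?_
    simpa only [map_smul, smul_eq_mul] using (L x y).integrable_comp (hint (star h))
  have k1 : 2 * Real.pi * r.eval (RingHom.id ℂ) z * inner ℂ y x +
      ∫ σ : frontier (sector c θ α), h σ * outwardNormal (sector c θ α) σ * L y x (S σ)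
        ∂(arclength (sector c θ α)) = 2 * Real.pi * inner ℂ y (ratEval r A x) := by
    have := congrArg (L y x) e1
    rw [map_add, hLalg, ← (L y x).integral_comp_comm (hint h), map_smul, hLa] at this
    simpa only [map_smul, smul_eq_mul] using this
  have k2 : ∫ σ : frontier (sector c θ α),
      conj (star h σ * outwardNormal (sector c θ α) σ * L x y (S σ))
        ∂(arclength (sector c θ α)) = 0 := by
    have := congrArg (L x y) e2
    rw [← (L x y).integral_comp_comm (hint (star h)), map_zero] at this
    simp only [map_smul, smul_eq_mul] at this
    rw [integral_conj, this, map_zero]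
  -- The density splits into the increment of the resolvent from the base point, its adjoint
  -- counterpart, and the scalar kernel at the base point. Against h they give the Cauchy part of
  -- r(A), zero, and r(z).
  have hpt : ∀ σ : frontier (sector c θ α),
      h σ * inner ℂ y (poissonOperator (sector c θ α) A σ x) =
      (2 * Real.pi : ℂ)⁻¹ * ((h σ * outwardNormal (sector c θ α) σ * L y x (S σ) +
        conj (star h σ * outwardNormal (sector c θ α) σ * L x y (S σ))) +
        2 * Real.pi * inner ℂ y x * ((doubleLayerKernel (sector c θ α) σ z : ℂ) * h σ)) := by
    intro σ
    have h1 := two_pi_mul_inner_poissonOperator (sector c θ α) A σ y x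
    have h2 : 2 * Real.pi * (doubleLayerKernel (sector c θ α) σ z : ℂ) =
        outwardNormal (sector c θ α) σ * ((σ : ℂ) - z)⁻¹ +
        conj (outwardNormal (sector c θ α) σ * ((σ : ℂ) - z)⁻¹) := by
      rw [Complex.add_conj, doubleLayerKernel, ← div_eq_mul_inv]
      have : (Real.pi : ℂ) ≠ 0 := Complex.ofReal_ne_zero.2 Real.pi_ne_zero
      push_cast
      field_simp
    rw [eq_inv_mul_iff_mul_eq₀ hpi, hSL, hSL]
    simp only [map_mul, map_sub, BoundedContinuousFunction.star_apply, RCLike.star_def,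
      Complex.conj_conj, inner_conj_symm] at h1 h2 ⊢
    linear_combination h σ * h1 - h σ * inner ℂ y x * h2
  simp only [hpt]
  have i3 := (i1.add i2).add (j1.const_mul (2 * Real.pi * inner ℂ y x))
  refine ⟨i3.const_mul _, ?_⟩
  rw [integral_const_mul, inv_mul_eq_iff_eq_mul₀ hpi]
  have i4 := integral_add (i1.add i2) (j1.const_mul (2 * Real.pi * inner ℂ y x))
  have i5 := integral_add i1 i2
  simp only [Pi.add_apply] at i4 i5
  rw [i4, i5, k2, add_zero, integral_const_mul, j2, ← k1]
  ring

/-- The factor is 1 + (π - 2α)/π, from the mass of the strip kernel. -/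
theorem add_doubleLayerOperator_const (hα : 0 < α) (hα2 : α ≤ Real.pi / 2) (k : ℂ) :
    BoundedContinuousFunction.const (frontier (sector c θ α)) k +
      doubleLayerOperator c θ hα hα2 (BoundedContinuousFunction.const _ k) =
      BoundedContinuousFunction.const _ (((2 * (Real.pi - α) / Real.pi : ℝ) : ℂ) * k) := by
  have hpi := Real.pi_pos
  ext z
  obtain ⟨ε, hε, t, ht, rfl⟩ := exists_eq_sidePoint hα hα2 z
  rw [BoundedContinuousFunction.add_apply, doubleLayerOperator_sidePoint hα hα2 _ hε ht]
  simp only [BoundedContinuousFunction.const_apply]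
  rw [integral_mul_const, integral_stripKernel (by linarith) (by linarith)]
  have : (Real.pi : ℂ) ≠ 0 := Complex.ofReal_ne_zero.2 Real.pi_ne_zero
  push_cast
  field_simp
  ring

/-- The total mass of the operator valued density. -/
theorem integral_inner_poissonOperator (hα : 0 < α) (hα2 : α ≤ Real.pi / 2) {A : H →L[ℂ] H}
    (hA : closure (numRange A) ⊆ sector c θ α) (y x : H) :
    Integrable (fun σ : frontier (sector c θ α) =>
      inner ℂ y (poissonOperator (sector c θ α) A σ x)) (arclength (sector c θ α)) ∧
    ∫ σ : frontier (sector c θ α), inner ℂ y (poissonOperator (sector c θ α) A σ x)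
      ∂(arclength (sector c θ α)) = ((2 * (Real.pi - α) / Real.pi : ℝ) : ℂ) * inner ℂ y x := by
  have hpi := Real.pi_pos
  set m : ℂ := ((2 * (Real.pi - α) / Real.pi : ℝ) : ℂ) with hm
  have hm0 : m ≠ 0 := by
    rw [hm, Complex.ofReal_ne_zero]
    have : 0 < Real.pi - α := by linarith
    positivity
  -- For r = 1 the solution is the constant 1/m, so the total mass of the density is m times the
  -- identity.
  obtain ⟨h1, h2⟩ := integral_mul_inner_poissonOperator hα hα2 (r := 1)
    (f := BoundedContinuousFunction.const _ 1)
    (h := BoundedContinuousFunction.const _ m⁻¹) (by simp [RatFunc.eval_one]) (by simp)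
    (by rw [add_doubleLayerOperator_const, ← hm, mul_inv_cancel₀ hm0]) hA y x
  simp only [BoundedContinuousFunction.const_apply] at h1 h2
  rw [integral_const_mul, ratEval_one, inv_mul_eq_iff_eq_mul₀ hm0] at h2
  exact ⟨(integrable_const_mul_iff (isUnit_iff_ne_zero.2 (inv_ne_zero hm0)) _).1 h1, h2⟩

end PoissonOperator

/-- Evaluation of rational functions is additive only away from poles; the reduced denominator of
the sum divides the product of the denominators. -/
theorem exists_ratFunc_eval_eq_sum {ι : Type*} (s : Finset ι) (k : ι → ℂ) (r : ι → RatFunc ℂ) :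
    ∃ q : RatFunc ℂ, ∀ z : ℂ, (∀ i, (r i).denom.eval z ≠ 0) → q.denom.eval z ≠ 0 ∧
      q.eval (RingHom.id ℂ) z = ∑ i ∈ s, k i * (r i).eval (RingHom.id ℂ) z := by
  classical
  have hmul : ∀ i, ∀ z : ℂ, (r i).denom.eval z ≠ 0 →
      (RatFunc.C (k i) * r i).denom.eval z ≠ 0 ∧
      (RatFunc.C (k i) * r i).eval (RingHom.id ℂ) z = k i * (r i).eval (RingHom.id ℂ) z := by
    intro i z hz
    constructor
    · obtain ⟨p, hp⟩ := RatFunc.denom_mul_dvd (RatFunc.C (k i)) (r i)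
      rw [RatFunc.denom_C, one_mul] at hp
      rw [hp, Polynomial.eval_mul] at hz
      exact left_ne_zero_of_mul hz
    · rw [RatFunc.eval_mul _ _ (by simp [RatFunc.denom_C])
        (by simpa [Polynomial.eval₂_id] using hz), RatFunc.eval_C, RingHom.id_apply]
  refine ⟨∑ i ∈ s, RatFunc.C (k i) * r i, fun z hz => ?_⟩
  induction s using Finset.induction_on with
  | empty => simp
  | insert a s ha ih =>
    rw [Finset.sum_insert ha, Finset.sum_insert ha]
    obtain ⟨h1, h2⟩ := hmul a z (hz a)
    constructor
    · obtain ⟨p, hp⟩ := RatFunc.denom_add_dvd (RatFunc.C (k a) * r a)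
        (∑ i ∈ s, RatFunc.C (k i) * r i)
      have h3 := mul_ne_zero h1 ih.1
      rw [← Polynomial.eval_mul, hp, Polynomial.eval_mul] at h3
      exact left_ne_zero_of_mul h3
    · rw [RatFunc.eval_add _ _ (by simpa [Polynomial.eval₂_id] using h1)
        (by simpa [Polynomial.eval₂_id] using ih.1), h2, ih.2]

/-! ### Sesquilinear forms of matrices and positive operators. -/

section MatrixForms

variable {m n : ℕ}

/-- Cauchy–Schwarz followed by the inequality between geometric and arithmetic means. Sums of
squares, unlike products of norms, can be added over the Gram vectors and integrated. -/
theorem norm_sum_sum_le_of_matrixNorm_le {M : Matrix (Fin m) (Fin n) ℂ} (hM : matrixNorm M ≤ 1)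
    (v : Fin m → ℂ) (w : Fin n → ℂ) :
    ‖∑ i, ∑ j, conj (v i) * w j * M i j‖ ≤ (∑ i, ‖v i‖ ^ 2 + ∑ j, ‖w j‖ ^ 2) / 2 := by
  set V : EuclideanSpace ℂ (Fin m) := WithLp.toLp 2 v with hV
  set W : EuclideanSpace ℂ (Fin n) := WithLp.toLp 2 w with hW
  have e : ∑ i, ∑ j, conj (v i) * w j * M i j =
      inner ℂ V ((Matrix.toEuclideanLin M).toContinuousLinearMap W) := by
    rw [PiLp.inner_apply]
    refine Finset.sum_congr rfl fun i _ => ?_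
    rw [LinearMap.coe_toContinuousLinearMap', Matrix.toLpLin_apply]
    simp only [hV, hW, Matrix.mulVec, dotProduct, RCLike.inner_apply, Finset.sum_mul]
    refine Finset.sum_congr rfl fun j _ => ?_
    ring
  have hv : ∑ i, ‖v i‖ ^ 2 = ‖V‖ ^ 2 := (EuclideanSpace.norm_sq_eq V).symm
  have hw : ∑ j, ‖w j‖ ^ 2 = ‖W‖ ^ 2 := (EuclideanSpace.norm_sq_eq W).symm
  rw [e, hv, hw]
  have h1 : ‖(Matrix.toEuclideanLin M).toContinuousLinearMap W‖ ≤ 1 * ‖W‖ :=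
    ContinuousLinearMap.le_of_opNorm_le _ hM W
  have h2 := norm_inner_le_norm (𝕜 := ℂ) V ((Matrix.toEuclideanLin M).toContinuousLinearMap W)
  have h3 := mul_le_mul_of_nonneg_left h1 (norm_nonneg V)
  nlinarith [sq_nonneg (‖V‖ - ‖W‖)]

theorem norm_entry_le_one {M : Matrix (Fin m) (Fin n) ℂ} (hM : matrixNorm M ≤ 1) (i : Fin m)
    (j : Fin n) : ‖M i j‖ ≤ 1 := by
  have := norm_sum_sum_le_of_matrixNorm_le hM (Pi.single i 1) (Pi.single j 1)
  have e1 : ∑ a, ∑ b, conj ((Pi.single i 1 : Fin m → ℂ) a) * (Pi.single j 1 : Fin n → ℂ) b * M a b =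
      M i j := by
    rw [Finset.sum_eq_single i (fun a _ ha => by simp [Pi.single_eq_of_ne ha]) (by simp),
      Finset.sum_eq_single j (fun b _ hb => by simp [Pi.single_eq_of_ne hb]) (by simp)]
    simp
  have e2 : ∀ {k : ℕ} (i : Fin k), ∑ a, ‖(Pi.single i 1 : Fin k → ℂ) a‖ ^ 2 = 1 := by
    intro k i
    rw [Finset.sum_eq_single i (fun a _ ha => by simp [Pi.single_eq_of_ne ha]) (by simp)]
    simp
  rw [e1, e2, e2] at this
  linarith

open scoped ComplexOrder in
/-- A positive operator has Gram matrices of the form `∑ vₖ vₖ*`. -/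
theorem exists_gram {H : Type*} [NormedAddCommGroup H] [InnerProductSpace ℂ H] {M : H →L[ℂ] H}
    (hM : ∀ y x, conj (inner ℂ y (M x)) = inner ℂ x (M y)) (hM0 : ∀ x, 0 ≤ (inner ℂ x (M x)).re)
    {ι : Type*} [Fintype ι] (w : ι → H) :
    ∃ (d : ℕ) (v : Fin d → ι → ℂ), ∀ p q, inner ℂ (w p) (M (w q)) = ∑ k, v k p * conj (v k q) := by
  set G : Matrix ι ι ℂ := fun p q => inner ℂ (w p) (M (w q)) with hG
  have hpos : G.PosSemidef := by
    refine Matrix.PosSemidef.of_dotProduct_mulVec_nonneg ?_ fun x => ?_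
    · ext p q
      exact hM _ _
    · have e : dotProduct (star x) (G.mulVec x) =
          inner ℂ (∑ p, x p • w p) (M (∑ p, x p • w p)) := by
        simp only [dotProduct, Matrix.mulVec, map_sum, map_smul, sum_inner, inner_sum,
          inner_smul_left, inner_smul_right, hG, Pi.star_apply, RCLike.star_def, Finset.mul_sum]
        rw [Finset.sum_comm]
        refine Finset.sum_congr rfl fun p _ => Finset.sum_congr rfl fun q _ => ?_
        ring
      rw [e, Complex.le_def]
      exact ⟨hM0 _, (Complex.conj_eq_iff_im.1 (hM _ _)).symm⟩
  obtain ⟨d, v, hv⟩ := Matrix.posSemidef_iff_eq_sum_vecMulVec.1 hpos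
  refine ⟨d, v, fun p q => ?_⟩
  have := congrFun (congrFun hv p) q
  rw [Matrix.sum_apply] at this
  simpa [Matrix.vecMulVec_apply] using this

/-- A bound for a sesquilinear form extends to vectors measured by a positive operator. -/
theorem norm_sum_sum_mul_inner_le {H : Type*} [NormedAddCommGroup H] [InnerProductSpace ℂ H]
    {M : H →L[ℂ] H} (hM : ∀ y x, conj (inner ℂ y (M x)) = inner ℂ x (M y))
    (hM0 : ∀ x, 0 ≤ (inner ℂ x (M x)).re) {h : Fin m → Fin n → ℂ} {K : ℝ}
    (hK : ∀ (v : Fin m → ℂ) (w : Fin n → ℂ), ‖∑ i, ∑ j, conj (v i) * w j * h i j‖ ≤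
      K * (∑ i, ‖v i‖ ^ 2 + ∑ j, ‖w j‖ ^ 2)) (y : Fin m → H) (x : Fin n → H) :
    ‖∑ i, ∑ j, h i j * inner ℂ (y i) (M (x j))‖ ≤
      K * (∑ i, (inner ℂ (y i) (M (y i))).re + ∑ j, (inner ℂ (x j) (M (x j))).re) := by
  obtain ⟨d, v, hv⟩ := exists_gram hM hM0 (Sum.elim y x)
  have e1 : ∀ i j, inner ℂ (y i) (M (x j)) = ∑ k, v k (Sum.inl i) * conj (v k (Sum.inr j)) :=
    fun i j => hv (Sum.inl i) (Sum.inr j)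
  have e2 : ∀ i, (inner ℂ (y i) (M (y i))).re = ∑ k, ‖conj (v k (Sum.inl i))‖ ^ 2 := by
    intro i
    have := hv (Sum.inl i) (Sum.inl i)
    simp only [Sum.elim_inl, Complex.mul_conj'] at this
    rw [this]
    simp only [RCLike.norm_conj]
    exact_mod_cast rfl
  have e3 : ∀ j, (inner ℂ (x j) (M (x j))).re = ∑ k, ‖conj (v k (Sum.inr j))‖ ^ 2 := by
    intro j
    have := hv (Sum.inr j) (Sum.inr j)
    simp only [Sum.elim_inr, Complex.mul_conj'] at this
    rw [this]
    simp only [RCLike.norm_conj]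
    exact_mod_cast rfl
  have e4 : ∑ i, ∑ j, h i j * inner ℂ (y i) (M (x j)) = ∑ k, ∑ i, ∑ j,
      conj (conj (v k (Sum.inl i))) * conj (v k (Sum.inr j)) * h i j := by
    refine Eq.symm (Finset.sum_comm.trans (Finset.sum_congr rfl fun i _ =>
      Finset.sum_comm.trans (Finset.sum_congr rfl fun j _ => ?_)))
    rw [e1, Finset.mul_sum]
    refine Finset.sum_congr rfl fun k _ => ?_
    rw [Complex.conj_conj]
    ring
  have e5 : ∑ i, ∑ k, ‖conj (v k (Sum.inl i))‖ ^ 2 + ∑ j, ∑ k, ‖conj (v k (Sum.inr j))‖ ^ 2 =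
      ∑ k, (∑ i, ‖conj (v k (Sum.inl i))‖ ^ 2 + ∑ j, ‖conj (v k (Sum.inr j))‖ ^ 2) := by
    rw [Finset.sum_add_distrib]
    exact congrArg₂ (· + ·) Finset.sum_comm Finset.sum_comm
  rw [e4]
  simp only [e2, e3]
  rw [e5, Finset.mul_sum]
  exact (norm_sum_le _ _).trans (Finset.sum_le_sum fun k _ => hK _ _)

end MatrixForms

/-! ### The complete bound. -/

section CompleteBound

variable {c : ℂ} {θ α : ℝ} {m n : ℕ}

/-- Finiteness of `constN`, known from the explicit bound, is what allows the passage to real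
numbers. -/
theorem norm_solution_le (hα : 0 < α) (hα2 : α ≤ Real.pi / 2) {r : RatFunc ℂ}
    (hr : ∀ z ∈ sector c θ α, ‖r.eval (RingHom.id ℂ) z‖ ≤ 1)
    {f h : frontier (sector c θ α) →ᵇ ℂ}
    (hf : ∀ z : frontier (sector c θ α), f z = r.eval (RingHom.id ℂ) z)
    (hh : h + doubleLayerOperator c θ hα hα2 h = f) :
    ‖h‖ ≤ (constN (sector c θ α)).toReal / 2 := by
  have hle : ENNReal.ofReal (2 * ‖h‖) ≤ constN (sector c θ α) :=
    le_sSup ⟨r, f, h, hr, hf, (isDoubleLayer_sub_iff hα hα2 f h).2 hh, rfl⟩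
  have hfin : constN (sector c θ α) ≠ ⊤ :=
    ((constN_sector_le hα hα2).trans_lt ENNReal.ofReal_lt_top).ne
  have := (ENNReal.ofReal_le_iff_le_toReal hfin).1 hle
  linarith

/-- The bound by `constN` for the solutions with matrix valued data. -/
theorem norm_sum_sum_solution_le (hα : 0 < α) (hα2 : α ≤ Real.pi / 2)
    {R : Matrix (Fin m) (Fin n) (RatFunc ℂ)}
    (hR : ∀ z ∈ sector c θ α, matrixNorm (R.map fun r => r.eval (RingHom.id ℂ) z) ≤ 1)
    {f h : Fin m → Fin n → frontier (sector c θ α) →ᵇ ℂ}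
    (hf : ∀ i j (z : frontier (sector c θ α)), f i j z = (R i j).eval (RingHom.id ℂ) z)
    (hh : ∀ i j, h i j + doubleLayerOperator c θ hα hα2 (h i j) = f i j)
    (σ : frontier (sector c θ α)) (v : Fin m → ℂ) (w : Fin n → ℂ) :
    ‖∑ i, ∑ j, conj (v i) * w j * h i j σ‖ ≤
      (constN (sector c θ α)).toReal / 4 * (∑ i, ‖v i‖ ^ 2 + ∑ j, ‖w j‖ ^ 2) := by
  have hden : ∀ i j, ∀ z ∈ closure (sector c θ α), (R i j).denom.eval z ≠ 0 := fun i j z hz =>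
    (ratFunc_denom_ne_zero_and_norm_eval_le (isOpen_sector hα hα2)
      (fun z hz => norm_entry_le_one (hR z hz) i j) hz).1
  -- With this normalization the scalar rational function v*Rw is bounded by 1. Its solution is the
  -- same combination of the h i j by linearity.
  have key : ∀ (v : Fin m → ℂ) (w : Fin n → ℂ), ∑ i, ‖v i‖ ^ 2 + ∑ j, ‖w j‖ ^ 2 = 2 →
      ‖∑ i, ∑ j, conj (v i) * w j * h i j σ‖ ≤ (constN (sector c θ α)).toReal / 2 := by
    intro v w hvw
    obtain ⟨q, hq⟩ := exists_ratFunc_eval_eq_sum (Finset.univ : Finset (Fin m × Fin n))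
      (fun p => conj (v p.1) * w p.2) (fun p => R p.1 p.2)
    have hqe : ∀ z ∈ closure (sector c θ α), q.eval (RingHom.id ℂ) z =
        ∑ i, ∑ j, conj (v i) * w j * (R i j).eval (RingHom.id ℂ) z := by
      intro z hz
      rw [(hq z fun p => hden _ _ z hz).2, Fintype.sum_prod_type]
    have hle := norm_solution_le (r := q) hα hα2 (fun z hz => by
        rw [hqe z (subset_closure hz)]
        refine (norm_sum_sum_le_of_matrixNorm_le (hR z hz) v w).trans_eq ?_
        rw [hvw]
        norm_num)
      (f := ∑ i, ∑ j, (conj (v i) * w j) • f i j) (h := ∑ i, ∑ j, (conj (v i) * w j) • h i j)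
      (fun z => by
        rw [hqe z (frontier_subset_closure z.2)]
        simp only [BoundedContinuousFunction.sum_apply, BoundedContinuousFunction.smul_apply,
          smul_eq_mul, hf])
      (by
        simp only [map_sum, map_smul, ← Finset.sum_add_distrib, ← smul_add, hh])
    refine le_trans ?_ ((BoundedContinuousFunction.norm_coe_le_norm _ σ).trans hle)
    simp only [BoundedContinuousFunction.sum_apply, BoundedContinuousFunction.smul_apply,
      smul_eq_mul, le_refl]
  set q : ℝ := ∑ i, ‖v i‖ ^ 2 + ∑ j, ‖w j‖ ^ 2 with hq
  have hA : 0 ≤ ∑ i, ‖v i‖ ^ 2 := Finset.sum_nonneg fun i _ => by positivity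
  have hB : 0 ≤ ∑ j, ‖w j‖ ^ 2 := Finset.sum_nonneg fun i _ => by positivity
  rcases (add_nonneg hA hB).eq_or_lt with h0 | h0
  · have hv : ∀ i, v i = 0 := by
      have h1 : ∑ i, ‖v i‖ ^ 2 = 0 := by linarith
      intro i
      simpa using (Finset.sum_eq_zero_iff_of_nonneg fun i _ => by positivity).1 h1 i
        (Finset.mem_univ i)
    rw [hq, ← h0]
    simp [hv]
  · set s : ℝ := √(2 / q) with hs
    have hs2 : s ^ 2 = 2 / q := Real.sq_sqrt (by positivity)
    have hk := key (fun i => (s : ℂ) * v i) (fun j => (s : ℂ) * w j) (by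
      simp only [norm_mul, Complex.norm_real, mul_pow, Real.norm_eq_abs, sq_abs]
      rw [← Finset.mul_sum, ← Finset.mul_sum, ← mul_add, ← hq, hs2, div_mul_cancel₀ _ h0.ne'])
    have e : ∑ i, ∑ j, conj ((s : ℂ) * v i) * ((s : ℂ) * w j) * h i j σ =
        ((s ^ 2 : ℝ) : ℂ) * ∑ i, ∑ j, conj (v i) * w j * h i j σ := by
      simp only [Finset.mul_sum]
      refine Finset.sum_congr rfl fun i _ => Finset.sum_congr rfl fun j _ => ?_
      rw [map_mul, Complex.conj_ofReal]
      push_cast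
      ring
    rw [e, norm_mul, Complex.norm_real, hs2, Real.norm_of_nonneg (by positivity),
      div_mul_eq_mul_div, div_le_iff₀ h0] at hk
    linarith

variable {H : Type u} [NormedAddCommGroup H] [InnerProductSpace ℂ H]

theorem inner_blockOperator (T : Matrix (Fin m) (Fin n) (H →L[ℂ] H))
    (y : PiLp 2 fun _ : Fin m => H) (x : PiLp 2 fun _ : Fin n => H) :
    inner ℂ y (blockOperator T x) = ∑ i, ∑ j, inner ℂ (y i) (T i j (x j)) := by
  rw [PiLp.inner_apply]
  refine Finset.sum_congr rfl fun i _ => ?_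
  rw [← inner_sum]
  congr 1
  simp [blockOperator]

/-- The form of R(A) is the integral of the matrix of solutions against the positive density. The
pointwise bound C_N/4 for sums of squares is integrated with the mass 2(π - α)/π. -/
theorem norm_blockOperator_le [CompleteSpace H] (hα : 0 < α) (hα2 : α ≤ Real.pi / 2)
    {A : H →L[ℂ] H} (hA : closure (numRange A) ⊆ sector c θ α)
    {R : Matrix (Fin m) (Fin n) (RatFunc ℂ)}
    (hR : ∀ z ∈ sector c θ α, matrixNorm (R.map fun r => r.eval (RingHom.id ℂ) z) ≤ 1) :
    ‖blockOperator (R.map fun r => ratEval r A)‖ ≤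
      (Real.pi - α) / Real.pi * (constN (sector c θ α)).toReal := by
  have hpi := Real.pi_pos
  have hpα : 0 < Real.pi - α := by linarith
  set K : ℝ := (constN (sector c θ α)).toReal with hK
  have hent : ∀ i j, ∀ z ∈ sector c θ α, ‖(R i j).eval (RingHom.id ℂ) z‖ ≤ 1 :=
    fun i j z hz => norm_entry_le_one (hR z hz) i j
  choose f h hf hh _ using fun i j => exists_solution hα hα2 (hent i j)
  have hsol := norm_sum_sum_solution_le hα hα2 hR hf hh
  have hform : ∀ (y : PiLp 2 fun _ : Fin m => H) (x : PiLp 2 fun _ : Fin n => H),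
      ‖inner ℂ y (blockOperator (R.map fun r => ratEval r A) x)‖ ≤
        (Real.pi - α) / Real.pi * K * ((‖y‖ ^ 2 + ‖x‖ ^ 2) / 2) := by
    intro y x
    have hw := fun i j =>
      integral_mul_inner_poissonOperator hα hα2 (hent i j) (hf i j) (hh i j) hA (y i) (x j)
    have hre : ∀ v : H, Integrable (fun σ : frontier (sector c θ α) =>
          (inner ℂ v (poissonOperator (sector c θ α) A σ v)).re) (arclength (sector c θ α)) ∧
        ∫ σ : frontier (sector c θ α), (inner ℂ v (poissonOperator (sector c θ α) A σ v)).re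
          ∂(arclength (sector c θ α)) = 2 * (Real.pi - α) / Real.pi * ‖v‖ ^ 2 := by
      intro v
      obtain ⟨h1, h2⟩ := integral_inner_poissonOperator hα hα2 hA v v
      refine ⟨h1.re, ?_⟩
      have h3 := congrArg Complex.re h2
      rw [Complex.re_ofReal_mul, inner_self_eq_norm_sq_to_K] at h3
      have h4 : (((‖v‖ : ℝ) : ℂ) ^ 2).re = ‖v‖ ^ 2 := by
        rw [← Complex.ofReal_pow, Complex.ofReal_re]
      exact (integral_re h1).trans (h3.trans (congrArg _ h4))
    have e : inner ℂ y (blockOperator (R.map fun r => ratEval r A) x) =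
        ∫ σ : frontier (sector c θ α), ∑ i, ∑ j,
          h i j σ * inner ℂ (y i) (poissonOperator (sector c θ α) A σ (x j))
          ∂(arclength (sector c θ α)) := by
      rw [inner_blockOperator, integral_finsetSum _ fun i _ =>
        integrable_finsetSum _ fun j _ => (hw i j).1]
      refine Finset.sum_congr rfl fun i _ => ?_
      rw [integral_finsetSum _ fun j _ => (hw i j).1]
      exact Finset.sum_congr rfl fun j _ => (hw i j).2.symm
    have hb1 := integrable_finsetSum Finset.univ fun i _ => (hre (y i)).1
    have hb2 := integrable_finsetSum Finset.univ fun j _ => (hre (x j)).1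
    rw [e]
    refine (norm_integral_le_of_norm_le ((hb1.add hb2).const_mul (K / 4)) ?_).trans_eq ?_
    · filter_upwards [ae_poissonOperator_nonneg hα hα2 hA] with σ hσ
      exact norm_sum_sum_mul_inner_le (conj_inner_poissonOperator _ A σ) hσ (hsol σ) _ _
    · simp only [Pi.add_apply]
      rw [integral_const_mul, integral_add hb1 hb2, integral_finsetSum _ fun i _ => (hre (y i)).1,
        integral_finsetSum _ fun j _ => (hre (x j)).1]
      simp only [(hre _).2]
      rw [← Finset.mul_sum, ← Finset.mul_sum, ← PiLp.norm_sq_eq_of_L2, ← PiLp.norm_sq_eq_of_L2]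
      ring
  refine ContinuousLinearMap.opNorm_le_bound _ (by positivity) fun x => ?_
  set B := blockOperator (R.map fun r => ratEval r A) with hB
  rcases eq_or_ne (B x) 0 with h0 | h0
  · rw [h0, norm_zero]
    positivity
  have hx : x ≠ 0 := by
    rintro rfl
    exact h0 (map_zero _)
  have hn : 0 < ‖B x‖ := norm_pos_iff.2 h0
  have hxn : 0 < ‖x‖ := norm_pos_iff.2 hx
  -- The first vector is scaled to have norm ‖x‖, so that the arithmetic mean of the squares equals
  -- the product of the norms.
  have h1 := hform (((‖x‖ / ‖B x‖ : ℝ) : ℂ) • B x) x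
  rw [inner_smul_left, Complex.conj_ofReal, norm_mul, Complex.norm_real, norm_smul,
    Complex.norm_real, Real.norm_of_nonneg (by positivity), div_mul_cancel₀ _ hn.ne',
    inner_self_eq_norm_sq_to_K, norm_pow, RCLike.norm_ofReal, abs_norm] at h1
  have h2 : ‖x‖ / ‖B x‖ * ‖B x‖ ^ 2 = ‖B x‖ * ‖x‖ := by
    field_simp
  rw [h2] at h1
  refine le_of_mul_le_mul_right (h1.trans_eq ?_) hxn
  ring

theorem constCB_sector_le (hα : 0 < α) (hα2 : α ≤ Real.pi / 2) :
    constCB.{u} (sector c θ α) ≤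
      ENNReal.ofReal ((Real.pi - α) / Real.pi) * constN (sector c θ α) := by
  have hpi := Real.pi_pos
  refine sSup_le ?_
  rintro _ ⟨H, _, _, _, A, m, n, R, hA, hR, rfl⟩
  have hfin : constN (sector c θ α) ≠ ⊤ :=
    ((constN_sector_le hα hα2).trans_lt ENNReal.ofReal_lt_top).ne
  refine (ENNReal.ofReal_le_ofReal (norm_blockOperator_le hα hα2 hA hR)).trans_eq ?_
  have : 0 < Real.pi - α := by linarith
  rw [ENNReal.ofReal_mul (by positivity), ENNReal.ofReal_toReal hfin]

end CompleteBound

theorem mainTheorem7 :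
    (∀ (c : ℂ) (θ α : ℝ), 0 < α → α ≤ Real.pi / 2 →
      IsNeumannInvertible (sector c θ α) ∧
      constN (sector c θ α) ≤ ENNReal.ofReal
        (2 - 2 / Real.pi * Real.log (Real.tan (α * Real.pi / (4 * (Real.pi - α))))) ∧
      constCB.{u} (sector c θ α) ≤
        ENNReal.ofReal ((Real.pi - α) / Real.pi) * constN (sector c θ α)) ∧
    ∃ K : ℝ, ∀ (c : ℂ) (θ α : ℝ), 0 < α → α ≤ Real.pi / 2 →
      |(constN (sector c θ α)).toReal - 2 / Real.pi * Real.log (1 / α)| ≤ K :=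
  ⟨fun _ _ _ hα hα2 => ⟨isNeumannInvertible_sector hα hα2, constN_sector_le hα hα2,
    constCB_sector_le hα hα2⟩, exists_asymptotic_bound⟩
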